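/- Setting. Let $\tilde\Omega\subset\mathbb R^2$ be a simply-connected region with a finite quadrangulation into strictly convex quadrilaterals such that two distinct elements have empty intersection, a common vertex or a common edge. The valence of a vertex is the number of mesh edges at it. An edge is inner if it belongs to two elements and a boundary edge otherwise; a vertex is a boundary vertex if it lies on a boundary edge, otherwise inner; a corner is a boundary vertex of valence 2. The mesh is assumed to satisfy: boundary vertices have valence 2 or 3; an inner edge has at most one boundary vertex; and (Uniform Edge Distribution Condition) if an even vertex of valence $\ge 6$ has two pairs of colinear edges, the remaining edges at it do not all lie in the same quadrant formed by the two lines containing these pairs. Each element is parametrised bilinearly over $[0,1]^2$. $\mathrm{FUN}^{(4)}$ is the space of surfaces over this parametrisation whose height is $C^1$ as a function on $\tilde\Omega$ and on each element is a tensor-product Bézier polynomial of degree 4 in the parameters. $\mathrm{CP}^{(4)}\subset\mathbb R^2$ is the set of planar control points of all elements after elevation of the bilinear parametrisation to degree 4. A set $D\subseteq\mathrm{CP}^{(4)}$ is determining if a surface of $\mathrm{FUN}^{(4)}$ vanishes as soon as its $Z$-components at the points of $D$ vanish; a minimal determining set (MDS) is a determining set of smallest size. Its points are called basic, the other control points dependent.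 An "additional" constraint fixes a set $S\subseteq\mathrm{CP}^{(4)}$. An MDS $M$ fits it if every $P\in S$ belongs to $M$ or depends only on the fixed control points in $M$, that is, the $Z$-component at $P$ of a surface of $\mathrm{FUN}^{(4)}$ is determined by those at the points of $M\cap S$. Types of control points. For an edge $VW$: the $E$-point of $V$ is $V+\frac14(W-V)$ and the $D$-point of the edge is its midpoint; the $T$-point of $V$ in an element is the control point with index $(1,1)$ counted from $V$; the two side middle points of an inner edge are the control points next to the middle of the edge in the adjacent rows of its two elements. A vertex $V$ uses the $D$-point of an inner edge at $V$ if the two neighbouring edges at $V$ (the preceding and the following one in the cyclic order) are not colinear. A regular 4-vertex is an inner vertex of valence 4 whose edges form two colinear pairs. A boundary vertex is $D$-relevant (for $S$) if it is not a corner, its boundary edges are not colinear and both its $T$-points lie in $S$ (as for the clamped boundary condition). A vertex is $D$-relevant if it is such a boundary vertex, or an inner vertex of even valence that is not a regular 4-vertex. A set $M\subseteq\mathrm{CP}^{(4)}$ is assembled from the local templates (for $S$) if: (a) it contains every control point that neither lies on an inner edge nor in the row next to one; (b) for every non-corner vertex it contains the vertex and exactly two of its $E$-points, on non-colinear edges;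 (c) it contains no $T$-point of an inner odd vertex, exactly one $T$-point of an inner even vertex, exactly one $T$-point of a non-corner boundary vertex that is not $D$-relevant, and both $T$-points of a $D$-relevant boundary vertex; (d) each $D$-relevant vertex owns the $D$-point of one of its edges which it uses, different vertices own different $D$-points, the $D$-points of inner edges not in $M$ are exactly the owned ones, and the $D$-relevant vertices can be traversed in an order such that every vertex comes after the owners of the other owned $D$-points that it uses; (e) of the two side middle points of an inner edge $\gamma\gamma'$ it contains none, or exactly one if the Projections Relation $\frac{\mathrm{dist}(\rho)}{\mathrm{dist}(\rho')}=\frac{\mathrm{dist}(\lambda)}{\mathrm{dist}(\lambda')}$ holds, where dist is the distance to the line $\gamma\gamma'$ and $\lambda,\rho$ (resp. $\lambda',\rho'$) are the vertices of the two elements adjacent to $\gamma$ (resp. $\gamma'$) off that edge. Lemma. For every such mesh: (1) A "pure" MDS exists: there is an MDS of degree 4 assembled from the local templates (for $S=\emptyset$). (2) For every additional constraint $S\subseteq\mathrm{CP}^{(4)}$ for which there is no $D$-relevant boundary vertex, there is an MDS of degree 4 that fits $S$. It can moreover be chosen assembled from the local templates for $S$ whenever $S$ is of interpolation/boundary-condition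 type, meaning: apart from control points as in (a), $S$ contains only vertices, $E$-points, and $T$-points of non-corner boundary vertices; it contains an $E$-point of a non-corner vertex only together with that vertex; and it contains both $T$-points of a non-corner boundary vertex only together with that vertex and all its $E$-points. In particular, an MDS of degree 4 that fits the constraint and is assembled from the local templates always exists for every (vertex)[tangent plane][boundary curve]-interpolation problem ($S$ consists of all vertices and, optionally, of all $E$-points, and, optionally, of all control points on the boundary edges), and for the simply-supported boundary condition ($S$ consists of all control points on the boundary edges). -/

import Mathlib

/-- `Z`-coordinate of the cross product of two planar vectors. -/
def cross2 (a b : ℝ × ℝ) : ℝ := a.1 * b.2 - a.2 * b.1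

/-- A regular quadrangulation into strictly convex quadrilaterals. `V` indexes the vertices and
`F` the elements; `vert f 0, …, vert f 3` are the vertices of the element `f` in counter-clockwise
order (indices are read modulo `4`). -/
structure QuadMesh (V F : Type*) where
  pos : V → ℝ × ℝ
  vert : F → Fin 4 → V
  pos_injective : Function.Injective pos
  exists_vert : ∀ v, ∃ f k, vert f k = v
  /-- every element is strictly convex: it turns strictly to the left at each of its vertices -/
  strictConvex : ∀ f k,
    0 < cross2 (pos (vert f (k + 1)) - pos (vert f k)) (pos (vert f (k + 2)) - pos (vert f (k + 1)))
  /-- two elements have either an empty intersection, or a vertex, or an edge in common -/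
  regular : ∀ f g, f ≠ g →
    convexHull ℝ (Set.range fun k => pos (vert f k)) ∩
        convexHull ℝ (Set.range fun k => pos (vert g k)) = ∅ ∨
    (∃ k l, vert f k = vert g l ∧
      convexHull ℝ (Set.range fun k => pos (vert f k)) ∩
        convexHull ℝ (Set.range fun k => pos (vert g k)) = {pos (vert f k)}) ∨
    (∃ k l, s(vert f k, vert f (k + 1)) = s(vert g l, vert g (l + 1)) ∧
      convexHull ℝ (Set.range fun k => pos (vert f k)) ∩
        convexHull ℝ (Set.range fun k => pos (vert g k)) =
          segment ℝ (pos (vert f k)) (pos (vert f (k + 1))))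

namespace QuadMesh

variable {V F : Type*} (Q : QuadMesh V F)

/-! ### The planar mesh -/

/-- The closed planar region covered by the mesh. -/
def domain : Set (ℝ × ℝ) := ⋃ f, convexHull ℝ (Set.range fun k => Q.pos (Q.vert f k))

/-- The directed planar edge from `v` to `w`. -/
def dir (v w : V) : ℝ × ℝ := Q.pos w - Q.pos v

/-- The edge from `v` to `w` is a side of an element lying to the left of it. -/
def IsSide (v w : V) : Prop := ∃ f k, Q.vert f k = v ∧ Q.vert f (k + 1) = w

/-- `v` and `w` are joined by a mesh edge. -/
def Adj (v w : V) : Prop := Q.IsSide v w ∨ Q.IsSide w v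

/-- A mesh edge with an element on either side of it. -/
def IsInnerEdge (v w : V) : Prop := Q.IsSide v w ∧ Q.IsSide w v

/-- A mesh edge that belongs to a single element. -/
def IsBoundaryEdge (v w : V) : Prop := Q.Adj v w ∧ ¬ Q.IsInnerEdge v w

/-- Number of mesh edges at `v`. -/
noncomputable def valence (v : V) : ℕ := {w | Q.Adj v w}.ncard

def IsBoundaryVertex (v : V) : Prop := ∃ w, Q.IsBoundaryEdge v w

/-- A corner is a boundary vertex of valence `2`. -/
def IsCorner (v : V) : Prop := Q.IsBoundaryVertex v ∧ Q.valence v = 2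

/-- A regular `4`-vertex: an inner vertex of valence `4` whose edges form two colinear pairs. -/
def IsRegular4 (v : V) : Prop :=
  ¬ Q.IsBoundaryVertex v ∧ Q.valence v = 4 ∧
    ∀ w, Q.Adj v w → ∃ w', Q.Adj v w' ∧ w' ≠ w ∧ cross2 (Q.dir v w) (Q.dir v w') = 0

/-- The "Uniform Edge Distribution Condition": if an even vertex of valence at least `6` has two
pairs of colinear edges `va, va'` and `vb, vb'`, then the remaining edges do not all belong to the
same quadrant (the roles of `a, a'` and of `b, b'` can be exchanged, so that the quadrant spanned
by `va` and `vb` is any of the four). -/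
def UniformEdgeDistribution : Prop :=
  ∀ v, Even (Q.valence v) → 6 ≤ Q.valence v → ∀ a a' b b',
    Q.Adj v a → Q.Adj v a' → Q.Adj v b → Q.Adj v b' → [a, a', b, b'].Nodup →
    cross2 (Q.dir v a) (Q.dir v a') = 0 → cross2 (Q.dir v b) (Q.dir v b') = 0 →
    ∃ w, Q.Adj v w ∧ w ∉ [a, a', b, b'] ∧
      ¬ ∃ s t : ℝ, 0 ≤ s ∧ 0 ≤ t ∧ Q.dir v w = s • Q.dir v a + t • Q.dir v b

/-- The standing limitations on the mesh (besides strict convexity of the elements). -/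
structure Limitations : Prop where
  boundary_valence : ∀ v, Q.IsBoundaryVertex v → Q.valence v = 2 ∨ Q.valence v = 3
  inner_edge : ∀ v w, Q.IsInnerEdge v w → ¬ (Q.IsBoundaryVertex v ∧ Q.IsBoundaryVertex w)
  uniform : Q.UniformEdgeDistribution

/-! ### Bilinear parametrisation, control points, smooth surfaces -/

/-- The bilinear parametrisation of the element `f`, with the origin of the parameter square placed
at the corner number `k`, the first parameter running towards the next corner in counter-clockwise
order and the second one towards the previous corner. -/
def param (f : F) (k : Fin 4) (s t : ℝ) : ℝ × ℝ :=
  ((1 - s) * (1 - t)) • Q.pos (Q.vert f k) + (s * (1 - t)) • Q.pos (Q.vert f (k + 1)) +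
    (s * t) • Q.pos (Q.vert f (k + 2)) + ((1 - s) * t) • Q.pos (Q.vert f (k + 3))

/-- The planar control point number `(i, j)` of the element `f` (counted from the corner `k`) after
elevation of the bilinear parametrisation to degree `n`; see `param_eq_sum` below. -/
noncomputable def cpt (n : ℕ) (f : F) (k : Fin 4) (i j : ℕ) : ℝ × ℝ :=
  Q.param f k ((i : ℝ) / n) ((j : ℝ) / n)

/-- The points `cpt n f k i j` are the control points of the bilinear parametrisation after degree
elevation: they are its Bézier coefficients of degree `n`. -/
theorem param_eq_sum {n : ℕ} (hn : n ≠ 0) (f : F) (k : Fin 4) (s t : ℝ) :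
    Q.param f k s t = ∑ i ∈ Finset.range (n + 1), ∑ j ∈ Finset.range (n + 1),
      ((bernsteinPolynomial ℝ n i).eval s * (bernsteinPolynomial ℝ n j).eval t) •
        Q.cpt n f k i j := by
  have hn' : (n : ℝ) ≠ 0 := Nat.cast_ne_zero.mpr hn
  have h0 : ∀ x : ℝ, ∑ i ∈ Finset.range (n + 1), (bernsteinPolynomial ℝ n i).eval x = 1 := by
    intro x
    have := congrArg (Polynomial.eval x) (bernsteinPolynomial.sum ℝ n)
    simpa [Polynomial.eval_finsetSum] using this
  have h1 : ∀ x : ℝ, ∑ i ∈ Finset.range (n + 1),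
      (bernsteinPolynomial ℝ n i).eval x * ((i : ℝ) / n) = x := by
    intro x
    have := congrArg (Polynomial.eval x) (bernsteinPolynomial.sum_smul ℝ n)
    simp only [Polynomial.eval_finsetSum, nsmul_eq_mul, Polynomial.eval_mul, Polynomial.eval_natCast,
      Polynomial.eval_X] at this
    calc _ = (∑ i ∈ Finset.range (n + 1), (i : ℝ) * (bernsteinPolynomial ℝ n i).eval x) / n := by
          rw [Finset.sum_div]; exact Finset.sum_congr rfl fun i _ => by ring
      _ = x := by rw [this]; field_simp
  have key : ∀ a b c d : ℝ,
      ((1 - s) * (1 - t)) * a + (s * (1 - t)) * b + (s * t) * c + ((1 - s) * t) * d =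
      ∑ i ∈ Finset.range (n + 1), ∑ j ∈ Finset.range (n + 1),
        ((bernsteinPolynomial ℝ n i).eval s * (bernsteinPolynomial ℝ n j).eval t) *
        (((1 - (i : ℝ) / n) * (1 - (j : ℝ) / n)) * a + ((i : ℝ) / n * (1 - (j : ℝ) / n)) * b +
          ((i : ℝ) / n * ((j : ℝ) / n)) * c + ((1 - (i : ℝ) / n) * ((j : ℝ) / n)) * d) := by
    intro a b c d
    have hj : ∀ p q : ℝ, ∑ j ∈ Finset.range (n + 1), (bernsteinPolynomial ℝ n j).eval t *
        (p + (j : ℝ) / n * q) = p + t * q := by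
      intro p q
      calc _ = (∑ j ∈ Finset.range (n + 1), (bernsteinPolynomial ℝ n j).eval t) * p +
            (∑ j ∈ Finset.range (n + 1), (bernsteinPolynomial ℝ n j).eval t * ((j : ℝ) / n)) * q := by
            rw [Finset.sum_mul, Finset.sum_mul, ← Finset.sum_add_distrib]
            exact Finset.sum_congr rfl fun i _ => by ring
        _ = _ := by rw [h0, h1]; ring
    have hi : ∀ p q : ℝ, ∑ i ∈ Finset.range (n + 1), (bernsteinPolynomial ℝ n i).eval s *
        (p + (i : ℝ) / n * q) = p + s * q := by
      intro p q
      calc _ = (∑ j ∈ Finset.range (n + 1), (bernsteinPolynomial ℝ n j).eval s) * p +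
            (∑ j ∈ Finset.range (n + 1), (bernsteinPolynomial ℝ n j).eval s * ((j : ℝ) / n)) * q := by
            rw [Finset.sum_mul, Finset.sum_mul, ← Finset.sum_add_distrib]
            exact Finset.sum_congr rfl fun i _ => by ring
        _ = _ := by rw [h0, h1]; ring
    symm
    calc _ = ∑ i ∈ Finset.range (n + 1), (bernsteinPolynomial ℝ n i).eval s *
          ((a + t * (d - a)) + (i : ℝ) / n * ((b - a) + t * (a - b + c - d))) := by
          refine Finset.sum_congr rfl fun i _ => ?_
          rw [show (a + t * (d - a)) + (i : ℝ) / n * ((b - a) + t * (a - b + c - d)) =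
            (a + (i : ℝ) / n * (b - a)) + t * ((d - a) + (i : ℝ) / n * (a - b + c - d)) by ring,
            ← hj, Finset.mul_sum]
          exact Finset.sum_congr rfl fun j _ => by ring
      _ = _ := by rw [hi]; ring
  ext
  · simpa [param, cpt, Prod.fst_sum, mul_add] using key (Q.pos (Q.vert f k)).1 (Q.pos (Q.vert f (k + 1))).1
      (Q.pos (Q.vert f (k + 2))).1 (Q.pos (Q.vert f (k + 3))).1
  · simpa [param, cpt, Prod.snd_sum, mul_add] using key (Q.pos (Q.vert f k)).2 (Q.pos (Q.vert f (k + 1))).2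
      (Q.pos (Q.vert f (k + 2))).2 (Q.pos (Q.vert f (k + 3))).2

/-- The set of planar control points of degree `n` of all the elements. -/
def CP (n : ℕ) : Set (ℝ × ℝ) :=
  {P | ∃ f, ∃ i ≤ n, ∃ j ≤ n, P = Q.cpt n f 0 i j}

/-- Control points that take part in the smoothness conditions: those which lie on an inner edge or
in the row next to it. -/
def GCP (n : ℕ) : Set (ℝ × ℝ) :=
  {P | ∃ f k, Q.IsInnerEdge (Q.vert f k) (Q.vert f (k + 1)) ∧
    ∃ i ≤ n, ∃ j ≤ 1, P = Q.cpt n f k i j}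

/-- Control points that do not take part in the smoothness conditions. -/
def FCP (n : ℕ) : Set (ℝ × ℝ) := Q.CP n \ Q.GCP n

/-- The function `z` on the domain is, on every element, the tensor-product Bézier polynomial of
degree `n` in the bilinear parameters whose coefficient at each control point `P` is `Z P`. -/
def HasNet (n : ℕ) (z Z : ℝ × ℝ → ℝ) : Prop :=
  ∀ f, ∀ s ∈ Set.Icc (0 : ℝ) 1, ∀ t ∈ Set.Icc (0 : ℝ) 1,
    z (Q.param f 0 s t) =
      ∑ i ∈ Finset.range (n + 1), ∑ j ∈ Finset.range (n + 1),
        Z (Q.cpt n f 0 i j) *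
          ((bernsteinPolynomial ℝ n i).eval s * (bernsteinPolynomial ℝ n j).eval t)

/-- The space of piecewise parametric surfaces of degree `n` over the bilinear parametrisation that
are `C¹` as functions on the domain; a surface is represented by its height function. -/
def FUN (n : ℕ) : Set (ℝ × ℝ → ℝ) :=
  {z | ContDiffOn ℝ 1 z Q.domain ∧ ∃ Z, Q.HasNet n z Z}

/-- `D` is a determining set of control points. -/
def IsDetermining (n : ℕ) (D : Set (ℝ × ℝ)) : Prop :=
  D ⊆ Q.CP n ∧ ∀ z ∈ Q.FUN n, ∀ Z, Q.HasNet n z Z → (∀ P ∈ D, Z P = 0) → ∀ x ∈ Q.domain, z x = 0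

/-- `M` is a minimal determining set: a determining set of the smallest size. -/
def IsMDS (n : ℕ) (M : Set (ℝ × ℝ)) : Prop :=
  Q.IsDetermining n M ∧ ∀ D, Q.IsDetermining n D → M.ncard ≤ D.ncard

/-- The `Z`-component of the control point `P` depends, on the space of smooth surfaces, only on
the `Z`-components of the control points of `A` (it vanishes as soon as those do; by linearity it is
then a linear function of them). -/
def DependsOnly (n : ℕ) (P : ℝ × ℝ) (A : Set (ℝ × ℝ)) : Prop :=
  ∀ z ∈ Q.FUN n, ∀ Z, Q.HasNet n z Z → (∀ P' ∈ A, Z P' = 0) → Z P = 0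

/-- `M` fits an "additional" constraint that fixes the control points of `S`: every fixed control
point belongs to `M` or depends only on fixed control points that belong to `M`. -/
def Fits (n : ℕ) (S M : Set (ℝ × ℝ)) : Prop :=
  ∀ P ∈ S, P ∈ M ∨ Q.DependsOnly n P (M ∩ S)

/-! ### Types of control points (degree `4`) -/

/-- `E`-type control point of `v` on the edge to `w`: the first one after `v`. -/
noncomputable def ptE (v w : V) : ℝ × ℝ := Q.pos v + (1 / 4 : ℝ) • Q.dir v w

/-- `D`-type control point of `v` on the edge to `w`: the second one after `v`. In degree `4` it is
the `D`-type control point of `w` as well. -/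
noncomputable def ptD (v w : V) : ℝ × ℝ := Q.pos v + (2 / 4 : ℝ) • Q.dir v w

/-- `T`-type control point of the vertex `vert f k` in the element `f`. -/
noncomputable def ptT (f : F) (k : Fin 4) : ℝ × ℝ := Q.cpt 4 f k 1 1

/-- "Side" middle control point of the element `f` next to its edge from corner `k` to `k + 1`. -/
noncomputable def ptM (f : F) (k : Fin 4) : ℝ × ℝ := Q.cpt 4 f k 2 1

/-- The `D`-type control point of the inner edge `e` from `v` to `w` enters the twist equation of
this edge at `v` with a non-zero coefficient `⟨e⁻, e⁺⟩ / (⟨e⁻, e⟩ ⟨e, e⁺⟩)`, where `e⁻` and `e⁺`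
are the edges at `v` just before and just after `e` in counter-clockwise order. -/
def Uses (v w : V) : Prop :=
  ∃ f k g l, Q.vert f k = v ∧ Q.vert f (k + 1) = w ∧ Q.vert g l = v ∧ Q.vert g (l + 3) = w ∧
    cross2 (Q.dir v (Q.vert g (l + 1))) (Q.dir v (Q.vert f (k + 3))) /
      (cross2 (Q.dir v (Q.vert g (l + 1))) (Q.dir v w) *
        cross2 (Q.dir v w) (Q.dir v (Q.vert f (k + 3)))) ≠ 0

/-- "Projections Relation" for the inner edge from `γ` to `γ'` with the element `f` (vertices
`γ, γ', λ', λ`) on the left and `g` (vertices `γ', γ, ρ, ρ'`) on the right: the quotient of the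
distances of `ρ, ρ'` from the line `γγ'` equals that of the distances of `λ, λ'`. (The distance of
`x` is `|⟨γ' - γ, x - γ⟩| / ‖γ' - γ‖`; the denominator and the signs cancel.) -/
def ProjectionsRelation (f : F) (k : Fin 4) (g : F) (l : Fin 4) : Prop :=
  let e := Q.dir (Q.vert f k) (Q.vert f (k + 1))
  cross2 e (Q.dir (Q.vert f k) (Q.vert g (l + 2))) /
      cross2 e (Q.dir (Q.vert f k) (Q.vert g (l + 3))) =
    cross2 e (Q.dir (Q.vert f k) (Q.vert f (k + 3))) /
      cross2 e (Q.dir (Q.vert f k) (Q.vert f (k + 2)))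

/-! ### `D`-relevant vertices and instances of the MDS assembled from local templates -/

/-- `v` is a `D`-relevant boundary vertex for the constraint that fixes the control points of `S`:
a non-corner boundary vertex with non-colinear boundary edges at which all (that is, both) `T`-type
control points are fixed, as under the clamped boundary condition. At such a vertex the `D`-type
control point has to be chosen as a dependent one. -/
def IsDRelevantBoundary (S : Set (ℝ × ℝ)) (v : V) : Prop :=
  Q.IsBoundaryVertex v ∧ ¬ Q.IsCorner v ∧
    (∃ a b, Q.IsBoundaryEdge v a ∧ Q.IsBoundaryEdge v b ∧ a ≠ b ∧
      cross2 (Q.dir v a) (Q.dir v b) ≠ 0) ∧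
    ∀ f k, Q.vert f k = v → Q.ptT f k ∈ S

/-- `D`-relevant vertices: inner even vertices other than regular `4`-vertices, and `D`-relevant
boundary vertices. -/
def IsDRelevant (S : Set (ℝ × ℝ)) (v : V) : Prop :=
  (¬ Q.IsBoundaryVertex v ∧ Even (Q.valence v) ∧ ¬ Q.IsRegular4 v) ∨ Q.IsDRelevantBoundary S v

/-- Global classification of the control points of degree `4` into basic ones (the elements of `M`)
and dependent ones that puts together the local templates, for a constraint that fixes the control
points of `S`. -/
structure IsTemplateInstance (S M : Set (ℝ × ℝ)) : Prop where
  subset : M ⊆ Q.CP 4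
  /-- control points that take no part in the smoothness conditions are basic -/
  free : Q.FCP 4 ⊆ M
  /-- `V`, `E`-template: the vertex and exactly two `E`-type points, on non-colinear edges -/
  vertex : ∀ v, ¬ Q.IsCorner v → Q.pos v ∈ M
  tangent : ∀ v, ¬ Q.IsCorner v → ∃ a b, Q.Adj v a ∧ Q.Adj v b ∧
    cross2 (Q.dir v a) (Q.dir v b) ≠ 0 ∧ ∀ w, Q.Adj v w → (Q.ptE v w ∈ M ↔ w = a ∨ w = b)
  /-- inner odd vertex: every `T`-type point is dependent -/
  twist_odd : ∀ v, ¬ Q.IsBoundaryVertex v → Odd (Q.valence v) →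
    ∀ f k, Q.vert f k = v → Q.ptT f k ∉ M
  /-- inner even vertex: exactly one `T`-type point is basic -/
  twist_even : ∀ v, ¬ Q.IsBoundaryVertex v → Even (Q.valence v) →
    ∃! c : F × Fin 4, Q.vert c.1 c.2 = v ∧ Q.ptT c.1 c.2 ∈ M
  /-- non-corner boundary vertex: exactly one `T`-type point is basic, or both of them if the vertex
  is `D`-relevant -/
  twist_boundary : ∀ v, Q.IsBoundaryVertex v → ¬ Q.IsCorner v → ¬ Q.IsDRelevantBoundary S v →
    ∃! c : F × Fin 4, Q.vert c.1 c.2 = v ∧ Q.ptT c.1 c.2 ∈ M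
  twist_relevant : ∀ v, Q.IsDRelevantBoundary S v → ∀ f k, Q.vert f k = v → Q.ptT f k ∈ M
  /-- every `D`-relevant vertex `v` owns the `D`-type point of one of its edges `v (d v)`, which it
  uses; different vertices own different points; the dependent `D`-type points are those which
  are owned; and there is an order of traversal (by `rank`) in which, whenever a vertex is treated,
  all the other dependent `D`-type points that it uses have been treated before -/
  dpoints : ∃ (d : V → V) (rank : V → ℕ),
    (∀ v, Q.IsDRelevant S v → Q.Uses v (d v)) ∧
    (∀ v w, Q.IsDRelevant S v → Q.IsDRelevant S w → s(v, d v) = s(w, d w) → v = w) ∧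
    (∀ v w, Q.IsInnerEdge v w →
      (Q.ptD v w ∉ M ↔ ∃ x, Q.IsDRelevant S x ∧ s(x, d x) = s(v, w))) ∧
    (∀ v w x, Q.IsDRelevant S v → Q.Uses v w → Q.IsDRelevant S x → x ≠ v →
      s(x, d x) = s(v, w) → rank x < rank v)
  /-- middle template of an inner edge: none of the two "side" middle points is basic, or exactly
  one if the "Projections Relation" holds -/
  middle : ∀ f k g l, Q.vert f k = Q.vert g (l + 1) → Q.vert f (k + 1) = Q.vert g l →
    (¬ Q.ProjectionsRelation f k g l → Q.ptM f k ∉ M ∧ Q.ptM g l ∉ M) ∧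
    (Q.ProjectionsRelation f k g l → Xor (Q.ptM f k ∈ M) (Q.ptM g l ∈ M))

/-! ### Constraints -/

/-- The constraints of interpolation and boundary-condition type: apart from control points that
take no part in the smoothness conditions, only `V`-type and `E`-type points and `T`-type points of
non-corner boundary vertices are fixed; an `E`-type point of a non-corner vertex is fixed only
together with the vertex, and all `T`-type points of a non-corner boundary vertex only together with
the vertex and its `E`-type points. -/
structure IsStandardConstraint (S : Set (ℝ × ℝ)) : Prop where
  kinds : ∀ P ∈ S, P ∈ Q.GCP 4 →
    (∃ v, P = Q.pos v) ∨ (∃ v w, Q.Adj v w ∧ P = Q.ptE v w) ∨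
    (∃ f k, Q.IsBoundaryVertex (Q.vert f k) ∧ ¬ Q.IsCorner (Q.vert f k) ∧ P = Q.ptT f k)
  tangent : ∀ v w, ¬ Q.IsCorner v → Q.Adj v w → Q.ptE v w ∈ S → Q.pos v ∈ S
  twist : ∀ v, Q.IsBoundaryVertex v → ¬ Q.IsCorner v → (∀ f k, Q.vert f k = v → Q.ptT f k ∈ S) →
    Q.pos v ∈ S ∧ ∀ w, Q.Adj v w → Q.ptE v w ∈ S

/-- Control points lying on the global boundary: those fixed by a simply-supported boundary condition
or by interpolation of a boundary curve. -/
def boundaryPoints (n : ℕ) : Set (ℝ × ℝ) :=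
  {P | ∃ f k, Q.IsBoundaryEdge (Q.vert f k) (Q.vert f (k + 1)) ∧ ∃ i ≤ n, P = Q.cpt n f k i 0}

/-- Control points fixed by a (vertex)-interpolation problem, with (tangent plane)-interpolation if
`tangentPlane` and with (boundary curve)-interpolation if `boundaryCurve`. -/
def interpolationPoints (tangentPlane boundaryCurve : Prop) : Set (ℝ × ℝ) :=
  {P | (∃ v, P = Q.pos v) ∨ (tangentPlane ∧ ∃ v w, Q.Adj v w ∧ P = Q.ptE v w) ∨
    (boundaryCurve ∧ P ∈ Q.boundaryPoints 4)}

end QuadMesh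

/-! ### The cross product -/

/-! A surface is replaced by its net of control values. Along an inner edge the gradients of the two
adjacent patches agree exactly when a certain combination of the rows of control values is the zero
polynomial of degree 5 (`edgeEq_sum`), which amounts to six linear equations. The two outer ones
hold as soon as there are tangent planes at the endpoints; the other four are a twist equation and a
middle equation for each end. Nets satisfying all of this form a finite-dimensional space
`smoothNets`, and they are precisely the nets of C¹ surfaces: `isSmoothNet_of_mem_FUN` reads the
equations off a gradient, and `IsSmoothNet.exists_mem_FUN` glues the gradients of the patches.

Minimality is a dimension count. Restriction to a determining set is injective on `smoothNets`, so
such a set has at least as many points as the dimension (`finrank_smoothNets_le`). For the set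
`TemplateChoice.basic`, the dependent points are matched one to one with equations that already
imply smoothness (`isSmoothNet_of_equations`), so it has at most that many points; and it is
determining by `TemplateChoice.eq_zero`.

Locally, measured from the tangent plane and normalised, the twist values of two consecutive corners
at a vertex add up to a multiple of the offset of the D-point between them (`edgeEq_one`). Around an
odd inner vertex this determines every T-point. Around an even one a T-point stays free and the
alternating sum becomes a condition on D-points, which makes a used D-point dependent; at a regular
4-vertex all coefficients vanish and one equation is redundant. The two middle equations of an edge
form a system whose determinant vanishes exactly under the Projections Relation, and then one of
them is redundant.

The global difficulty is to distribute the dependent D-points without conflict. Order the plane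
lexicographically. By the Uniform Edge Distribution Condition every even inner vertex that is not a
regular 4-vertex has a used edge pointing into the positive half-plane (`exists_uses_lexPos`). If
each vertex owns such an edge, no edge has two owners, and the lexicographic order of the vertices
is an admissible order of traversal. The argument relies on the corners at an inner vertex forming a
single cycle (`next_sameCycle`).

For an arbitrary constraint a fitting MDS is a basis extension of evaluation functionals
(`exists_isMDS_fits`). For a standard constraint the template choices prefer fixed points, and
`TemplateChoice.fits` applies. -/

theorem cross2_self (a : ℝ × ℝ) : cross2 a a = 0 := by simp only [cross2]; ring

theorem cross2_comm (a b : ℝ × ℝ) : cross2 a b = -cross2 b a := by simp only [cross2]; ring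

theorem cross2_neg_left (a b : ℝ × ℝ) : cross2 (-a) b = -cross2 a b := by
  simp only [cross2, Prod.fst_neg, Prod.snd_neg]; ring

theorem cross2_neg_right (a b : ℝ × ℝ) : cross2 a (-b) = -cross2 a b := by
  simp only [cross2, Prod.fst_neg, Prod.snd_neg]; ring

theorem cross2_add_left (a b c : ℝ × ℝ) : cross2 (a + b) c = cross2 a c + cross2 b c := by
  simp only [cross2, Prod.fst_add, Prod.snd_add]; ring

theorem cross2_add_right (a b c : ℝ × ℝ) : cross2 a (b + c) = cross2 a b + cross2 a c := by
  simp only [cross2, Prod.fst_add, Prod.snd_add]; ring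

theorem cross2_smul_left (r : ℝ) (a b : ℝ × ℝ) : cross2 (r • a) b = r * cross2 a b := by
  simp only [cross2, Prod.smul_fst, Prod.smul_snd, smul_eq_mul]; ring

theorem cross2_smul_right (r : ℝ) (a b : ℝ × ℝ) : cross2 a (r • b) = r * cross2 a b := by
  simp only [cross2, Prod.smul_fst, Prod.smul_snd, smul_eq_mul]; ring

/-- The linear relation between three planar vectors. -/
theorem cross2_smul_add_smul_add_smul (a b c : ℝ × ℝ) :
    cross2 a b • c + cross2 b c • a + cross2 c a • b = 0 := by
  ext <;> simp only [cross2, Prod.fst_add, Prod.snd_add, Prod.smul_fst, Prod.smul_snd, smul_eq_mul,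
    Prod.fst_zero, Prod.snd_zero] <;> ring

theorem eq_smul_add_smul_of_cross2_ne_zero {a b : ℝ × ℝ} (h : cross2 a b ≠ 0) (c : ℝ × ℝ) :
    c = (cross2 c b / cross2 a b) • a + (cross2 a c / cross2 a b) • b := by
  ext <;> simp only [Prod.fst_add, Prod.snd_add, Prod.smul_fst, Prod.smul_snd, smul_eq_mul] <;>
    field_simp <;> simp only [cross2] <;> ring

theorem exists_smul_eq_of_cross2_eq_zero {a b : ℝ × ℝ} (ha : a ≠ 0) (h : cross2 a b = 0) :
    ∃ r : ℝ, b = r • a := by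
  simp only [cross2] at h
  by_cases h1 : a.1 = 0
  · have h2 : a.2 ≠ 0 := fun h2 => ha (Prod.ext h1 h2)
    refine ⟨b.2 / a.2, ?_⟩
    ext <;> simp only [Prod.smul_fst, Prod.smul_snd, smul_eq_mul] <;> field_simp
    rw [h1] at h ⊢
    simp only [zero_mul, zero_sub, neg_eq_zero, mul_eq_zero, h2, false_or] at h
    simp [h]
  · refine ⟨b.1 / a.1, ?_⟩
    ext <;> simp only [Prod.smul_fst, Prod.smul_snd, smul_eq_mul] <;> field_simp
    linarith

/-! ### A single strictly convex quadrilateral -/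

/-- The four triangles spanned by consecutive vertices are positively oriented. -/
structure ConvexQuad (p₀ p₁ p₂ p₃ : ℝ × ℝ) : Prop where
  t₀ : 0 < cross2 (p₁ - p₀) (p₃ - p₀)
  t₁ : 0 < cross2 (p₁ - p₀) (p₂ - p₀)
  t₂ : 0 < cross2 (p₂ - p₁) (p₃ - p₁)
  t₃ : 0 < cross2 (p₂ - p₀) (p₃ - p₀)

/-- Bilinear interpolation of four points. -/
def bilinear (p₀ p₁ p₂ p₃ : ℝ × ℝ) (s t : ℝ) : ℝ × ℝ :=
  ((1 - s) * (1 - t)) • p₀ + (s * (1 - t)) • p₁ + (s * t) • p₂ + ((1 - s) * t) • p₃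

def bilinearS (p₀ p₁ p₂ p₃ : ℝ × ℝ) (t : ℝ) : ℝ × ℝ := (1 - t) • (p₁ - p₀) + t • (p₂ - p₃)

def bilinearT (p₀ p₁ p₂ p₃ : ℝ × ℝ) (s : ℝ) : ℝ × ℝ := (1 - s) • (p₃ - p₀) + s • (p₂ - p₁)

/-- An exact mean value formula: a secant is expressed by the two partial derivatives at the
parameter midpoint. It turns positivity of the Jacobian into injectivity. -/
theorem bilinear_sub (p₀ p₁ p₂ p₃ : ℝ × ℝ) (s t s' t' : ℝ) :
    bilinear p₀ p₁ p₂ p₃ s t - bilinear p₀ p₁ p₂ p₃ s' t' =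
      (s - s') • bilinearS p₀ p₁ p₂ p₃ ((t + t') / 2) +
        (t - t') • bilinearT p₀ p₁ p₂ p₃ ((s + s') / 2) := by
  ext <;> simp only [bilinear, bilinearS, bilinearT, Prod.fst_add, Prod.snd_add, Prod.fst_sub,
    Prod.snd_sub, Prod.smul_fst, Prod.smul_snd, smul_eq_mul] <;> ring

/-- A convex combination of two positive numbers is positive. -/
theorem combo_pos {a b s : ℝ} (ha : 0 < a) (hb : 0 < b) (hs : s ∈ Set.Icc (0 : ℝ) 1) :
    0 < (1 - s) * a + s * b := by
  rcases hs.1.eq_or_lt with h | h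
  · simpa [← h]
  · have := mul_nonneg (sub_nonneg.mpr hs.2) ha.le
    have := mul_pos h hb
    linarith

namespace ConvexQuad

variable {p₀ p₁ p₂ p₃ : ℝ × ℝ} (h : ConvexQuad p₀ p₁ p₂ p₃)
include h

/-- The Jacobian is affine in each parameter, and its values at the four corners of the square are
the four triangle orientations. -/
theorem jacobian_pos {s t : ℝ} (hs : s ∈ Set.Icc (0 : ℝ) 1) (ht : t ∈ Set.Icc (0 : ℝ) 1) :
    0 < cross2 (bilinearS p₀ p₁ p₂ p₃ t) (bilinearT p₀ p₁ p₂ p₃ s) := by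
  have e : cross2 (bilinearS p₀ p₁ p₂ p₃ t) (bilinearT p₀ p₁ p₂ p₃ s) =
      (1 - t) * ((1 - s) * cross2 (p₁ - p₀) (p₃ - p₀) + s * cross2 (p₁ - p₀) (p₂ - p₀)) +
        t * ((1 - s) * cross2 (p₂ - p₀) (p₃ - p₀) + s * cross2 (p₂ - p₁) (p₃ - p₁)) := by
    simp only [bilinearS, bilinearT, cross2, Prod.fst_add, Prod.snd_add, Prod.fst_sub,
      Prod.snd_sub, Prod.smul_fst, Prod.smul_snd, smul_eq_mul]
    ring
  rw [e]
  exact combo_pos (combo_pos h.t₀ h.t₁ hs) (combo_pos h.t₃ h.t₂ hs) ht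

theorem bilinear_injective {s t s' t' : ℝ} (hs : s ∈ Set.Icc (0 : ℝ) 1)
    (ht : t ∈ Set.Icc (0 : ℝ) 1) (hs' : s' ∈ Set.Icc (0 : ℝ) 1) (ht' : t' ∈ Set.Icc (0 : ℝ) 1)
    (e : bilinear p₀ p₁ p₂ p₃ s t = bilinear p₀ p₁ p₂ p₃ s' t') : s = s' ∧ t = t' := by
  have hj := h.jacobian_pos (s := (s + s') / 2) (t := (t + t') / 2)
    ⟨by linarith [hs.1, hs'.1], by linarith [hs.2, hs'.2]⟩
    ⟨by linarith [ht.1, ht'.1], by linarith [ht.2, ht'.2]⟩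
  have hd := bilinear_sub p₀ p₁ p₂ p₃ s t s' t'
  rw [e, sub_self] at hd
  set a := bilinearS p₀ p₁ p₂ p₃ ((t + t') / 2)
  set b := bilinearT p₀ p₁ p₂ p₃ ((s + s') / 2)
  have h1 : cross2 ((s - s') • a + (t - t') • b) b = 0 := by rw [← hd]; simp [cross2]
  have h2 : cross2 a ((s - s') • a + (t - t') • b) = 0 := by rw [← hd]; simp [cross2]
  rw [cross2_add_left, cross2_smul_left, cross2_smul_left, cross2_self, mul_zero, add_zero] at h1
  rw [cross2_add_right, cross2_smul_right, cross2_smul_right, cross2_self, mul_zero, zero_add] at h2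
  constructor
  · have := (mul_eq_zero.mp h1).resolve_right hj.ne'
    linarith
  · have := (mul_eq_zero.mp h2).resolve_right hj.ne'
    linarith

/-- The lines `s = const` sweep the quadrilateral from side `p₀p₃` to side `p₁p₂`, so by the
intermediate value theorem one of them passes through `x`. The other two sides then bound `t`. -/
theorem exists_bilinear_eq {x : ℝ × ℝ} (h0 : 0 ≤ cross2 (p₁ - p₀) (x - p₀))
    (h1 : 0 ≤ cross2 (p₂ - p₁) (x - p₁)) (h2 : 0 ≤ cross2 (p₃ - p₂) (x - p₂))
    (h3 : 0 ≤ cross2 (p₀ - p₃) (x - p₃)) :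
    ∃ s ∈ Set.Icc (0 : ℝ) 1, ∃ t ∈ Set.Icc (0 : ℝ) 1, x = bilinear p₀ p₁ p₂ p₃ s t := by
  let φ : ℝ → ℝ := fun s => cross2 (bilinearT p₀ p₁ p₂ p₃ s) (x - bilinear p₀ p₁ p₂ p₃ s 0)
  have hφ : Continuous φ := by
    simp only [φ, cross2, bilinearT, bilinear]
    fun_prop
  have hφ0 : φ 0 ≤ 0 := by
    have : φ 0 = -cross2 (p₀ - p₃) (x - p₃) := by
      simp only [φ, bilinearT, bilinear, cross2, Prod.fst_add, Prod.snd_add, Prod.fst_sub,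
        Prod.snd_sub, Prod.smul_fst, Prod.smul_snd, smul_eq_mul]
      ring
    linarith
  have hφ1 : 0 ≤ φ 1 := by
    have : φ 1 = cross2 (p₂ - p₁) (x - p₁) := by
      simp only [φ, bilinearT, bilinear, cross2, Prod.fst_add, Prod.snd_add, Prod.fst_sub,
        Prod.snd_sub, Prod.smul_fst, Prod.smul_snd, smul_eq_mul]
      ring
    linarith
  obtain ⟨s, hs, hs0⟩ : (0 : ℝ) ∈ φ '' Set.Icc 0 1 :=
    intermediate_value_Icc zero_le_one hφ.continuousOn ⟨hφ0, hφ1⟩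
  have hT : bilinearT p₀ p₁ p₂ p₃ s ≠ 0 := by
    intro hT
    have := h.jacobian_pos hs (t := 0) ⟨le_rfl, zero_le_one⟩
    rw [hT] at this
    simp [cross2] at this
  obtain ⟨t, ht⟩ := exists_smul_eq_of_cross2_eq_zero hT hs0
  have hx : x = bilinear p₀ p₁ p₂ p₃ s t := by
    rw [sub_eq_iff_eq_add] at ht
    rw [ht]
    ext <;> simp only [bilinear, bilinearT, Prod.fst_add, Prod.snd_add, Prod.fst_sub,
      Prod.snd_sub, Prod.smul_fst, Prod.smul_snd, smul_eq_mul] <;> ring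
  refine ⟨s, hs, t, ⟨?_, ?_⟩, hx⟩
  · have e : cross2 (p₁ - p₀) (x - p₀) =
        t * ((1 - s) * cross2 (p₁ - p₀) (p₃ - p₀) + s * cross2 (p₁ - p₀) (p₂ - p₀)) := by
      rw [hx]
      simp only [bilinear, cross2, Prod.fst_add, Prod.snd_add, Prod.fst_sub,
        Prod.snd_sub, Prod.smul_fst, Prod.smul_snd, smul_eq_mul]
      ring
    rw [e] at h0
    exact nonneg_of_mul_nonneg_left h0 (combo_pos h.t₀ h.t₁ hs)
  · have e : cross2 (p₃ - p₂) (x - p₂) =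
        (1 - t) * ((1 - s) * cross2 (p₂ - p₀) (p₃ - p₀) + s * cross2 (p₂ - p₁) (p₃ - p₁)) := by
      rw [hx]
      simp only [bilinear, cross2, Prod.fst_add, Prod.snd_add, Prod.fst_sub,
        Prod.snd_sub, Prod.smul_fst, Prod.smul_snd, smul_eq_mul]
      ring
    rw [e] at h2
    have := nonneg_of_mul_nonneg_left h2 (combo_pos h.t₃ h.t₂ hs)
    linarith

end ConvexQuad

namespace QuadMesh

variable {V F : Type*} (Q : QuadMesh V F)

/-! ### The elements of a mesh -/

theorem fin4_add_one_add_three (k : Fin 4) : k + 1 + 3 = k := by rw [add_assoc]; exact add_zero k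

theorem fin4_add_three_add_one (k : Fin 4) : k + 3 + 1 = k := by rw [add_assoc]; exact add_zero k

theorem fin4_add_one_add_one (k : Fin 4) : k + 1 + 1 = k + 2 := by rw [add_assoc]; rfl

theorem fin4_add_one_add_two (k : Fin 4) : k + 1 + 2 = k + 3 := by rw [add_assoc]; rfl

theorem fin4_add_two_add_one (k : Fin 4) : k + 2 + 1 = k + 3 := by rw [add_assoc]; rfl

theorem fin4_add_two_add_two (k : Fin 4) : k + 2 + 2 = k := by rw [add_assoc]; exact add_zero k

theorem fin4_cases (k l : Fin 4) : l = k ∨ l = k + 1 ∨ l = k + 2 ∨ l = k + 3 := by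
  revert k l; decide

theorem convexQuad (f : F) (k : Fin 4) :
    ConvexQuad (Q.pos (Q.vert f k)) (Q.pos (Q.vert f (k + 1))) (Q.pos (Q.vert f (k + 2)))
      (Q.pos (Q.vert f (k + 3))) := by
  have h0 := Q.strictConvex f k
  have h1 := Q.strictConvex f (k + 1)
  have h2 := Q.strictConvex f (k + 2)
  have h3 := Q.strictConvex f (k + 3)
  simp only [fin4_add_one_add_one, fin4_add_one_add_two, fin4_add_two_add_one,
    fin4_add_two_add_two, fin4_add_three_add_one] at h0 h1 h2 h3
  have : k + 3 + 2 = k + 1 := by rw [add_assoc]; rfl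
  rw [this] at h3
  constructor <;> simp only [cross2, Prod.fst_sub, Prod.snd_sub] at * <;> linarith

/-- The closed element `f`. -/
def elem (f : F) : Set (ℝ × ℝ) := convexHull ℝ (Set.range fun k => Q.pos (Q.vert f k))

theorem param_rotate (f : F) (k : Fin 4) (s t : ℝ) :
    Q.param f (k + 1) s t = Q.param f k (1 - t) s := by
  have : k + 1 + 3 = k := fin4_add_one_add_three k
  simp only [param, fin4_add_one_add_one, fin4_add_one_add_two, fin4_add_one_add_three]
  ext <;> simp only [Prod.fst_add, Prod.snd_add, Prod.smul_fst, Prod.smul_snd, smul_eq_mul] <;> ring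

theorem param_rotate_two (f : F) (k : Fin 4) (s t : ℝ) :
    Q.param f (k + 2) s t = Q.param f k (1 - s) (1 - t) := by
  rw [← fin4_add_one_add_one, param_rotate, param_rotate]

theorem param_rotate_three (f : F) (k : Fin 4) (s t : ℝ) :
    Q.param f (k + 3) s t = Q.param f k t (1 - s) := by
  rw [← fin4_add_two_add_one, param_rotate, param_rotate_two]
  congr 1
  ring

theorem param_injective {f : F} {k : Fin 4} {s t s' t' : ℝ} (hs : s ∈ Set.Icc (0 : ℝ) 1)
    (ht : t ∈ Set.Icc (0 : ℝ) 1) (hs' : s' ∈ Set.Icc (0 : ℝ) 1) (ht' : t' ∈ Set.Icc (0 : ℝ) 1)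
    (e : Q.param f k s t = Q.param f k s' t') : s = s' ∧ t = t' :=
  (Q.convexQuad f k).bilinear_injective hs ht hs' ht' e

theorem pos_mem_elem (f : F) (k : Fin 4) : Q.pos (Q.vert f k) ∈ Q.elem f :=
  subset_convexHull ℝ _ ⟨k, rfl⟩

theorem param_mem_elem (f : F) (k : Fin 4) {s t : ℝ} (hs : s ∈ Set.Icc (0 : ℝ) 1)
    (ht : t ∈ Set.Icc (0 : ℝ) 1) : Q.param f k s t ∈ Q.elem f := by
  have hc : Convex ℝ (Q.elem f) := convex_convexHull ℝ _
  have h1 := hc (Q.pos_mem_elem f k) (Q.pos_mem_elem f (k + 1)) (sub_nonneg.mpr hs.2) hs.1 (by ring)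
  have h2 := hc (Q.pos_mem_elem f (k + 3)) (Q.pos_mem_elem f (k + 2)) (sub_nonneg.mpr hs.2) hs.1
    (by ring)
  have h3 := hc h1 h2 (sub_nonneg.mpr ht.2) ht.1 (by ring)
  convert h3 using 1
  ext <;> simp only [param, Prod.fst_add, Prod.snd_add, Prod.smul_fst, Prod.smul_snd,
    smul_eq_mul] <;> ring

theorem convex_setOf_cross2_nonneg (a b : ℝ × ℝ) : Convex ℝ {x | 0 ≤ cross2 a (x - b)} := by
  intro x hx y hy α β hα hβ hαβ
  simp only [Set.mem_ofPred_eq] at *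
  have : cross2 a (α • x + β • y - b) = α * cross2 a (x - b) + β * cross2 a (y - b) := by
    obtain rfl : β = 1 - α := by linarith
    simp only [cross2, Prod.fst_add, Prod.snd_add, Prod.fst_sub,
      Prod.snd_sub, Prod.smul_fst, Prod.smul_snd, smul_eq_mul]
    ring
  rw [this]
  positivity

theorem cross2_nonneg_of_mem_elem {f : F} {x : ℝ × ℝ} (hx : x ∈ Q.elem f) (k : Fin 4) :
    0 ≤ cross2 (Q.pos (Q.vert f (k + 1)) - Q.pos (Q.vert f k)) (x - Q.pos (Q.vert f k)) := by
  refine convexHull_min ?_ (convex_setOf_cross2_nonneg _ _) hx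
  rintro _ ⟨l, rfl⟩
  simp only [Set.mem_ofPred_eq]
  have h := Q.convexQuad f k
  rcases fin4_cases k l with rfl | rfl | rfl | rfl
  · simp [cross2]
  · rw [cross2_self]
  · exact h.t₁.le
  · exact h.t₀.le

theorem exists_param_of_mem_elem {f : F} {x : ℝ × ℝ} (hx : x ∈ Q.elem f) (k : Fin 4) :
    ∃ s ∈ Set.Icc (0 : ℝ) 1, ∃ t ∈ Set.Icc (0 : ℝ) 1, x = Q.param f k s t := by
  have h0 := Q.cross2_nonneg_of_mem_elem hx k
  have h1 := Q.cross2_nonneg_of_mem_elem hx (k + 1)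
  have h2 := Q.cross2_nonneg_of_mem_elem hx (k + 2)
  have h3 := Q.cross2_nonneg_of_mem_elem hx (k + 3)
  rw [fin4_add_one_add_one] at h1
  rw [fin4_add_two_add_one] at h2
  rw [fin4_add_three_add_one] at h3
  exact (Q.convexQuad f k).exists_bilinear_eq h0 h1 h2 h3

theorem vert_injective (f : F) : Function.Injective (Q.vert f) := by
  intro k l hkl
  have h0 : Q.pos (Q.vert f k) = Q.param f k 0 0 := by simp [param]
  have z : (0 : ℝ) ∈ Set.Icc (0 : ℝ) 1 := by simp
  have o : (1 : ℝ) ∈ Set.Icc (0 : ℝ) 1 := by simp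
  rcases fin4_cases k l with rfl | rfl | rfl | rfl
  · rfl
  · have h1 : Q.pos (Q.vert f (k + 1)) = Q.param f k 1 0 := by simp [param]
    have := Q.param_injective z z o z (by rw [← h0, ← h1, hkl])
    simp at this
  · have h1 : Q.pos (Q.vert f (k + 2)) = Q.param f k 1 1 := by simp [param]
    have := Q.param_injective z z o o (by rw [← h0, ← h1, hkl])
    simp at this
  · have h1 : Q.pos (Q.vert f (k + 3)) = Q.param f k 0 1 := by simp [param]
    have := Q.param_injective z z z o (by rw [← h0, ← h1, hkl])
    simp at this

theorem param_zero_right (f : F) (k : Fin 4) (s : ℝ) :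
    Q.param f k s 0 = Q.pos (Q.vert f k) + s • Q.dir (Q.vert f k) (Q.vert f (k + 1)) := by
  ext <;> simp only [param, dir, Prod.fst_add, Prod.snd_add, Prod.fst_sub, Prod.snd_sub,
    Prod.smul_fst, Prod.smul_snd, smul_eq_mul] <;> ring

theorem param_zero_left (f : F) (k : Fin 4) (t : ℝ) :
    Q.param f k 0 t = Q.pos (Q.vert f k) + t • Q.dir (Q.vert f k) (Q.vert f (k + 3)) := by
  ext <;> simp only [param, dir, Prod.fst_add, Prod.snd_add, Prod.fst_sub, Prod.snd_sub,
    Prod.smul_fst, Prod.smul_snd, smul_eq_mul] <;> ring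

theorem pos_add_smul_dir_symm (v w : V) (r : ℝ) :
    Q.pos v + r • Q.dir v w = Q.pos w + (1 - r) • Q.dir w v := by
  ext <;> simp only [dir, Prod.fst_add, Prod.snd_add, Prod.fst_sub, Prod.snd_sub,
    Prod.smul_fst, Prod.smul_snd, smul_eq_mul] <;> ring

theorem mem_segment_iff_param (f : F) (k : Fin 4) (x : ℝ × ℝ) :
    x ∈ segment ℝ (Q.pos (Q.vert f k)) (Q.pos (Q.vert f (k + 1))) ↔
      ∃ s ∈ Set.Icc (0 : ℝ) 1, x = Q.param f k s 0 := by
  rw [segment_eq_image']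
  simp only [Set.mem_image, param_zero_right, dir, eq_comm]

/-- A point of the relative interior of a side of an element lies on no other side. -/
theorem param_side_injective {f : F} {k l : Fin 4} {r r' : ℝ} (hr : r ∈ Set.Ioo (0 : ℝ) 1)
    (hr' : r' ∈ Set.Icc (0 : ℝ) 1) (e : Q.param f k r 0 = Q.param f l r' 0) : k = l ∧ r = r' := by
  have z : (0 : ℝ) ∈ Set.Icc (0 : ℝ) 1 := by simp
  have o : (1 : ℝ) ∈ Set.Icc (0 : ℝ) 1 := by simp
  have hr1 := Set.Ioo_subset_Icc_self hr
  have hr2 : 1 - r' ∈ Set.Icc (0 : ℝ) 1 := ⟨by linarith [hr'.2], by linarith [hr'.1]⟩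
  rcases fin4_cases k l with rfl | rfl | rfl | rfl
  · exact ⟨rfl, (Q.param_injective hr1 z hr' z e).1⟩
  · rw [param_rotate, sub_zero] at e
    exact absurd (Q.param_injective hr1 z o hr' e).1 hr.2.ne
  · rw [param_rotate_two, sub_zero] at e
    exact absurd (Q.param_injective hr1 z hr2 o e).2 zero_ne_one
  · rw [param_rotate_three] at e
    exact absurd (Q.param_injective hr1 z z hr2 e).1 hr.1.ne'

theorem param_interior_ne_side {f : F} {k l : Fin 4} {s t r : ℝ} (hs : s ∈ Set.Ioo (0 : ℝ) 1)
    (ht : t ∈ Set.Ioo (0 : ℝ) 1) (hr : r ∈ Set.Icc (0 : ℝ) 1) :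
    Q.param f k s t ≠ Q.param f l r 0 := by
  intro e
  have z : (0 : ℝ) ∈ Set.Icc (0 : ℝ) 1 := by simp
  have o : (1 : ℝ) ∈ Set.Icc (0 : ℝ) 1 := by simp
  have hs1 := Set.Ioo_subset_Icc_self hs
  have ht1 := Set.Ioo_subset_Icc_self ht
  have hr2 : 1 - r ∈ Set.Icc (0 : ℝ) 1 := ⟨by linarith [hr.2], by linarith [hr.1]⟩
  rcases fin4_cases k l with rfl | rfl | rfl | rfl
  · exact ht.1.ne' (Q.param_injective hs1 ht1 hr z e).2
  · rw [param_rotate, sub_zero] at e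
    exact hs.2.ne (Q.param_injective hs1 ht1 o hr e).1
  · rw [param_rotate_two, sub_zero] at e
    exact ht.2.ne (Q.param_injective hs1 ht1 hr2 o e).2
  · rw [param_rotate_three] at e
    exact hs.1.ne' (Q.param_injective hs1 ht1 z hr2 e).1

theorem pos_eq_param (f : F) (k : Fin 4) : Q.pos (Q.vert f k) = Q.param f k 0 0 := by simp [param]

/-- An interior point of an element lies in no other element. -/
theorem eq_of_param_interior_mem_elem {f g : F} {k : Fin 4} {s t : ℝ} (hs : s ∈ Set.Ioo (0 : ℝ) 1)
    (ht : t ∈ Set.Ioo (0 : ℝ) 1) (h : Q.param f k s t ∈ Q.elem g) : f = g := by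
  by_contra hfg
  have hm : Q.param f k s t ∈ Q.elem f ∩ Q.elem g :=
    ⟨Q.param_mem_elem f k (Set.Ioo_subset_Icc_self hs) (Set.Ioo_subset_Icc_self ht), h⟩
  rcases Q.regular f g hfg with h | ⟨k', l', -, h⟩ | ⟨k', l', -, h⟩
  · exact absurd hm (by rw [elem, elem, h]; simp)
  · rw [elem, elem, h, Set.mem_singleton_iff, pos_eq_param] at hm
    exact Q.param_interior_ne_side hs ht (by simp) hm
  · rw [elem, elem, h, mem_segment_iff_param] at hm
    obtain ⟨r, hr, hm⟩ := hm
    exact Q.param_interior_ne_side hs ht hr hm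

theorem param_open_side_ne_pos {f : F} {k : Fin 4} {r : ℝ} (hr : r ∈ Set.Ioo (0 : ℝ) 1) (l : Fin 4) :
    Q.param f k r 0 ≠ Q.pos (Q.vert f l) := by
  rw [pos_eq_param]
  intro e
  exact hr.1.ne' (Q.param_side_injective hr (by simp) e).2

/-- A point of the relative interior of a side determines the side. -/
theorem side_eq_of_param_eq {f g : F} {k l : Fin 4} {r r' : ℝ} (hr : r ∈ Set.Ioo (0 : ℝ) 1)
    (hr' : r' ∈ Set.Icc (0 : ℝ) 1) (e : Q.param f k r 0 = Q.param g l r' 0) :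
    s(Q.vert f k, Q.vert f (k + 1)) = s(Q.vert g l, Q.vert g (l + 1)) := by
  by_cases hfg : f = g
  · subst hfg
    rw [(Q.param_side_injective hr hr' e).1]
  have z : (0 : ℝ) ∈ Set.Icc (0 : ℝ) 1 := by simp
  have hm : Q.param f k r 0 ∈ Q.elem f ∩ Q.elem g :=
    ⟨Q.param_mem_elem f k (Set.Ioo_subset_Icc_self hr) z, e ▸ Q.param_mem_elem g l hr' z⟩
  rcases Q.regular f g hfg with h | ⟨k', l', -, h⟩ | ⟨k', l', hkl, h⟩
  · exact absurd hm (by rw [elem, elem, h]; simp)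
  · rw [elem, elem, h, Set.mem_singleton_iff] at hm
    exact absurd hm (Q.param_open_side_ne_pos hr k')
  · rw [elem, elem, h] at hm
    have hm1 := (Q.mem_segment_iff_param f k' _).mp hm
    obtain ⟨q, hq, hm1⟩ := hm1
    obtain ⟨rfl, rfl⟩ := Q.param_side_injective hr hq hm1
    have hm2 : Q.param f k r 0 ∈ segment ℝ (Q.pos (Q.vert g l')) (Q.pos (Q.vert g (l' + 1))) := by
      rcases Sym2.eq_iff.mp hkl with ⟨h1, h2⟩ | ⟨h1, h2⟩
      · rwa [← h1, ← h2]
      · rwa [← h1, ← h2, segment_symm]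
    rw [mem_segment_iff_param] at hm2
    obtain ⟨q', hq', hm2⟩ := hm2
    have hq1 : q' ∈ Set.Ioo (0 : ℝ) 1 := by
      have a0 : q' ≠ 0 := by
        rintro rfl
        rw [← pos_eq_param] at hm2
        rcases Sym2.eq_iff.mp hkl with ⟨h1, h2⟩ | ⟨h1, h2⟩
        · exact Q.param_open_side_ne_pos hr _ (hm2.trans (congrArg Q.pos h1.symm))
        · exact Q.param_open_side_ne_pos hr _ (hm2.trans (congrArg Q.pos h2.symm))
      have a1 : q' ≠ 1 := by
        rintro rfl
        have : Q.param g l' 1 0 = Q.pos (Q.vert g (l' + 1)) := by simp [param]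
        rw [this] at hm2
        rcases Sym2.eq_iff.mp hkl with ⟨h1, h2⟩ | ⟨h1, h2⟩
        · exact Q.param_open_side_ne_pos hr _ (hm2.trans (congrArg Q.pos h2.symm))
        · exact Q.param_open_side_ne_pos hr _ (hm2.trans (congrArg Q.pos h1.symm))
      exact ⟨lt_of_le_of_ne hq'.1 a0.symm, lt_of_le_of_ne hq'.2 a1⟩
    have := (Q.param_side_injective hq1 hr' (hm2.symm.trans e)).1
    rw [hkl, this]

theorem Adj.symm {v w : V} (h : Q.Adj v w) : Q.Adj w v := Or.symm h

theorem Adj.ne {v w : V} (h : Q.Adj v w) : v ≠ w := by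
  rcases h with ⟨f, k, rfl, rfl⟩ | ⟨f, k, rfl, rfl⟩
  · exact (Q.vert_injective f).ne (by revert k; decide)
  · exact (Q.vert_injective f).ne (by revert k; decide)

theorem dir_ne_zero {v w : V} (h : v ≠ w) : Q.dir v w ≠ 0 :=
  sub_ne_zero.mpr fun e => h (Q.pos_injective e).symm

theorem dir_symm (v w : V) : Q.dir w v = -Q.dir v w := by simp [dir]

/-- The points of the relative interior of a mesh edge, as points of a side of an element. -/
theorem Adj.exists_side {v w : V} (h : Q.Adj v w) (r : ℝ) :
    ∃ f k r', (r' = r ∨ r' = 1 - r) ∧ s(Q.vert f k, Q.vert f (k + 1)) = s(v, w) ∧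
      Q.pos v + r • Q.dir v w = Q.param f k r' 0 := by
  rcases h with ⟨f, k, rfl, rfl⟩ | ⟨f, k, rfl, rfl⟩
  · exact ⟨f, k, r, Or.inl rfl, rfl, (Q.param_zero_right f k r).symm⟩
  · exact ⟨f, k, 1 - r, Or.inr rfl, Sym2.eq_swap, by
      rw [Q.param_zero_right, Q.pos_add_smul_dir_symm]⟩

/-- By regularity a relative interior point of an edge lies on no other edge; the two outcomes are
the two directions in which the edge can be read. Distinctness of the E- and D-points rests on this.
-/
theorem edge_point_eq {v w v' w' : V} (h : Q.Adj v w) (h' : Q.Adj v' w') {r r' : ℝ}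
    (hr : r ∈ Set.Ioo (0 : ℝ) 1) (hr' : r' ∈ Set.Icc (0 : ℝ) 1)
    (e : Q.pos v + r • Q.dir v w = Q.pos v' + r' • Q.dir v' w') :
    (v = v' ∧ w = w' ∧ r = r') ∨ (v = w' ∧ w = v' ∧ r = 1 - r') := by
  obtain ⟨f, k, q, hq, hs, hf⟩ := h.exists_side Q r
  obtain ⟨g, l, q', hq', hs', hg⟩ := h'.exists_side Q r'
  have h1 : q ∈ Set.Ioo (0 : ℝ) 1 := by
    rcases hq with rfl | rfl
    · exact hr
    · exact ⟨by linarith [hr.2], by linarith [hr.1]⟩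
  have h2 : q' ∈ Set.Icc (0 : ℝ) 1 := by
    rcases hq' with rfl | rfl
    · exact hr'
    · exact ⟨by linarith [hr'.2], by linarith [hr'.1]⟩
  have h3 := Q.side_eq_of_param_eq h1 h2 (hf.symm.trans (e.trans hg))
  rw [hs, hs'] at h3
  have hd := Q.dir_ne_zero h.ne
  rcases Sym2.eq_iff.mp h3 with ⟨rfl, rfl⟩ | ⟨rfl, rfl⟩
  · refine Or.inl ⟨rfl, rfl, ?_⟩
    exact smul_left_injective ℝ hd (add_left_cancel e)
  · refine Or.inr ⟨rfl, rfl, ?_⟩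
    rw [Q.pos_add_smul_dir_symm w v r'] at e
    exact smul_left_injective ℝ hd (add_left_cancel e)

theorem edge_point_ne_pos {v w u : V} (h : Q.Adj v w) {r : ℝ} (hr : r ∈ Set.Ioo (0 : ℝ) 1) :
    Q.pos v + r • Q.dir v w ≠ Q.pos u := by
  obtain ⟨g, l, rfl⟩ := Q.exists_vert u
  intro e
  have := Q.edge_point_eq h (Or.inl ⟨g, l, rfl, rfl⟩ : Q.Adj (Q.vert g l) (Q.vert g (l + 1))) hr
    (r' := 0) (by simp) (by simpa using e)
  rcases this with ⟨-, -, h⟩ | ⟨-, -, h⟩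
  · exact hr.1.ne' h
  · exact hr.2.ne (by simpa using h)

theorem edge_point_mem_elem_of_adj {v w : V} (h : Q.Adj v w) {r : ℝ} (hr : r ∈ Set.Icc (0 : ℝ) 1) :
    ∃ f k, ∃ q ∈ Set.Icc (0 : ℝ) 1, Q.pos v + r • Q.dir v w = Q.param f k q 0 := by
  obtain ⟨f, k, q, hq, -, hf⟩ := h.exists_side Q r
  refine ⟨f, k, q, ?_, hf⟩
  rcases hq with rfl | rfl
  · exact hr
  · exact ⟨by linarith [hr.2], by linarith [hr.1]⟩

theorem param_interior_ne_edge_point {f : F} {k : Fin 4} {s t r : ℝ} {v w : V}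
    (hs : s ∈ Set.Ioo (0 : ℝ) 1) (ht : t ∈ Set.Ioo (0 : ℝ) 1) (h : Q.Adj v w)
    (hr : r ∈ Set.Icc (0 : ℝ) 1) : Q.param f k s t ≠ Q.pos v + r • Q.dir v w := by
  intro e
  obtain ⟨g, l, q, hq, hg⟩ := Q.edge_point_mem_elem_of_adj h hr
  rw [hg] at e
  have hfg : f = g :=
    Q.eq_of_param_interior_mem_elem hs ht (e ▸ Q.param_mem_elem g l hq (by simp))
  subst hfg
  exact Q.param_interior_ne_side hs ht hq e

/-! ### Corners of the elements at a vertex -/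

/-- The open sectors of two different corners at a vertex are disjoint. -/
theorem corner_eq_of_sectors_meet {f g : F} {k l : Fin 4} (hv : Q.vert f k = Q.vert g l) {x : ℝ × ℝ}
    (h1 : 0 < cross2 (Q.dir (Q.vert f k) (Q.vert f (k + 1))) x)
    (h2 : 0 < cross2 x (Q.dir (Q.vert f k) (Q.vert f (k + 3))))
    (h3 : 0 < cross2 (Q.dir (Q.vert g l) (Q.vert g (l + 1))) x)
    (h4 : 0 < cross2 x (Q.dir (Q.vert g l) (Q.vert g (l + 3)))) : f = g ∧ k = l := by
  -- A short step from the vertex in a direction of the open sector ends in the open element. Two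
  -- interiors can then be compared at a common point.
  have key : ∀ (f : F) (k : Fin 4), 0 < cross2 (Q.dir (Q.vert f k) (Q.vert f (k + 1))) x →
      0 < cross2 x (Q.dir (Q.vert f k) (Q.vert f (k + 3))) → ∃ ε₀ > 0, ∀ ε : ℝ, 0 < ε → ε ≤ ε₀ →
        ∃ s ∈ Set.Ioo (0 : ℝ) 1, ∃ t ∈ Set.Ioo (0 : ℝ) 1,
          Q.pos (Q.vert f k) + ε • x = Q.param f k s t := by
    intro f k h1 h2
    have hq := Q.convexQuad f k
    set p₀ := Q.pos (Q.vert f k) with hp₀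
    set p₁ := Q.pos (Q.vert f (k + 1)) with hp₁
    set p₂ := Q.pos (Q.vert f (k + 2)) with hp₂
    set p₃ := Q.pos (Q.vert f (k + 3)) with hp₃
    have hx := eq_smul_add_smul_of_cross2_ne_zero hq.t₀.ne' x
    have ha : 0 < cross2 x (p₃ - p₀) / cross2 (p₁ - p₀) (p₃ - p₀) := div_pos h2 hq.t₀
    have hb : 0 < cross2 (p₁ - p₀) x / cross2 (p₁ - p₀) (p₃ - p₀) := div_pos h1 hq.t₀
    set a := cross2 x (p₃ - p₀) / cross2 (p₁ - p₀) (p₃ - p₀)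
    set b := cross2 (p₁ - p₀) x / cross2 (p₁ - p₀) (p₃ - p₀)
    -- In the coordinates of the two sides at the vertex this bound gives `ε (a + b) < 1`, so the
    -- point stays in the triangle `p₀p₁p₃`, strictly off the two opposite sides.
    refine ⟨1 / (2 * (a + b)), by positivity, fun ε hε hε' => ?_⟩
    have hab : ε * (a + b) < 1 := by
      rw [le_div_iff₀ (by positivity)] at hε'
      have : 0 < ε * (a + b) := by positivity
      linarith
    have hm : p₀ + ε • x ∈ Q.elem f := by
      have hc : Convex ℝ (Q.elem f) := convex_convexHull ℝ _
      have := hc.sum_mem (t := Finset.univ) (w := ![1 - ε * (a + b), ε * a, ε * b])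
        (z := ![p₀, p₁, p₃]) (by
          intro i _
          fin_cases i
          · simpa using hab.le
          · simp; positivity
          · simp; positivity) (by simp [Fin.sum_univ_three]; ring) (by
          intro i _
          fin_cases i
          · exact Q.pos_mem_elem f k
          · exact Q.pos_mem_elem f (k + 1)
          · exact Q.pos_mem_elem f (k + 3))
      convert this using 1
      rw [hx]
      ext <;> simp [Fin.sum_univ_three] <;> ring
    obtain ⟨s, hs, t, ht, e⟩ := Q.exists_param_of_mem_elem hm k
    have e1 : p₀ + ε • x - p₀ = bilinear p₀ p₁ p₂ p₃ s t - p₀ := by rw [e]; rfl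
    have e2 : cross2 (p₁ - p₀) (ε • x) =
        t * ((1 - s) * cross2 (p₁ - p₀) (p₃ - p₀) + s * cross2 (p₁ - p₀) (p₂ - p₀)) := by
      rw [add_sub_cancel_left] at e1
      rw [e1]
      simp only [bilinear, cross2, Prod.fst_add, Prod.snd_add, Prod.fst_sub,
        Prod.snd_sub, Prod.smul_fst, Prod.smul_snd, smul_eq_mul]
      ring
    have e3 : cross2 (ε • x) (p₃ - p₀) =
        s * ((1 - t) * cross2 (p₁ - p₀) (p₃ - p₀) + t * cross2 (p₂ - p₀) (p₃ - p₀)) := by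
      rw [add_sub_cancel_left] at e1
      rw [e1]
      simp only [bilinear, cross2, Prod.fst_add, Prod.snd_add, Prod.fst_sub,
        Prod.snd_sub, Prod.smul_fst, Prod.smul_snd, smul_eq_mul]
      ring
    have ht0 : t ≠ 0 := by
      rintro rfl
      rw [cross2_smul_right, zero_mul] at e2
      have : 0 < ε * cross2 (p₁ - p₀) x := mul_pos hε h1
      linarith
    have hs0 : s ≠ 0 := by
      rintro rfl
      rw [cross2_smul_left, zero_mul] at e3
      have : 0 < ε * cross2 x (p₃ - p₀) := mul_pos hε h2
      linarith
    have e4 : bilinear p₀ p₁ p₂ p₃ s t = p₀ + ε • (a • (p₁ - p₀) + b • (p₃ - p₀)) := by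
      rw [← hx]; exact e.symm
    have hs1 : s ≠ 1 := by
      rintro rfl
      have e5 : cross2 (p₂ - p₁) (p₀ + ε • (a • (p₁ - p₀) + b • (p₃ - p₀)) - p₁) = 0 := by
        rw [← e4]
        simp only [bilinear, cross2, Prod.fst_add, Prod.snd_add, Prod.fst_sub,
          Prod.snd_sub, Prod.smul_fst, Prod.smul_snd, smul_eq_mul]
        ring
      have e6 : cross2 (p₂ - p₁) (p₀ + ε • (a • (p₁ - p₀) + b • (p₃ - p₀)) - p₁) =
          (1 - ε * (a + b)) * cross2 (p₁ - p₀) (p₂ - p₀) + ε * b * cross2 (p₂ - p₁) (p₃ - p₁) := by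
        simp only [cross2, Prod.fst_add, Prod.snd_add, Prod.fst_sub,
          Prod.snd_sub, Prod.smul_fst, Prod.smul_snd, smul_eq_mul]
        ring
      have := mul_pos (sub_pos.mpr hab) hq.t₁
      have := mul_pos (mul_pos hε hb) hq.t₂
      linarith
    have ht1 : t ≠ 1 := by
      rintro rfl
      have e5 : cross2 (p₃ - p₂) (p₀ + ε • (a • (p₁ - p₀) + b • (p₃ - p₀)) - p₂) = 0 := by
        rw [← e4]
        simp only [bilinear, cross2, Prod.fst_add, Prod.snd_add, Prod.fst_sub,
          Prod.snd_sub, Prod.smul_fst, Prod.smul_snd, smul_eq_mul]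
        ring
      have e6 : cross2 (p₃ - p₂) (p₀ + ε • (a • (p₁ - p₀) + b • (p₃ - p₀)) - p₂) =
          (1 - ε * (a + b)) * cross2 (p₂ - p₀) (p₃ - p₀) + ε * a * cross2 (p₂ - p₁) (p₃ - p₁) := by
        simp only [cross2, Prod.fst_add, Prod.snd_add, Prod.fst_sub,
          Prod.snd_sub, Prod.smul_fst, Prod.smul_snd, smul_eq_mul]
        ring
      have := mul_pos (sub_pos.mpr hab) hq.t₃
      have := mul_pos (mul_pos hε ha) hq.t₂
      linarith
    exact ⟨s, ⟨hs.1.lt_of_ne hs0.symm, hs.2.lt_of_ne hs1⟩, t,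
      ⟨ht.1.lt_of_ne ht0.symm, ht.2.lt_of_ne ht1⟩, e⟩
  obtain ⟨ε₁, hε₁, H₁⟩ := key f k h1 h2
  obtain ⟨ε₂, hε₂, H₂⟩ := key g l h3 h4
  obtain ⟨s, hs, t, ht, e⟩ := H₁ (min ε₁ ε₂) (lt_min hε₁ hε₂) (min_le_left _ _)
  obtain ⟨s', hs', t', ht', e'⟩ := H₂ (min ε₁ ε₂) (lt_min hε₁ hε₂) (min_le_right _ _)
  have hfg : f = g := by
    refine Q.eq_of_param_interior_mem_elem hs ht (k := k) ?_
    rw [← e, hv, e']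
    exact Q.param_mem_elem g l (Set.Ioo_subset_Icc_self hs') (Set.Ioo_subset_Icc_self ht')
  subst hfg
  exact ⟨rfl, Q.vert_injective f hv⟩

end QuadMesh

/-! ### The lexicographic half-plane and small perturbations of directions -/

open Filter Topology in
theorem eventually_pos_add_mul {a : ℝ} (ha : 0 < a) (b : ℝ) :
    ∀ᶠ δ in 𝓝[>] (0 : ℝ), 0 < a + δ * b := by
  have h : Tendsto (fun δ : ℝ => a + δ * b) (𝓝[>] 0) (𝓝 (a + 0 * b)) :=
    (Continuous.tendsto (by fun_prop) 0).mono_left nhdsWithin_le_nhds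
  rw [zero_mul, add_zero] at h
  exact h.eventually_const_lt ha

/-- The half-plane of lexicographically positive vectors. -/
def LexPos (x : ℝ × ℝ) : Prop := 0 < x.1 ∨ x.1 = 0 ∧ 0 < x.2

theorem LexPos.add {x y : ℝ × ℝ} (hx : LexPos x) (hy : LexPos y) : LexPos (x + y) := by
  simp only [LexPos, Prod.fst_add, Prod.snd_add] at *
  rcases hx with hx | ⟨hx, hx'⟩ <;> rcases hy with hy | ⟨hy, hy'⟩
  · exact Or.inl (by linarith)
  · exact Or.inl (by linarith)
  · exact Or.inl (by linarith)
  · exact Or.inr ⟨by linarith, by linarith⟩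

theorem LexPos.smul {x : ℝ × ℝ} (hx : LexPos x) {r : ℝ} (hr : 0 < r) : LexPos (r • x) := by
  simp only [LexPos, Prod.smul_fst, Prod.smul_snd, smul_eq_mul] at *
  rcases hx with hx | ⟨hx, hx'⟩
  · exact Or.inl (by positivity)
  · exact Or.inr ⟨by simp [hx], by positivity⟩

theorem LexPos.not_neg {x : ℝ × ℝ} (hx : LexPos x) : ¬ LexPos (-x) := by
  simp only [LexPos, Prod.fst_neg, Prod.snd_neg] at *
  rcases hx with hx | ⟨hx, hx'⟩
  · rintro (h | ⟨h, -⟩) <;> linarith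
  · rintro (h | ⟨-, h⟩) <;> linarith

theorem lexPos_or_neg {x : ℝ × ℝ} (hx : x ≠ 0) : LexPos x ∨ LexPos (-x) := by
  simp only [LexPos, Prod.fst_neg, Prod.snd_neg]
  rcases lt_trichotomy x.1 0 with h | h | h
  · exact Or.inr (Or.inl (by linarith))
  · rcases lt_trichotomy x.2 0 with h' | h' | h'
    · exact Or.inr (Or.inr ⟨by linarith, by linarith⟩)
    · exact absurd (Prod.ext h h') hx
    · exact Or.inl (Or.inr ⟨h, h'⟩)
  · exact Or.inl (Or.inl h)

theorem not_lexPos_zero : ¬ LexPos 0 := by simp [LexPos]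

/-- Within a half-plane, turning left is transitive: in `[x,z] y = [y,z] x + [x,y] z` the right side
is lexicographically positive, which forces the coefficient on the left to be positive. -/
theorem cross2_pos_trans {x y z : ℝ × ℝ} (hx : LexPos x) (hy : LexPos y) (hz : LexPos z)
    (hxy : 0 < cross2 x y) (hyz : 0 < cross2 y z) : 0 < cross2 x z := by
  have e : cross2 x z • y = cross2 y z • x + cross2 x y • z := by
    ext <;> simp only [cross2, Prod.fst_add, Prod.snd_add, Prod.smul_fst, Prod.smul_snd,
      smul_eq_mul] <;> ring
  have h : LexPos (cross2 x z • y) := e ▸ (hx.smul hyz).add (hz.smul hxy)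
  rcases lt_trichotomy (cross2 x z) 0 with h0 | h0 | h0
  · have := hy.smul (neg_pos.mpr h0)
    rw [neg_smul] at this
    exact absurd this h.not_neg
  · rw [h0, zero_smul] at h
    exact absurd h not_lexPos_zero
  · exact h0

/-- Two lexicographically positive vectors cannot be opposite. -/
theorem LexPos.exists_pos_smul {x y : ℝ × ℝ} (hx : LexPos x) (hy : LexPos y)
    (h : cross2 x y = 0) : ∃ r > (0 : ℝ), y = r • x := by
  have hx0 : x ≠ 0 := fun h => not_lexPos_zero (h ▸ hx)
  obtain ⟨r, rfl⟩ := exists_smul_eq_of_cross2_eq_zero hx0 h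
  refine ⟨r, ?_, rfl⟩
  rcases lt_trichotomy r 0 with h0 | h0 | h0
  · have := hx.smul (neg_pos.mpr h0)
    rw [neg_smul] at this
    exact absurd this hy.not_neg
  · rw [h0, zero_smul] at hy
    exact absurd hy not_lexPos_zero
  · exact h0

open Filter Topology in
/-- Two sectors that contain the boundary ray of the half-plane of lexicographically positive
vectors overlap. -/
theorem exists_mem_sectors_of_wrap {a b c d : ℝ × ℝ} (ha : LexPos (-a)) (hb : LexPos b)
    (hc : LexPos (-c)) (hd : LexPos d) :
    ∃ x, 0 < cross2 a x ∧ 0 < cross2 x b ∧ 0 < cross2 c x ∧ 0 < cross2 x d := by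
  -- The common vector is the ray `(0, -1)` turned slightly to the left. The tilt is needed because
  -- `a` or `c` may itself point along that ray.
  have key1 : ∀ a : ℝ × ℝ, LexPos (-a) → ∀ᶠ δ in 𝓝[>] (0 : ℝ), 0 < cross2 a (δ, -1) := by
    intro a ha
    simp only [LexPos, Prod.fst_neg, Prod.snd_neg] at ha
    rcases ha with ha | ⟨ha, ha'⟩
    · filter_upwards [eventually_pos_add_mul ha (-a.2)] with δ hδ
      simp only [cross2]
      linarith
    · filter_upwards [self_mem_nhdsWithin] with δ hδ
      have : 0 < δ * -a.2 := mul_pos hδ ha'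
      simp only [cross2]
      linarith
  have key2 : ∀ a : ℝ × ℝ, LexPos a → ∀ᶠ δ in 𝓝[>] (0 : ℝ), 0 < cross2 (δ, -1) a := by
    intro a ha
    filter_upwards [key1 (-a) (by rwa [neg_neg])] with δ hδ
    rw [cross2_neg_left, cross2_comm, neg_neg] at hδ
    exact hδ
  obtain ⟨δ, h1, h2, h3, h4⟩ :=
    ((key1 a ha).and ((key2 b hb).and ((key1 c hc).and (key2 d hd)))).exists
  exact ⟨_, h1, h2, h3, h4⟩

namespace QuadMesh

variable {V F : Type*} (Q : QuadMesh V F)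

/-! ### The cyclic structure of the mesh at a vertex -/

/-- The corners of the elements at the vertex `v`. -/
def Corner (v : V) : Type _ := {c : F × Fin 4 // Q.vert c.1 c.2 = v}

instance [Finite F] (v : V) : Finite (Q.Corner v) := Subtype.finite

variable {Q}

/-- The neighbour of `v` at the beginning (in counter-clockwise order) of a corner at `v`. -/
def Corner.rgt {v : V} (c : Q.Corner v) : V := Q.vert c.1.1 (c.1.2 + 1)

/-- The neighbour of `v` at the end (in counter-clockwise order) of a corner at `v`. -/
def Corner.lft {v : V} (c : Q.Corner v) : V := Q.vert c.1.1 (c.1.2 + 3)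

theorem Corner.vert_eq {v : V} (c : Q.Corner v) : Q.vert c.1.1 c.1.2 = v := c.2

theorem Corner.cross2_pos {v : V} (c : Q.Corner v) : 0 < cross2 (Q.dir v c.rgt) (Q.dir v c.lft) := by
  have := (Q.convexQuad c.1.1 c.1.2).t₀
  rwa [c.vert_eq] at this

theorem Corner.eq_of_sectors_meet {v : V} {c d : Q.Corner v} {x : ℝ × ℝ}
    (h1 : 0 < cross2 (Q.dir v c.rgt) x) (h2 : 0 < cross2 x (Q.dir v c.lft))
    (h3 : 0 < cross2 (Q.dir v d.rgt) x) (h4 : 0 < cross2 x (Q.dir v d.lft)) : c = d := by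
  have := Q.corner_eq_of_sectors_meet (c.vert_eq.trans d.vert_eq.symm) (x := x)
    (by rw [c.vert_eq]; exact h1) (by rw [c.vert_eq]; exact h2)
    (by rw [d.vert_eq]; exact h3) (by rw [d.vert_eq]; exact h4)
  exact Subtype.ext (Prod.ext this.1 this.2)

open Filter Topology in
-- The common first direction, turned slightly towards `c.lft`, lies in both open sectors.
theorem Corner.eq_of_rgt_parallel {v : V} {c d : Q.Corner v} {r : ℝ} (hr : 0 < r)
    (h : Q.dir v c.rgt = r • Q.dir v d.rgt) : c = d := by
  have h0 : 0 < cross2 (Q.dir v d.rgt) (Q.dir v c.lft) := by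
    have := c.cross2_pos
    rw [h, cross2_smul_left] at this
    exact (mul_pos_iff_of_pos_left hr).mp this
  obtain ⟨δ, h1, h2⟩ := ((eventually_pos_add_mul d.cross2_pos
    (cross2 (Q.dir v c.lft) (Q.dir v d.lft))).and self_mem_nhdsWithin).exists
  have h2 : 0 < δ := h2
  refine Corner.eq_of_sectors_meet (x := Q.dir v d.rgt + δ • Q.dir v c.lft) ?_ ?_ ?_ ?_
  · rw [h, cross2_smul_left, cross2_add_right, cross2_self, cross2_smul_right, zero_add]
    positivity
  · rw [cross2_add_left, cross2_smul_left, cross2_self, mul_zero, add_zero]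
    exact h0
  · rw [cross2_add_right, cross2_self, cross2_smul_right, zero_add]
    positivity
  · rw [cross2_add_left, cross2_smul_left]
    exact h1

open Filter Topology in
/-- No edge at `v` points into the open sector of a corner at `v`. -/
theorem Corner.not_mem_sector {v : V} (c d : Q.Corner v)
    (h1 : 0 < cross2 (Q.dir v c.rgt) (Q.dir v d.rgt))
    (h2 : 0 < cross2 (Q.dir v d.rgt) (Q.dir v c.lft)) : False := by
  obtain ⟨δ, ⟨h3, h4⟩, h5⟩ := (((eventually_pos_add_mul h1
    (cross2 (Q.dir v c.rgt) (Q.dir v d.lft))).and (eventually_pos_add_mul h2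
    (cross2 (Q.dir v d.lft) (Q.dir v c.lft)))).and self_mem_nhdsWithin).exists
  have h5 : 0 < δ := h5
  have h6 := d.cross2_pos
  -- The first edge of `d`, turned slightly towards its second edge, is still in the open sector of
  -- `c` and already in that of `d`.
  have : c = d := by
    refine Corner.eq_of_sectors_meet (x := Q.dir v d.rgt + δ • Q.dir v d.lft) ?_ ?_ ?_ ?_
    · rw [cross2_add_right, cross2_smul_right]
      exact h3
    · rw [cross2_add_left, cross2_smul_left]
      exact h4
    · rw [cross2_add_right, cross2_self, cross2_smul_right, zero_add]
      positivity
    · rw [cross2_add_left, cross2_smul_left, cross2_self, mul_zero, add_zero]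
      exact h6
  subst this
  rw [cross2_self] at h1
  exact h1.false

theorem Corner.rgt_injective (v : V) : Function.Injective (Corner.rgt : Q.Corner v → V) :=
  fun c d h => Corner.eq_of_rgt_parallel one_pos (by rw [h, one_smul])

/-- Seen from the other end, the last edge of a corner is the first edge of the preceding corner of
the same element, so injectivity of `Corner.rgt` at that end applies. -/
theorem Corner.lft_injective (v : V) : Function.Injective (Corner.lft : Q.Corner v → V) := by
  intro c d h
  let c' : Q.Corner c.lft := ⟨(c.1.1, c.1.2 + 3), rfl⟩
  let d' : Q.Corner c.lft := ⟨(d.1.1, d.1.2 + 3), h.symm⟩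
  have h1 : c'.rgt = v := by
    simp only [c', Corner.rgt, fin4_add_three_add_one]; exact c.2
  have h2 : d'.rgt = v := by
    simp only [d', Corner.rgt, fin4_add_three_add_one]; exact d.2
  have h3 := Corner.rgt_injective _ (h1.trans h2.symm)
  have h4 := congrArg Subtype.val h3
  simp only [c', d', Prod.mk.injEq, add_left_inj] at h4
  exact Subtype.ext (Prod.ext h4.1 h4.2)

theorem isSide_iff_exists_rgt {v w : V} : Q.IsSide v w ↔ ∃ c : Q.Corner v, c.rgt = w := by
  constructor
  · rintro ⟨f, k, h1, h2⟩
    exact ⟨⟨(f, k), h1⟩, h2⟩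
  · rintro ⟨c, rfl⟩
    exact ⟨c.1.1, c.1.2, c.2, rfl⟩

theorem isSide_iff_exists_lft {v w : V} : Q.IsSide w v ↔ ∃ c : Q.Corner v, c.lft = w := by
  constructor
  · rintro ⟨f, k, h1, h2⟩
    refine ⟨⟨(f, k + 1), h2⟩, ?_⟩
    simp only [Corner.lft, fin4_add_one_add_three, h1]
  · rintro ⟨c, rfl⟩
    refine ⟨c.1.1, c.1.2 + 3, rfl, ?_⟩
    rw [fin4_add_three_add_one, c.2]

theorem side_unique {f g : F} {k l : Fin 4} (h : Q.vert f k = Q.vert g l)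
    (h' : Q.vert f (k + 1) = Q.vert g (l + 1)) : f = g ∧ k = l := by
  let c : Q.Corner (Q.vert f k) := ⟨(f, k), rfl⟩
  let d : Q.Corner (Q.vert f k) := ⟨(g, l), h.symm⟩
  have := congrArg Subtype.val (Corner.rgt_injective _ (a₁ := c) (a₂ := d) h')
  simpa [c, d] using this

theorem Corner.adj_rgt {v : V} (c : Q.Corner v) : Q.Adj v c.rgt :=
  Or.inl (isSide_iff_exists_rgt.mpr ⟨c, rfl⟩)

theorem Corner.adj_lft {v : V} (c : Q.Corner v) : Q.Adj v c.lft :=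
  Or.inr (isSide_iff_exists_lft.mpr ⟨c, rfl⟩)

theorem exists_corner (Q : QuadMesh V F) (v : V) : Nonempty (Q.Corner v) := by
  obtain ⟨f, k, h⟩ := Q.exists_vert v
  exact ⟨⟨(f, k), h⟩⟩

theorem IsInnerEdge.symm {v w : V} (h : Q.IsInnerEdge v w) : Q.IsInnerEdge w v := And.symm h

theorem IsInnerEdge.adj {v w : V} (h : Q.IsInnerEdge v w) : Q.Adj v w := Or.inl h.1

theorem isInnerEdge_of_not_isBoundaryVertex {v w : V} (hv : ¬ Q.IsBoundaryVertex v)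
    (h : Q.Adj v w) : Q.IsInnerEdge v w := by
  by_contra h'
  exact hv ⟨w, h, h'⟩

theorem exists_next {v : V} (hv : ¬ Q.IsBoundaryVertex v) (c : Q.Corner v) :
    ∃ d : Q.Corner v, d.rgt = c.lft :=
  isSide_iff_exists_rgt.mp (isInnerEdge_of_not_isBoundaryVertex hv c.adj_lft).1

theorem exists_rgt_of_adj {v w : V} (hv : ¬ Q.IsBoundaryVertex v) (h : Q.Adj v w) : ∃ c : Q.Corner v, c.rgt = w :=
  isSide_iff_exists_rgt.mp (isInnerEdge_of_not_isBoundaryVertex hv h).1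

theorem valence_eq_card {v : V} (hv : ¬ Q.IsBoundaryVertex v) : Q.valence v = Nat.card (Q.Corner v) := by
  have : {w | Q.Adj v w} = Set.range (Corner.rgt : Q.Corner v → V) := by
    ext w
    constructor
    · exact exists_rgt_of_adj hv
    · rintro ⟨c, rfl⟩
      exact c.adj_rgt
  rw [valence, this, ← Set.image_univ, Set.ncard_image_of_injective _ (Corner.rgt_injective v),
    Set.ncard_univ]

/-- The next corner, in counter-clockwise order, at an inner vertex. -/
noncomputable def next [Finite F] {v : V} (hv : ¬ Q.IsBoundaryVertex v) :
    Equiv.Perm (Q.Corner v) :=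
  Equiv.ofBijective (fun c => (exists_next hv c).choose) <| Finite.injective_iff_bijective.mp
    fun c d h => Corner.lft_injective v <| by
      rw [← (exists_next hv c).choose_spec, ← (exists_next hv d).choose_spec]
      exact congrArg _ h

section Inner

variable [Finite F] {v : V} (hv : ¬ Q.IsBoundaryVertex v)

theorem rgt_next (c : Q.Corner v) : (next hv c).rgt = c.lft := (exists_next hv c).choose_spec

theorem lft_next_symm (c : Q.Corner v) : ((next hv).symm c).lft = c.rgt := by
  rw [← rgt_next hv, Equiv.apply_symm_apply]


theorem cross2_next_pos (c : Q.Corner v) :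
    0 < cross2 (Q.dir v c.rgt) (Q.dir v (next hv c).rgt) := by
  rw [rgt_next]
  exact c.cross2_pos

/-- Turning around an inner vertex, one passes from the lexicographically negative half-plane to
the lexicographically positive one. -/
theorem exists_wrap (c : Q.Corner v) :
    ∃ j : ℕ, LexPos (-Q.dir v ((next hv ^ j) c).rgt) ∧ LexPos (Q.dir v ((next hv ^ j) c).lft) := by
  -- Without such a passage an edge in the negative half-plane is followed only by edges in it. So
  -- from some edge on, all edges lie in one half-plane, where left turns are transitive, and
  -- periodicity would put an edge strictly to the left of itself.
  by_contra! H
  set u : ℕ → ℝ × ℝ := fun j => Q.dir v ((next hv ^ j) c).rgt with hu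
  have hstep : ∀ j, 0 < cross2 (u j) (u (j + 1)) := by
    intro j
    simp only [hu, pow_succ', Equiv.Perm.mul_apply]
    exact cross2_next_pos hv _
  have hu0 : ∀ j, LexPos (u j) ∨ LexPos (-u j) := fun j =>
    lexPos_or_neg (Q.dir_ne_zero (Corner.adj_rgt _).ne)
  have H' : ∀ j, LexPos (-u j) → LexPos (-u (j + 1)) := by
    intro j hj
    have h1 := H j hj
    rw [← rgt_next hv, ← Equiv.Perm.mul_apply, ← pow_succ'] at h1
    exact (hu0 (j + 1)).resolve_left h1
  obtain ⟨m, hm0, hm⟩ : ∃ m : ℕ, 0 < m ∧ (next hv) ^ m = 1 := by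
    have := isOfFinOrder_of_finite (next hv)
    rwa [isOfFinOrder_iff_pow_eq_one] at this
  have hper : ∀ j, u (j + m) = u j := by
    intro j
    simp only [hu, pow_add, hm, mul_one]
  have hmono : ∀ (w : ℕ → ℝ × ℝ), (∀ j, LexPos (w j)) → (∀ j, 0 < cross2 (w j) (w (j + 1))) →
      ∀ j, 0 < cross2 (w 0) (w (j + 1)) := by
    intro w hw hw' j
    induction j with
    | zero => exact hw' 0
    | succ j ih => exact cross2_pos_trans (hw _) (hw _) (hw _) ih (hw' _)
  obtain ⟨n, rfl⟩ : ∃ n, m = n + 1 := ⟨m - 1, by omega⟩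
  by_cases hall : ∀ j, LexPos (u j)
  · have := hmono u hall hstep n
    rw [← zero_add (n + 1), hper, cross2_self] at this
    exact this.false
  · push Not at hall
    obtain ⟨i, hi⟩ := hall
    have hi' : ∀ j, LexPos (-u (i + j)) := by
      intro j
      induction j with
      | zero => exact (hu0 i).resolve_left hi
      | succ j ih => exact H' _ ih
    have := hmono (fun j => -u (i + j)) hi' (fun j => by
      rw [cross2_neg_left, cross2_neg_right, neg_neg]; exact hstep _) n
    simp only [add_zero, hper, cross2_self] at this
    exact this.false

/-- The corners at an inner vertex form a single cycle. -/
theorem next_sameCycle (c d : Q.Corner v) : (next hv).SameCycle c d := by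
  -- Every cycle contains a wrapping corner, and any two wrapping corners overlap near the ray `(0,
  -- -1)`; hence there is only one such corner, common to both cycles.
  obtain ⟨i, h1, h2⟩ := exists_wrap hv c
  obtain ⟨j, h3, h4⟩ := exists_wrap hv d
  obtain ⟨x, h5, h6, h7, h8⟩ := exists_mem_sectors_of_wrap h1 h2 h3 h4
  have := Corner.eq_of_sectors_meet h5 h6 h7 h8
  refine ⟨(i : ℤ) - j, ?_⟩
  rw [sub_eq_neg_add, zpow_add, Equiv.Perm.mul_apply, zpow_natCast, this, ← zpow_natCast,
    ← Equiv.Perm.mul_apply, ← zpow_add]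
  simp

theorem exists_pow_next_eq (c d : Q.Corner v) :
    ∃ j < Nat.card (Q.Corner v), (next hv ^ j) c = d := by
  classical
  have := Fintype.ofFinite (Q.Corner v)
  have hc : (next hv).IsCycleOn ((Finset.univ : Finset (Q.Corner v)) : Set (Q.Corner v)) :=
    ⟨by simp, fun a _ b _ => next_sameCycle hv a b⟩
  obtain ⟨j, hj, e⟩ := hc.exists_pow_eq (Finset.mem_univ c) (Finset.mem_univ d)
  exact ⟨j, by simpa [Nat.card_eq_fintype_card] using hj, e⟩

theorem pow_card_next (c : Q.Corner v) : (next hv ^ Nat.card (Q.Corner v)) c = c := by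
  classical
  have := Fintype.ofFinite (Q.Corner v)
  have hc : (next hv).IsCycleOn ((Finset.univ : Finset (Q.Corner v)) : Set (Q.Corner v)) :=
    ⟨by simp, fun a _ b _ => next_sameCycle hv a b⟩
  have := hc.pow_card_apply (Finset.mem_univ c)
  simpa [Nat.card_eq_fintype_card] using this

end Inner

/-- The denominator in `Uses` is a product of two positive corner cross products, and an edge
determines the corners on its two sides. -/
theorem uses_iff {v : V} {p c : Q.Corner v} (h : p.lft = c.rgt) :
    Q.Uses v c.rgt ↔ cross2 (Q.dir v p.rgt) (Q.dir v c.lft) ≠ 0 := by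
  have hp := p.cross2_pos
  have hc := c.cross2_pos
  rw [h] at hp
  constructor
  · rintro ⟨f, k, g, l, h1, h2, h3, h4, h5⟩ h0
    have e1 : (⟨(f, k), h1⟩ : Q.Corner v) = c := Corner.rgt_injective v h2
    have e2 : (⟨(g, l), h3⟩ : Q.Corner v) = p := Corner.lft_injective v (h4.trans h.symm)
    have e3 : Q.vert g (l + 1) = p.rgt := by rw [← e2]; rfl
    have e4 : Q.vert f (k + 3) = c.lft := by rw [← e1]; rfl
    rw [e3, e4, h0, zero_div] at h5
    exact h5 rfl
  · intro h0
    exact ⟨c.1.1, c.1.2, p.1.1, p.1.2, c.2, rfl, p.2, h,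
      div_ne_zero h0 (mul_pos hp hc).ne'⟩

/-- At an inner even vertex that is not a regular `4`-vertex, one of the edges with a used `D`-type
point points into the lexicographically positive half-plane. -/
theorem exists_uses_lexPos [Finite F] {v : V} (hQ : Q.UniformEdgeDistribution)
    (hv : ¬ Q.IsBoundaryVertex v) (heven : Even (Q.valence v)) (hreg : ¬ Q.IsRegular4 v) :
    ∃ w, Q.Adj v w ∧ Q.Uses v w ∧ LexPos (Q.dir v w) := by
  by_contra! H
  obtain ⟨c₀⟩ := Q.exists_corner v
  obtain ⟨j, hneg, hpos⟩ := exists_wrap hv c₀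
  set a₀ := (next hv ^ j) c₀
  set a₁ := next hv a₀ with ha₁
  set a₂ := next hv a₁ with ha₂
  set a₃ := next hv a₂ with ha₃
  -- An unused edge in the positive half-plane has colinear neighbours. Here `a₀` starts at the last
  -- negative edge and `a₁` at the first positive one.
  have H' : ∀ c : Q.Corner v, LexPos (Q.dir v (next hv c).rgt) →
      cross2 (Q.dir v c.rgt) (Q.dir v (next hv (next hv c)).rgt) = 0 := by
    intro c hc
    by_contra h0
    refine H _ (Corner.adj_rgt _) ?_ hc
    rw [uses_iff (rgt_next hv c).symm, ← rgt_next hv]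
    exact h0
  have c01 := cross2_next_pos hv a₀
  have c12 := cross2_next_pos hv a₁
  have c23 := cross2_next_pos hv a₂
  rw [← ha₁] at c01
  rw [← ha₂] at c12
  rw [← ha₃] at c23
  rw [← rgt_next hv, ← ha₁] at hpos
  have nz : ∀ c : Q.Corner v, LexPos (Q.dir v c.rgt) ∨ LexPos (-Q.dir v c.rgt) := fun c =>
    lexPos_or_neg (Q.dir_ne_zero c.adj_rgt.ne)
  set e₀ := Q.dir v a₀.rgt with he₀
  set e₁ := Q.dir v a₁.rgt with he₁
  set e₂ := Q.dir v a₂.rgt with he₂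
  set e₃ := Q.dir v a₃.rgt with he₃
  have h02 : cross2 e₀ e₂ = 0 := H' a₀ hpos
  -- A negative `e₂` would be a positive multiple of `e₀`, against the left turns from `e₀` to `e₁`
  -- and from `e₁` to `e₂`. So `e₂` is opposite to `e₀`, and being positive and unused it forces
  -- `e₁` and `e₃` to be colinear in turn.
  have hpos2 : LexPos e₂ := by
    refine (nz a₂).resolve_right fun h => ?_
    obtain ⟨r, hr, h⟩ := hneg.exists_pos_smul h
      (by rw [cross2_neg_left, cross2_neg_right, neg_neg]; exact h02)
    have : e₂ = r • e₀ := by rw [smul_neg] at h; exact neg_injective h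
    rw [this, cross2_smul_right, cross2_comm] at c12
    have := mul_pos hr c01
    linarith
  have h13 : cross2 e₁ e₃ = 0 := H' a₁ hpos2
  have hneg3 : LexPos (-e₃) := by
    refine (nz a₃).resolve_left fun h => ?_
    obtain ⟨r, hr, h⟩ := hpos.exists_pos_smul h h13
    have h : e₃ = r • e₁ := h
    rw [h, cross2_smul_right, cross2_comm] at c23
    have := mul_pos hr c12
    linarith
  obtain ⟨μ, hμ, h2⟩ := hneg.exists_pos_smul hpos2 (by rw [cross2_neg_left, h02, neg_zero])
  obtain ⟨ν, hν, h3⟩ := hpos.exists_pos_smul hneg3 (by rw [cross2_neg_right, h13, neg_zero])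
  have h3 : e₃ = -(ν • e₁) := by rw [← h3, neg_neg]
  have h2 : e₂ = -(μ • e₀) := by rw [h2, smul_neg]
  have ne01 : a₀ ≠ a₁ := by
    intro h; rw [he₀, h, ← he₁, cross2_self] at c01; exact c01.false
  have ne12 : a₁ ≠ a₂ := by
    intro h; rw [he₁, h, ← he₂, cross2_self] at c12; exact c12.false
  have ne23 : a₂ ≠ a₃ := by
    intro h; rw [he₂, h, ← he₃, cross2_self] at c23; exact c23.false
  have ne02 : a₀ ≠ a₂ := by
    intro h; rw [he₀, h, ← he₂] at hneg; exact hpos2.not_neg hneg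
  have ne13 : a₁ ≠ a₃ := by
    intro h; rw [he₁, h, ← he₃] at hpos; exact hpos.not_neg hneg3
  have ne03 : a₀ ≠ a₃ := by
    intro h
    rw [he₃, ← h, ← he₀, cross2_comm, h02] at c23
    simp at c23
  have hcard : Q.valence v = Nat.card (Q.Corner v) := valence_eq_card hv
  have hinj := Corner.rgt_injective (Q := Q) v
  classical
  have := Fintype.ofFinite (Q.Corner v)
  let s : Finset (Q.Corner v) := {a₀, a₁, a₂, a₃}
  have hs : s.card = 4 := by
    simp [s, ne01, ne12, ne23, ne02, ne13, ne03]
  have h4 : 4 ≤ Q.valence v := by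
    rw [hcard, Nat.card_eq_fintype_card, ← hs]
    exact Finset.card_le_univ s
  -- With four edges the two opposite pairs make a regular 4-vertex. Otherwise evenness gives at
  -- least six edges, and the distribution condition applies to the quadrant between `e₃` and `e₀`.
  rcases h4.eq_or_lt with h4 | h4
  · refine hreg ⟨hv, h4.symm, fun w hw => ?_⟩
    obtain ⟨c, rfl⟩ := exists_rgt_of_adj hv hw
    have hc : c ∈ s := by
      have : s = Finset.univ := by
        rw [← Finset.card_eq_iff_eq_univ, hs, h4, hcard, Nat.card_eq_fintype_card]
      rw [this]
      exact Finset.mem_univ c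
    simp only [s, Finset.mem_insert, Finset.mem_singleton] at hc
    rcases hc with rfl | rfl | rfl | rfl
    · exact ⟨a₂.rgt, a₂.adj_rgt, hinj.ne ne02.symm, h02⟩
    · exact ⟨a₃.rgt, a₃.adj_rgt, hinj.ne ne13.symm, h13⟩
    · exact ⟨a₀.rgt, a₀.adj_rgt, hinj.ne ne02, by rw [cross2_comm]; exact neg_eq_zero.mpr h02⟩
    · exact ⟨a₁.rgt, a₁.adj_rgt, hinj.ne ne13, by rw [cross2_comm]; exact neg_eq_zero.mpr h13⟩
  · have h6 : 6 ≤ Q.valence v := by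
      obtain ⟨n, hn⟩ := heven
      omega
    obtain ⟨w, hw, hne, hquad⟩ := hQ v heven h6 a₀.rgt a₂.rgt a₃.rgt a₁.rgt a₀.adj_rgt a₂.adj_rgt
      a₃.adj_rgt a₁.adj_rgt (by
        simp [hinj.eq_iff, ne01, ne12.symm, ne23, ne02, ne13.symm, ne03]) h02
        (by rw [cross2_comm]; exact neg_eq_zero.mpr h13)
    obtain ⟨c, rfl⟩ := exists_rgt_of_adj hv hw
    simp only [List.mem_cons, hinj.eq_iff, List.not_mem_nil, or_false, not_or] at hne
    obtain ⟨n0, n2, n3, n1⟩ := hne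
    -- In the basis `e₀, e₁` the edges `e₂, e₃` are the negative half-axes. No edge enters the open
    -- sectors of `a₀`, `a₁`, `a₂`, so any further edge has `α ≥ 0` and `β ≤ 0`: it lies in the
    -- quadrant of `e₀` and `e₃`.
    have hc := eq_smul_add_smul_of_cross2_ne_zero c01.ne' (Q.dir v c.rgt)
    set α := cross2 (Q.dir v c.rgt) e₁ / cross2 e₀ e₁
    set β := cross2 e₀ (Q.dir v c.rgt) / cross2 e₀ e₁
    have sec : ∀ d : Q.Corner v, 0 < cross2 (Q.dir v d.rgt) (Q.dir v c.rgt) →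
        0 < cross2 (Q.dir v c.rgt) (Q.dir v (next hv d).rgt) → False := by
      intro d h h'
      rw [rgt_next] at h'
      exact d.not_mem_sector c h h'
    have hα : 0 ≤ α := by
      by_contra! hα
      rcases lt_trichotomy β 0 with hβ | hβ | hβ
      · refine sec a₂ ?_ ?_
        · rw [← he₂, h2, hc, cross2_neg_left, cross2_smul_left, cross2_add_right, cross2_smul_right,
            cross2_smul_right, cross2_self]
          have := mul_pos (mul_pos (neg_pos.mpr hβ) hμ) c01
          linarith
        · rw [← ha₃, ← he₃, h3, hc, cross2_neg_right, cross2_smul_right, cross2_add_left,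
            cross2_smul_left, cross2_smul_left, cross2_self]
          have := mul_pos (mul_pos (neg_pos.mpr hα) hν) c01
          linarith
      · refine n2 (Corner.eq_of_rgt_parallel (r := -α / μ) (div_pos (neg_pos.mpr hα) hμ) ?_)
        rw [← he₂, h2, hc, hβ, zero_smul, add_zero, ← smul_neg, smul_smul,
          div_mul_cancel₀ _ hμ.ne']
        simp
      · refine sec a₁ ?_ ?_
        · rw [← he₁, hc, cross2_add_right, cross2_smul_right,
            cross2_smul_right, cross2_self, cross2_comm]
          have := mul_pos (neg_pos.mpr hα) c01
          linarith
        · rw [← ha₂, ← he₂, h2, hc, cross2_neg_right, cross2_smul_right, cross2_add_left,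
            cross2_smul_left, cross2_smul_left, cross2_self, cross2_comm e₁]
          have := mul_pos (mul_pos hβ hμ) c01
          linarith
    have hβ : β ≤ 0 := by
      by_contra! hβ
      rcases hα.eq_or_lt with hα | hα
      · refine n1 (Corner.eq_of_rgt_parallel hβ ?_)
        rw [← he₁, hc, ← hα, zero_smul, zero_add]
      · refine sec a₀ ?_ ?_
        · rw [← he₀, hc, cross2_add_right, cross2_smul_right, cross2_smul_right, cross2_self]
          have := mul_pos hβ c01
          linarith
        · rw [← ha₁, ← he₁, hc, cross2_add_left, cross2_smul_left, cross2_smul_left, cross2_self]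
          have := mul_pos hα c01
          linarith
    refine hquad ⟨α, -β / ν, hα, div_nonneg (by linarith) hν.le, ?_⟩
    rw [← he₀, ← he₃, h3, ← smul_neg, smul_smul, div_mul_cancel₀ _ hν.ne', smul_neg, neg_smul,
      neg_neg]
    exact hc

/-! ### Boundary vertices -/

theorem adj_iff {v w : V} : Q.Adj v w ↔
    w ∈ Set.range (Corner.rgt : Q.Corner v → V) ∪ Set.range (Corner.lft : Q.Corner v → V) := by
  rw [Adj, isSide_iff_exists_rgt, isSide_iff_exists_lft]
  rfl

theorem isInnerEdge_iff {v w : V} : Q.IsInnerEdge v w ↔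
    w ∈ Set.range (Corner.rgt : Q.Corner v → V) ∩ Set.range (Corner.lft : Q.Corner v → V) := by
  rw [IsInnerEdge, isSide_iff_exists_rgt, isSide_iff_exists_lft]
  rfl

/-- Inclusion–exclusion: first and last edges of the corners together are all edges at `v`, and the
inner edges are those that occur as both. -/
theorem valence_add_ncard_inner [Finite V] [Finite F] (v : V) :
    Q.valence v + {w | Q.IsInnerEdge v w}.ncard = 2 * Nat.card (Q.Corner v) := by
  have h1 : {w | Q.Adj v w} = Set.range (Corner.rgt : Q.Corner v → V) ∪
      Set.range (Corner.lft : Q.Corner v → V) := by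
    ext w; exact adj_iff
  have h2 : {w | Q.IsInnerEdge v w} = Set.range (Corner.rgt : Q.Corner v → V) ∩
      Set.range (Corner.lft : Q.Corner v → V) := by
    ext w; exact isInnerEdge_iff
  rw [valence, h1, h2, Set.ncard_union_add_ncard_inter, ← Set.image_univ, ← Set.image_univ,
    Set.ncard_image_of_injective _ (Corner.rgt_injective v),
    Set.ncard_image_of_injective _ (Corner.lft_injective v), Set.ncard_univ]
  ring

theorem ncard_inner_lt [Finite V] {v : V} (hv : Q.IsBoundaryVertex v) :
    {w | Q.IsInnerEdge v w}.ncard < Q.valence v := by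
  refine Set.ncard_lt_ncard ⟨fun w hw => IsInnerEdge.adj hw, fun h => ?_⟩
  obtain ⟨w, hw, hw'⟩ := hv
  exact hw' (h hw)

/-- A corner of the mesh belongs to a single element. -/
theorem IsCorner.subsingleton [Finite V] [Finite F] {v : V} (hv : Q.IsCorner v) :
    Subsingleton (Q.Corner v) := by
  have h1 := valence_add_ncard_inner (Q := Q) v
  have h2 := ncard_inner_lt hv.1
  rw [hv.2] at h1 h2
  have : Nat.card (Q.Corner v) = 1 := by omega
  exact (Nat.card_eq_one_iff_unique.mp this).1

theorem IsCorner.not_isInnerEdge [Finite V] [Finite F] {v w : V} (hv : Q.IsCorner v) :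
    ¬ Q.IsInnerEdge v w := by
  rw [isInnerEdge_iff]
  rintro ⟨⟨c, rfl⟩, ⟨d, h⟩⟩
  have := hv.subsingleton
  have h1 := c.cross2_pos
  rw [Subsingleton.elim d c] at h
  rw [h, cross2_self] at h1
  exact h1.false

/-- The two corners at a boundary vertex that is not a corner of the mesh. -/
theorem exists_two_corners [Finite V] [Finite F] {v : V} (hQ : Q.Limitations)
    (hv : Q.IsBoundaryVertex v) (hc : ¬ Q.IsCorner v) :
    ∃ c d : Q.Corner v, c ≠ d ∧ (∀ x, x = c ∨ x = d) ∧ c.lft = d.rgt ∧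
      (∀ w, Q.IsInnerEdge v w ↔ w = d.rgt) ∧ c.rgt ≠ d.lft := by
  have h3 : Q.valence v = 3 := (hQ.boundary_valence v hv).resolve_left fun h => hc ⟨hv, h⟩
  have h1 := valence_add_ncard_inner (Q := Q) v
  have h2 := ncard_inner_lt hv
  rw [h3] at h1 h2
  -- Valence 3 plus the number of inner edges is even, and that number is less than 3; so there is
  -- one inner edge and there are two corners.
  have hcard : Nat.card (Q.Corner v) = 2 := by omega
  have hin : {w | Q.IsInnerEdge v w}.ncard = 1 := by omega
  obtain ⟨w, hw⟩ := Set.ncard_eq_one.mp hin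
  have hw' : ∀ x, Q.IsInnerEdge v x ↔ x = w := by
    intro x
    have := Set.ext_iff.mp hw x
    simpa using this
  obtain ⟨⟨d, hd⟩, ⟨c, hc⟩⟩ := isInnerEdge_iff.mp ((hw' w).mpr rfl)
  have hcd : c ≠ d := by
    rintro rfl
    have h1 := c.cross2_pos
    rw [hc, hd, cross2_self] at h1
    exact h1.false
  have hall : ∀ x, x = c ∨ x = d := by
    classical
    have := Fintype.ofFinite (Q.Corner v)
    intro x
    have h : ({c, d} : Finset (Q.Corner v)) = Finset.univ := by
      rw [← Finset.card_eq_iff_eq_univ, Finset.card_pair hcd, ← hcard, Nat.card_eq_fintype_card]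
    have := Finset.mem_univ x
    rw [← h] at this
    simpa using this
  refine ⟨c, d, hcd, hall, hc.trans hd.symm, by rwa [hd], fun h => ?_⟩
  have : Q.IsInnerEdge v c.rgt := isInnerEdge_iff.mpr ⟨⟨c, rfl⟩, ⟨d, h.symm⟩⟩
  rw [hw', ← hd] at this
  exact hcd (Corner.rgt_injective v this)

end QuadMesh

/-! ### Polynomials in Bézier form -/

/-- The quartic polynomial with the given Bézier coefficients. -/
def quartic (a : ℕ → ℝ) (s : ℝ) : ℝ :=
  a 0 * (1 - s) ^ 4 + 4 * a 1 * s * (1 - s) ^ 3 + 6 * a 2 * s ^ 2 * (1 - s) ^ 2 +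
    4 * a 3 * s ^ 3 * (1 - s) + a 4 * s ^ 4

/-- The cubic polynomial with the given Bézier coefficients. -/
def cubic (a : ℕ → ℝ) (s : ℝ) : ℝ :=
  a 0 * (1 - s) ^ 3 + 3 * a 1 * s * (1 - s) ^ 2 + 3 * a 2 * s ^ 2 * (1 - s) + a 3 * s ^ 3

theorem quartic_sub (a b : ℕ → ℝ) (s : ℝ) :
    quartic (fun i => a i - b i) s = quartic a s - quartic b s := by
  simp only [quartic]; ring

theorem quartic_reflect (a : ℕ → ℝ) (s : ℝ) : quartic (fun i => a (4 - i)) s = quartic a (1 - s) := by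
  simp only [quartic, Nat.reduceSub]; ring

theorem quartic_comm (a : ℕ → ℕ → ℝ) (s t : ℝ) :
    quartic (fun j => quartic (fun i => a i j) s) t =
      quartic (fun i => quartic (fun j => a i j) t) s := by
  simp only [quartic]; ring

theorem quartic_congr {a b : ℕ → ℝ} (h : ∀ i ≤ 4, a i = b i) (s : ℝ) : quartic a s = quartic b s := by
  simp only [quartic, h 0 (by norm_num), h 1 (by norm_num), h 2 (by norm_num), h 3 (by norm_num),
    h 4 (by norm_num)]

theorem quartic_zero (a : ℕ → ℝ) : quartic a 0 = a 0 := by simp [quartic]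

theorem hasDerivAt_quartic (a : ℕ → ℝ) (s : ℝ) :
    HasDerivAt (quartic a) (4 * cubic (fun i => a (i + 1) - a i) s) s := by
  have h1 : HasDerivAt (fun s : ℝ => 1 - s) (-1) s := by
    exact (hasDerivAt_id s).const_sub 1
  have h2 : HasDerivAt (fun s : ℝ => s) 1 s := hasDerivAt_id s
  have h := (((((h1.pow 4).const_mul (a 0)).add ((h2.const_mul (4 * a 1)).mul (h1.pow 3))).add
    (((h2.pow 2).const_mul (6 * a 2)).mul (h1.pow 2))).add
    (((h2.pow 3).const_mul (4 * a 3)).mul h1)).add ((h2.pow 4).const_mul (a 4))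
  convert! h using 1
  simp only [cubic, zero_add, Nat.reduceAdd, Pi.pow_apply]
  norm_num
  ring

open Polynomial in
-- The substitution `s = x / (1 + x)`, followed by multiplication by `(1 + x) ^ n`, turns the Bézier
-- form into the power form with the same coefficients; that polynomial vanishes for all `x > 0`.
theorem eq_zero_of_forall_bezier_eq_zero {n : ℕ} {c : ℕ → ℝ}
    (h : ∀ s ∈ Set.Ioo (0 : ℝ) 1, ∑ i ∈ Finset.range (n + 1), c i * (s ^ i * (1 - s) ^ (n - i)) = 0)
    {i : ℕ} (hi : i ≤ n) : c i = 0 := by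
  let p : ℝ[X] := ∑ i ∈ Finset.range (n + 1), C (c i) * X ^ i
  have hp : p = 0 := by
    refine Polynomial.eq_zero_of_infinite_isRoot p ((Set.Ioi_infinite (0 : ℝ)).mono fun x hx => ?_)
    have hx : 0 < x := hx
    have h1 := h (x / (1 + x)) ⟨by positivity, by rw [div_lt_one (by positivity)]; linarith⟩
    have h2 : ∀ i ∈ Finset.range (n + 1), c i * x ^ i =
        c i * ((x / (1 + x)) ^ i * (1 - x / (1 + x)) ^ (n - i)) * (1 + x) ^ n := by
      intro i hi
      have e : 1 - x / (1 + x) = 1 / (1 + x) := by field_simp; ring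
      have hn : (1 + x) ^ n = (1 + x) ^ i * (1 + x) ^ (n - i) := by
        rw [← pow_add, Nat.add_sub_cancel' (Nat.lt_succ_iff.mp (Finset.mem_range.mp hi))]
      rw [e, hn, div_pow, div_pow, one_pow]
      field_simp
    have h3 : ∑ i ∈ Finset.range (n + 1), c i * x ^ i = 0 := by
      rw [Finset.sum_congr rfl h2, ← Finset.sum_mul, h1, zero_mul]
    simpa [p, Polynomial.IsRoot, Polynomial.eval_finsetSum] using h3
  have h3 : p.coeff i = c i := by
    simp only [p, Polynomial.finsetSum_coeff, Polynomial.coeff_C_mul, Polynomial.coeff_X_pow]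
    rw [Finset.sum_eq_single i]
    · simp
    · intro j _ hj
      simp [hj.symm]
    · intro h
      exact absurd (Finset.mem_range.mpr (Nat.lt_succ_of_le hi)) h
  rw [← h3, hp, Polynomial.coeff_zero]

theorem eq_zero_of_quartic_eq_zero {a : ℕ → ℝ} (h : ∀ s ∈ Set.Ioo (0 : ℝ) 1, quartic a s = 0)
    {i : ℕ} (hi : i ≤ 4) : a i = 0 := by
  have := eq_zero_of_forall_bezier_eq_zero (n := 4) (c := fun i => (Nat.choose 4 i : ℝ) * a i)
    (fun s hs => by
      rw [← h s hs]
      simp [Finset.sum_range_succ, quartic, Nat.choose]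
      ring) hi
  exact (mul_eq_zero.mp this).resolve_left (by exact_mod_cast (Nat.choose_pos hi).ne')

/-- Coefficients (up to binomial factors) of the `C¹` condition along an edge: `r₀, r₁` and
`l₀, l₁` are the coefficients of the linear weights of the right and of the left element,
`w₀, w₁, w₂` those of the quadratic weight of the edge, and `q`, `p`, `r` are the rows of control
values to the left of, on and to the right of the edge. -/
def edgeCoeff (r₀ r₁ l₀ l₁ w₀ w₁ w₂ : ℝ) (p q r : ℕ → ℝ) : ℕ → ℝ
  | 0 => r₀ * (q 0 - p 0) + l₀ * (r 0 - p 0) + w₀ * (p 1 - p 0)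
  | 1 => 4 * r₀ * (q 1 - p 1) + r₁ * (q 0 - p 0) + 4 * l₀ * (r 1 - p 1) + l₁ * (r 0 - p 0) +
      3 * w₀ * (p 2 - p 1) + w₁ * (p 1 - p 0)
  | 2 => 6 * r₀ * (q 2 - p 2) + 4 * r₁ * (q 1 - p 1) + 6 * l₀ * (r 2 - p 2) +
      4 * l₁ * (r 1 - p 1) + 3 * w₀ * (p 3 - p 2) + 3 * w₁ * (p 2 - p 1) + w₂ * (p 1 - p 0)
  | 3 => 4 * r₀ * (q 3 - p 3) + 6 * r₁ * (q 2 - p 2) + 4 * l₀ * (r 3 - p 3) +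
      6 * l₁ * (r 2 - p 2) + w₀ * (p 4 - p 3) + 3 * w₁ * (p 3 - p 2) + 3 * w₂ * (p 2 - p 1)
  | 4 => r₀ * (q 4 - p 4) + 4 * r₁ * (q 3 - p 3) + l₀ * (r 4 - p 4) + 4 * l₁ * (r 3 - p 3) +
      w₁ * (p 4 - p 3) + 3 * w₂ * (p 3 - p 2)
  | 5 => r₁ * (q 4 - p 4) + l₁ * (r 4 - p 4) + w₂ * (p 4 - p 3)
  | _ => 0

/-- Linear weights times quartics and a quadratic weight times a cubic all have degree 5, so the
condition along an edge consists of six scalar equations. -/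
theorem edgeCoeff_sum (r₀ r₁ l₀ l₁ w₀ w₁ w₂ : ℝ) (p q r : ℕ → ℝ) (s : ℝ) :
    ((1 - s) * r₀ + s * r₁) * quartic (fun i => q i - p i) s +
      ((1 - s) * l₀ + s * l₁) * quartic (fun i => r i - p i) s +
      (w₀ * (1 - s) ^ 2 + w₁ * s * (1 - s) + w₂ * s ^ 2) * cubic (fun i => p (i + 1) - p i) s =
    ∑ i ∈ Finset.range 6, edgeCoeff r₀ r₁ l₀ l₁ w₀ w₁ w₂ p q r i * (s ^ i * (1 - s) ^ (5 - i)) := by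
  simp only [Finset.sum_range_succ, Finset.sum_range_zero, edgeCoeff, quartic, cubic,
    Nat.reduceSub, Nat.reduceAdd]
  ring

namespace QuadMesh

variable {V F : Type*} (Q : QuadMesh V F)

/-! ### Control points and nets -/

/-- The Bézier polynomial over the element `f`, seen from the corner `k`. -/
noncomputable def patch (Z : ℝ × ℝ → ℝ) (f : F) (k : Fin 4) (s t : ℝ) : ℝ :=
  quartic (fun j => quartic (fun i => Z (Q.cpt 4 f k i j)) s) t

theorem cpt_rotate (f : F) (k : Fin 4) (i : ℕ) {j : ℕ} (hj : j ≤ 4) :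
    Q.cpt 4 f (k + 1) i j = Q.cpt 4 f k (4 - j) i := by
  rw [cpt, param_rotate, cpt, Nat.cast_sub hj]
  congr 1
  push_cast
  ring

theorem patch_rotate (Z : ℝ × ℝ → ℝ) (f : F) (k : Fin 4) (s t : ℝ) :
    Q.patch Z f (k + 1) s t = Q.patch Z f k (1 - t) s := by
  rw [patch, quartic_comm, patch]
  refine quartic_congr (fun i _ => ?_) s
  rw [← quartic_reflect]
  exact quartic_congr (fun j hj => by rw [Q.cpt_rotate f k i hj]) t

theorem patch_eq_sum (Z : ℝ × ℝ → ℝ) (f : F) (k : Fin 4) (s t : ℝ) :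
    Q.patch Z f k s t = ∑ i ∈ Finset.range (4 + 1), ∑ j ∈ Finset.range (4 + 1),
        Z (Q.cpt 4 f k i j) *
          ((bernsteinPolynomial ℝ 4 i).eval s * (bernsteinPolynomial ℝ 4 j).eval t) := by
  have h : ∀ (a : ℕ → ℝ) (x : ℝ),
      quartic a x = ∑ i ∈ Finset.range (4 + 1), a i * (bernsteinPolynomial ℝ 4 i).eval x := by
    intro a x
    simp [Finset.sum_range_succ, quartic, bernsteinPolynomial, Nat.choose]
    ring
  rw [patch, h, Finset.sum_comm]
  refine Finset.sum_congr rfl fun j _ => ?_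
  rw [h, Finset.sum_mul]
  exact Finset.sum_congr rfl fun i _ => by ring

variable {Q} in
theorem HasNet.eq_patch {z Z : ℝ × ℝ → ℝ} (h : Q.HasNet 4 z Z) (f : F) (k : Fin 4) {s t : ℝ}
    (hs : s ∈ Set.Icc (0 : ℝ) 1) (ht : t ∈ Set.Icc (0 : ℝ) 1) :
    z (Q.param f k s t) = Q.patch Z f k s t := by
  have step : ∀ k : Fin 4, (∀ s ∈ Set.Icc (0 : ℝ) 1, ∀ t ∈ Set.Icc (0 : ℝ) 1,
      z (Q.param f k s t) = Q.patch Z f k s t) → ∀ s ∈ Set.Icc (0 : ℝ) 1, ∀ t ∈ Set.Icc (0 : ℝ) 1,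
      z (Q.param f (k + 1) s t) = Q.patch Z f (k + 1) s t := by
    intro k hk s hs t ht
    rw [param_rotate, patch_rotate]
    exact hk _ ⟨by linarith [ht.2], by linarith [ht.1]⟩ _ hs
  have h0 : ∀ s ∈ Set.Icc (0 : ℝ) 1, ∀ t ∈ Set.Icc (0 : ℝ) 1,
      z (Q.param f 0 s t) = Q.patch Z f 0 s t := by
    intro s hs t ht
    rw [h f s hs t ht, patch_eq_sum]
  have h1 := step 0 h0
  have h2 := step _ h1
  have h3 := step _ h2
  fin_cases k
  · exact h0 s hs t ht
  · exact h1 s hs t ht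
  · exact h2 s hs t ht
  · exact h3 s hs t ht

theorem hasNet_of_eq_patch {z Z : ℝ × ℝ → ℝ} (h : ∀ f, ∀ s ∈ Set.Icc (0 : ℝ) 1,
    ∀ t ∈ Set.Icc (0 : ℝ) 1, z (Q.param f 0 s t) = Q.patch Z f 0 s t) : Q.HasNet 4 z Z := by
  intro f s hs t ht
  rw [h f s hs t ht, patch_eq_sum]

theorem cpt_mem_CP (f : F) (k : Fin 4) {i j : ℕ} (hi : i ≤ 4) (hj : j ≤ 4) :
    Q.cpt 4 f k i j ∈ Q.CP 4 := by
  have step : ∀ k : Fin 4, (∀ i ≤ 4, ∀ j ≤ 4, Q.cpt 4 f k i j ∈ Q.CP 4) →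
      ∀ i ≤ 4, ∀ j ≤ 4, Q.cpt 4 f (k + 1) i j ∈ Q.CP 4 := by
    intro k hk i hi j hj
    rw [Q.cpt_rotate f k i hj]
    exact hk _ (Nat.sub_le _ _) _ hi
  have h0 : ∀ i ≤ 4, ∀ j ≤ 4, Q.cpt 4 f 0 i j ∈ Q.CP 4 := fun i hi j hj => ⟨f, i, hi, j, hj, rfl⟩
  have h1 := step 0 h0
  have h2 := step _ h1
  have h3 := step _ h2
  fin_cases k
  · exact h0 i hi j hj
  · exact h1 i hi j hj
  · exact h2 i hi j hj
  · exact h3 i hi j hj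

theorem finite_CP [Finite F] : (Q.CP 4).Finite := by
  have h : Q.CP 4 ⊆ Set.range fun x : F × Fin 5 × Fin 5 => Q.cpt 4 x.1 0 x.2.1 x.2.2 := by
    rintro _ ⟨f, i, hi, j, hj, rfl⟩
    exact ⟨(f, ⟨i, by omega⟩, ⟨j, by omega⟩), rfl⟩
  exact (Set.finite_range _).subset h

theorem cpt_zero_zero (f : F) (k : Fin 4) : Q.cpt 4 f k 0 0 = Q.pos (Q.vert f k) := by
  simp [cpt, param]

theorem cpt_one_zero (f : F) (k : Fin 4) :
    Q.cpt 4 f k 1 0 = Q.ptE (Q.vert f k) (Q.vert f (k + 1)) := by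
  rw [cpt, Nat.cast_zero, zero_div, param_zero_right, ptE]; norm_num

theorem cpt_two_zero (f : F) (k : Fin 4) :
    Q.cpt 4 f k 2 0 = Q.ptD (Q.vert f k) (Q.vert f (k + 1)) := by
  rw [cpt, Nat.cast_zero, zero_div, param_zero_right, ptD]; norm_num

theorem cpt_three_zero (f : F) (k : Fin 4) :
    Q.cpt 4 f k 3 0 = Q.ptE (Q.vert f (k + 1)) (Q.vert f k) := by
  rw [cpt, Nat.cast_zero, zero_div, param_zero_right, ptE, pos_add_smul_dir_symm]; norm_num

theorem cpt_four_zero (f : F) (k : Fin 4) : Q.cpt 4 f k 4 0 = Q.pos (Q.vert f (k + 1)) := by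
  simp [cpt, param]

theorem cpt_zero_one (f : F) (k : Fin 4) :
    Q.cpt 4 f k 0 1 = Q.ptE (Q.vert f k) (Q.vert f (k + 3)) := by
  rw [cpt, Nat.cast_zero, zero_div, param_zero_left, ptE]; norm_num

theorem cpt_four_one (f : F) (k : Fin 4) :
    Q.cpt 4 f k 4 1 = Q.ptE (Q.vert f (k + 1)) (Q.vert f (k + 2)) := by
  have := Q.cpt_rotate f k 1 (j := 0) (by norm_num)
  rw [tsub_zero] at this
  rw [← this, cpt_one_zero, fin4_add_one_add_one]

theorem cpt_three_one (f : F) (k : Fin 4) : Q.cpt 4 f k 3 1 = Q.ptT f (k + 1) := by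
  rw [ptT, Q.cpt_rotate f k 1 (by norm_num)]

theorem ptD_symm (v w : V) : Q.ptD v w = Q.ptD w v := by
  rw [ptD, ptD, pos_add_smul_dir_symm]; norm_num

theorem ptD_eq_of_sym2 {v w v' w' : V} (h : s(v, w) = s(v', w')) : Q.ptD v w = Q.ptD v' w' := by
  rcases Sym2.eq_iff.mp h with ⟨rfl, rfl⟩ | ⟨rfl, rfl⟩
  · rfl
  · exact Q.ptD_symm _ _

/-! ### Smoothness equations -/

/-- The side `k` of `f` and the side `l` of `g` are the same edge, seen from opposite sides. -/
def IsMatch (f : F) (k : Fin 4) (g : F) (l : Fin 4) : Prop :=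
  Q.vert f k = Q.vert g (l + 1) ∧ Q.vert f (k + 1) = Q.vert g l

variable {Q} in
theorem IsMatch.symm {f g : F} {k l : Fin 4} (h : Q.IsMatch f k g l) : Q.IsMatch g l f k :=
  ⟨h.2.symm, h.1.symm⟩

variable {Q} in
theorem IsMatch.isInnerEdge {f g : F} {k l : Fin 4} (h : Q.IsMatch f k g l) :
    Q.IsInnerEdge (Q.vert f k) (Q.vert f (k + 1)) :=
  ⟨⟨f, k, rfl, rfl⟩, ⟨g, l, h.2.symm, h.1.symm⟩⟩

theorem exists_isMatch {f : F} {k : Fin 4} (h : Q.IsInnerEdge (Q.vert f k) (Q.vert f (k + 1))) :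
    ∃ g l, Q.IsMatch f k g l := by
  obtain ⟨g, l, h1, h2⟩ := h.2
  exact ⟨g, l, h2.symm, h1.symm⟩

/-- Coefficients of the `C¹` condition along the common edge of `f` and `g`. -/
noncomputable def edgeEq (Z : ℝ × ℝ → ℝ) (f : F) (k : Fin 4) (g : F) (l : Fin 4) : ℕ → ℝ :=
  edgeCoeff
    (cross2 (Q.dir (Q.vert g (l + 1)) (Q.vert g (l + 2))) (Q.dir (Q.vert f k) (Q.vert f (k + 1))))
    (cross2 (Q.dir (Q.vert g l) (Q.vert g (l + 3))) (Q.dir (Q.vert f k) (Q.vert f (k + 1))))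
    (cross2 (Q.dir (Q.vert f k) (Q.vert f (k + 1))) (Q.dir (Q.vert f k) (Q.vert f (k + 3))))
    (cross2 (Q.dir (Q.vert f k) (Q.vert f (k + 1))) (Q.dir (Q.vert f (k + 1)) (Q.vert f (k + 2))))
    (cross2 (Q.dir (Q.vert f k) (Q.vert f (k + 3))) (Q.dir (Q.vert g (l + 1)) (Q.vert g (l + 2))))
    (cross2 (Q.dir (Q.vert f k) (Q.vert f (k + 3))) (Q.dir (Q.vert g l) (Q.vert g (l + 3))) +
      cross2 (Q.dir (Q.vert f (k + 1)) (Q.vert f (k + 2)))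
        (Q.dir (Q.vert g (l + 1)) (Q.vert g (l + 2))))
    (cross2 (Q.dir (Q.vert f (k + 1)) (Q.vert f (k + 2))) (Q.dir (Q.vert g l) (Q.vert g (l + 3))))
    (fun i => Z (Q.cpt 4 f k i 0)) (fun i => Z (Q.cpt 4 f k i 1)) (fun i => Z (Q.cpt 4 g l (4 - i) 1))

/-- The nets of control values that define `C¹` surfaces: at every vertex there is a tangent plane,
and the twist and middle equations hold along the inner edges. -/
structure IsSmoothNet (Z : ℝ × ℝ → ℝ) : Prop where
  tangent : ∀ v, ∃ G : ℝ × ℝ →ₗ[ℝ] ℝ, ∀ w, Q.Adj v w →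
    Z (Q.ptE v w) = Z (Q.pos v) + 1 / 4 * G (Q.dir v w)
  twist : ∀ f k g l, Q.IsMatch f k g l → Q.edgeEq Z f k g l 1 = 0
  middle : ∀ f k g l, Q.IsMatch f k g l → Q.edgeEq Z f k g l 2 = 0

variable {Q}

theorem IsMatch.cpt_reflect {f g : F} {k l : Fin 4} (h : Q.IsMatch f k g l) {i : ℕ} (hi : i ≤ 4) :
    Q.cpt 4 g l i 0 = Q.cpt 4 f k (4 - i) 0 := by
  simp only [cpt, Nat.cast_zero, zero_div, param_zero_right, Nat.cast_sub hi]
  rw [← h.1, ← h.2, pos_add_smul_dir_symm]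
  congr 2
  push_cast
  ring

/-- Reading the edge backwards from the other element reverses the coefficients. Equations 3 and 4
are therefore the middle and twist equations of the opposite end. -/
theorem edgeEq_symm (Z : ℝ × ℝ → ℝ) {f g : F} {k l : Fin 4} (h : Q.IsMatch f k g l) {i : ℕ}
    (hi : i ≤ 5) : Q.edgeEq Z g l f k i = Q.edgeEq Z f k g l (5 - i) := by
  have h0 := h.cpt_reflect (i := 0) (by norm_num)
  have h1 := h.cpt_reflect (i := 1) (by norm_num)
  have h2 := h.cpt_reflect (i := 2) (by norm_num)
  have h3 := h.cpt_reflect (i := 3) (by norm_num)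
  have h4 := h.cpt_reflect (i := 4) (by norm_num)
  have hd : Q.dir (Q.vert g l) (Q.vert g (l + 1)) = -Q.dir (Q.vert f k) (Q.vert f (k + 1)) := by
    rw [← h.1, ← h.2, dir_symm]
  interval_cases i <;>
    simp only [edgeEq, edgeCoeff, h0, h1, h2, h3, h4, Nat.reduceSub, hd, tsub_zero, tsub_self,
      cross2_neg_left, cross2_neg_right] <;>
    simp only [cross2] <;> ring

/-- Coefficient 0 is the tangent map at the vertex applied to the linear relation between the three
edge vectors there. -/
theorem IsSmoothNet.edgeEq_zero {Z : ℝ × ℝ → ℝ}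
    (hZ : ∀ v, ∃ G : ℝ × ℝ →ₗ[ℝ] ℝ, ∀ w, Q.Adj v w →
      Z (Q.ptE v w) = Z (Q.pos v) + 1 / 4 * G (Q.dir v w)) {f g : F} {k l : Fin 4}
    (h : Q.IsMatch f k g l) : Q.edgeEq Z f k g l 0 = 0 := by
  obtain ⟨G, hG⟩ := hZ (Q.vert f k)
  simp only [edgeEq, edgeCoeff, tsub_zero, cpt_zero_zero, cpt_one_zero, cpt_zero_one, cpt_four_one]
  rw [← h.1]
  have a1 : Q.Adj (Q.vert f k) (Q.vert f (k + 1)) := Or.inl ⟨f, k, rfl, rfl⟩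
  have a2 : Q.Adj (Q.vert f k) (Q.vert f (k + 3)) :=
    Or.inr ⟨f, k + 3, rfl, by rw [fin4_add_three_add_one]⟩
  have a3 : Q.Adj (Q.vert f k) (Q.vert g (l + 2)) :=
    Or.inl ⟨g, l + 1, h.1.symm, by rw [fin4_add_one_add_one]⟩
  rw [hG _ a1, hG _ a2, hG _ a3]
  set a := Q.dir (Q.vert f k) (Q.vert f (k + 1))
  set b := Q.dir (Q.vert f k) (Q.vert f (k + 3))
  set c := Q.dir (Q.vert f k) (Q.vert g (l + 2))
  have key := congrArg G (cross2_smul_add_smul_add_smul a b c)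
  simp only [map_add, map_smul, smul_eq_mul, map_zero] at key
  linear_combination 1 / 4 * key

/-- Coefficients 0 and 5 come from the tangent planes, 1 and 2 from the edge as given, 3 and 4 from
the reversed edge. -/
theorem IsSmoothNet.edgeEq_eq_zero {Z : ℝ × ℝ → ℝ} (hZ : Q.IsSmoothNet Z) {f g : F} {k l : Fin 4}
    (h : Q.IsMatch f k g l) (i : ℕ) : Q.edgeEq Z f k g l i = 0 := by
  rcases i with _ | _ | _ | _ | _ | _ | i
  · exact IsSmoothNet.edgeEq_zero hZ.tangent h
  · exact hZ.twist _ _ _ _ h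
  · exact hZ.middle _ _ _ _ h
  · exact (edgeEq_symm Z h.symm (i := 3) (by norm_num)).trans (hZ.middle _ _ _ _ h.symm)
  · exact (edgeEq_symm Z h.symm (i := 4) (by norm_num)).trans (hZ.twist _ _ _ _ h.symm)
  · exact (edgeEq_symm Z h.symm (i := 5) (by norm_num)).trans
      (IsSmoothNet.edgeEq_zero hZ.tangent h.symm)
  · rfl

/-! ### Derivatives along the sides of an element -/

theorem bilinear_hasDerivAt_left (p₀ p₁ p₂ p₃ : ℝ × ℝ) (s t : ℝ) :
    HasDerivAt (fun s => bilinear p₀ p₁ p₂ p₃ s t) (bilinearS p₀ p₁ p₂ p₃ t) s := by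
  have h : (fun s => bilinear p₀ p₁ p₂ p₃ s t) =
      fun s => bilinear p₀ p₁ p₂ p₃ 0 t + s • bilinearS p₀ p₁ p₂ p₃ t := by
    funext s
    ext <;> simp only [bilinear, bilinearS, Prod.fst_add, Prod.snd_add, Prod.fst_sub, Prod.snd_sub,
      Prod.smul_fst, Prod.smul_snd, smul_eq_mul] <;> ring
  rw [h]
  have := ((hasDerivAt_id s).smul_const (bilinearS p₀ p₁ p₂ p₃ t)).const_add
    (bilinear p₀ p₁ p₂ p₃ 0 t)
  rwa [one_smul] at this

theorem bilinear_hasDerivAt_right (p₀ p₁ p₂ p₃ : ℝ × ℝ) (s t : ℝ) :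
    HasDerivAt (fun t => bilinear p₀ p₁ p₂ p₃ s t) (bilinearT p₀ p₁ p₂ p₃ s) t := by
  have h : (fun t => bilinear p₀ p₁ p₂ p₃ s t) =
      fun t => bilinear p₀ p₁ p₂ p₃ s 0 + t • bilinearT p₀ p₁ p₂ p₃ s := by
    funext t
    ext <;> simp only [bilinear, bilinearT, Prod.fst_add, Prod.snd_add, Prod.fst_sub, Prod.snd_sub,
      Prod.smul_fst, Prod.smul_snd, smul_eq_mul] <;> ring
  rw [h]
  have := ((hasDerivAt_id t).smul_const (bilinearT p₀ p₁ p₂ p₃ s)).const_add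
    (bilinear p₀ p₁ p₂ p₃ s 0)
  rwa [one_smul] at this

/-- The transversal derivative of the parametrisation along a side. -/
def sideT (Q : QuadMesh V F) (f : F) (k : Fin 4) (s : ℝ) : ℝ × ℝ :=
  (1 - s) • Q.dir (Q.vert f k) (Q.vert f (k + 3)) +
    s • Q.dir (Q.vert f (k + 1)) (Q.vert f (k + 2))

/-- The derivative of `t ↦ z (param s t)` at `t = 0` is computed both by the chain rule and from the
Bézier form; one-sided derivatives on an interval are unique. -/
theorem grad_sideT {z Z : ℝ × ℝ → ℝ} {f : F}
    (hz : ∀ k, ∀ s ∈ Set.Icc (0 : ℝ) 1, ∀ t ∈ Set.Icc (0 : ℝ) 1,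
      z (Q.param f k s t) = Q.patch Z f k s t) {k : Fin 4} {s : ℝ} (hs : s ∈ Set.Icc (0 : ℝ) 1)
    {G : ℝ × ℝ →L[ℝ] ℝ} (hG : HasFDerivWithinAt z G (Q.elem f) (Q.param f k s 0)) :
    G (Q.sideT f k s) = 4 * quartic (fun i => Z (Q.cpt 4 f k i 1) - Z (Q.cpt 4 f k i 0)) s := by
  have h0 : (0 : ℝ) ∈ Set.Icc (0 : ℝ) 1 := by simp
  have h1 := hG.comp_hasDerivWithinAt (f := fun t => Q.param f k s t) (s := Set.Icc 0 1) 0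
    (bilinear_hasDerivAt_right _ _ _ _ s 0).hasDerivWithinAt (fun t ht => Q.param_mem_elem f k hs ht)
  have h2 := (hasDerivAt_quartic (fun j => quartic (fun i => Z (Q.cpt 4 f k i j)) s)
    0).hasDerivWithinAt (s := Set.Icc 0 1)
  have h3 := h2.congr_of_mem (f₁ := z ∘ fun t => Q.param f k s t) (fun t ht => hz k s hs t ht) h0
  have h4 := UniqueDiffWithinAt.eq_deriv _ (uniqueDiffOn_Icc zero_lt_one 0 h0) h1 h3
  rw [quartic_sub]
  simpa [cubic, bilinearT, sideT, dir] using h4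

theorem grad_side {z Z : ℝ × ℝ → ℝ} {f : F}
    (hz : ∀ k, ∀ s ∈ Set.Icc (0 : ℝ) 1, ∀ t ∈ Set.Icc (0 : ℝ) 1,
      z (Q.param f k s t) = Q.patch Z f k s t) {k : Fin 4} {s : ℝ} (hs : s ∈ Set.Icc (0 : ℝ) 1)
    {G : ℝ × ℝ →L[ℝ] ℝ} (hG : HasFDerivWithinAt z G (Q.elem f) (Q.param f k s 0)) :
    G (Q.dir (Q.vert f k) (Q.vert f (k + 1))) =
      4 * cubic (fun i => Z (Q.cpt 4 f k (i + 1) 0) - Z (Q.cpt 4 f k i 0)) s := by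
  have h0 : (0 : ℝ) ∈ Set.Icc (0 : ℝ) 1 := by simp
  have h1 := hG.comp_hasDerivWithinAt (f := fun s => Q.param f k s 0) (s := Set.Icc 0 1) s
    (bilinear_hasDerivAt_left _ _ _ _ s 0).hasDerivWithinAt (fun s hs => Q.param_mem_elem f k hs h0)
  have h2 := (hasDerivAt_quartic (fun i => Z (Q.cpt 4 f k i 0)) s).hasDerivWithinAt
    (s := Set.Icc 0 1)
  have h3 := h2.congr_of_mem (f₁ := z ∘ fun s => Q.param f k s 0) (fun s hs => by
    rw [Function.comp_apply, hz k s hs 0 h0, patch, quartic_zero]) hs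
  have h4 := UniqueDiffWithinAt.eq_deriv _ (uniqueDiffOn_Icc zero_lt_one s hs) h1 h3
  simpa [bilinearS, dir] using h4

/-- The weights of the `C¹` condition along an edge, as polynomials. -/
theorem edgeEq_sum (Z : ℝ × ℝ → ℝ) {f g : F} {k l : Fin 4} (h : Q.IsMatch f k g l) (s : ℝ) :
    cross2 (Q.sideT g l (1 - s)) (Q.dir (Q.vert f k) (Q.vert f (k + 1))) *
        quartic (fun i => Z (Q.cpt 4 f k i 1) - Z (Q.cpt 4 f k i 0)) s +
      cross2 (Q.dir (Q.vert f k) (Q.vert f (k + 1))) (Q.sideT f k s) *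
        quartic (fun i => Z (Q.cpt 4 g l i 1) - Z (Q.cpt 4 g l i 0)) (1 - s) +
      cross2 (Q.sideT f k s) (Q.sideT g l (1 - s)) *
        cubic (fun i => Z (Q.cpt 4 f k (i + 1) 0) - Z (Q.cpt 4 f k i 0)) s =
    ∑ i ∈ Finset.range 6, Q.edgeEq Z f k g l i * (s ^ i * (1 - s) ^ (5 - i)) := by
  have e := edgeCoeff_sum
    (cross2 (Q.dir (Q.vert g (l + 1)) (Q.vert g (l + 2))) (Q.dir (Q.vert f k) (Q.vert f (k + 1))))
    (cross2 (Q.dir (Q.vert g l) (Q.vert g (l + 3))) (Q.dir (Q.vert f k) (Q.vert f (k + 1))))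
    (cross2 (Q.dir (Q.vert f k) (Q.vert f (k + 1))) (Q.dir (Q.vert f k) (Q.vert f (k + 3))))
    (cross2 (Q.dir (Q.vert f k) (Q.vert f (k + 1))) (Q.dir (Q.vert f (k + 1)) (Q.vert f (k + 2))))
    (cross2 (Q.dir (Q.vert f k) (Q.vert f (k + 3))) (Q.dir (Q.vert g (l + 1)) (Q.vert g (l + 2))))
    (cross2 (Q.dir (Q.vert f k) (Q.vert f (k + 3))) (Q.dir (Q.vert g l) (Q.vert g (l + 3))) +
      cross2 (Q.dir (Q.vert f (k + 1)) (Q.vert f (k + 2)))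
        (Q.dir (Q.vert g (l + 1)) (Q.vert g (l + 2))))
    (cross2 (Q.dir (Q.vert f (k + 1)) (Q.vert f (k + 2))) (Q.dir (Q.vert g l) (Q.vert g (l + 3))))
    (fun i => Z (Q.cpt 4 f k i 0)) (fun i => Z (Q.cpt 4 f k i 1))
    (fun i => Z (Q.cpt 4 g l (4 - i) 1)) s
  rw [edgeEq, ← e]
  have h1 : quartic (fun i => Z (Q.cpt 4 g l i 1) - Z (Q.cpt 4 g l i 0)) (1 - s) =
      quartic (fun i => Z (Q.cpt 4 g l (4 - i) 1) - Z (Q.cpt 4 f k i 0)) s := by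
    rw [← quartic_reflect]
    refine quartic_congr (fun i hi => ?_) s
    rw [h.cpt_reflect (Nat.sub_le 4 i), Nat.sub_sub_self hi]
  rw [h1]
  have h2 : cross2 (Q.sideT g l (1 - s)) (Q.dir (Q.vert f k) (Q.vert f (k + 1))) =
      (1 - s) * cross2 (Q.dir (Q.vert g (l + 1)) (Q.vert g (l + 2)))
        (Q.dir (Q.vert f k) (Q.vert f (k + 1))) +
      s * cross2 (Q.dir (Q.vert g l) (Q.vert g (l + 3)))
        (Q.dir (Q.vert f k) (Q.vert f (k + 1))) := by
    rw [sideT, cross2_add_left, cross2_smul_left, cross2_smul_left]; ring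
  have h3 : cross2 (Q.dir (Q.vert f k) (Q.vert f (k + 1))) (Q.sideT f k s) =
      (1 - s) * cross2 (Q.dir (Q.vert f k) (Q.vert f (k + 1)))
        (Q.dir (Q.vert f k) (Q.vert f (k + 3))) +
      s * cross2 (Q.dir (Q.vert f k) (Q.vert f (k + 1)))
        (Q.dir (Q.vert f (k + 1)) (Q.vert f (k + 2))) := by
    rw [sideT, cross2_add_right, cross2_smul_right, cross2_smul_right]
  have h4 : cross2 (Q.sideT f k s) (Q.sideT g l (1 - s)) =
      cross2 (Q.dir (Q.vert f k) (Q.vert f (k + 3))) (Q.dir (Q.vert g (l + 1)) (Q.vert g (l + 2))) *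
        (1 - s) ^ 2 +
      (cross2 (Q.dir (Q.vert f k) (Q.vert f (k + 3))) (Q.dir (Q.vert g l) (Q.vert g (l + 3))) +
        cross2 (Q.dir (Q.vert f (k + 1)) (Q.vert f (k + 2)))
        (Q.dir (Q.vert g (l + 1)) (Q.vert g (l + 2)))) * s * (1 - s) +
      cross2 (Q.dir (Q.vert f (k + 1)) (Q.vert f (k + 2))) (Q.dir (Q.vert g l) (Q.vert g (l + 3))) *
        s ^ 2 := by
    simp only [sideT, cross2_add_right, cross2_add_left, cross2_smul_right, cross2_smul_left]; ring
  rw [h2, h3, h4]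

theorem elem_subset_domain (f : F) : Q.elem f ⊆ Q.domain :=
  Set.subset_iUnion (fun f => convexHull ℝ (Set.range fun k => Q.pos (Q.vert f k))) f

theorem IsMatch.param_eq {f g : F} {k l : Fin 4} (h : Q.IsMatch f k g l) (s : ℝ) :
    Q.param g l (1 - s) 0 = Q.param f k s 0 := by
  rw [param_zero_right, param_zero_right, h.1, h.2, pos_add_smul_dir_symm]
  congr 2
  ring

/-- The gradient of a piecewise polynomial at a vertex. -/
theorem grad_vertex {z Z : ℝ × ℝ → ℝ} {f : F}
    (hz : ∀ k, ∀ s ∈ Set.Icc (0 : ℝ) 1, ∀ t ∈ Set.Icc (0 : ℝ) 1,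
      z (Q.param f k s t) = Q.patch Z f k s t) {k : Fin 4}
    {G : ℝ × ℝ →L[ℝ] ℝ} (hG : HasFDerivWithinAt z G (Q.elem f) (Q.pos (Q.vert f k))) :
    Z (Q.ptE (Q.vert f k) (Q.vert f (k + 1))) = Z (Q.pos (Q.vert f k)) +
        1 / 4 * G (Q.dir (Q.vert f k) (Q.vert f (k + 1))) ∧
      Z (Q.ptE (Q.vert f k) (Q.vert f (k + 3))) = Z (Q.pos (Q.vert f k)) +
        1 / 4 * G (Q.dir (Q.vert f k) (Q.vert f (k + 3))) := by
  rw [pos_eq_param] at hG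
  have h1 := grad_side hz (by simp) hG
  have h2 := grad_sideT hz (by simp) hG
  simp only [sideT, sub_zero, one_smul, zero_smul, add_zero, quartic_zero, cpt_zero_one,
    cpt_zero_zero] at h2
  simp only [cubic, zero_add, cpt_one_zero, cpt_zero_zero] at h1
  rw [h1, h2]
  constructor <;> ring

/-- The control values of a `C¹` surface satisfy the smoothness equations. -/
theorem isSmoothNet_of_mem_FUN {z Z : ℝ × ℝ → ℝ} (hz : z ∈ Q.FUN 4) (hZ : Q.HasNet 4 z Z) :
    Q.IsSmoothNet Z := by
  have hdiff : ∀ x ∈ Q.domain, HasFDerivWithinAt z (fderivWithin ℝ z Q.domain x) Q.domain x :=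
    fun x hx => ((hz.1.differentiableOn one_ne_zero) x hx).hasFDerivWithinAt
  have hpatch : ∀ f k, ∀ s ∈ Set.Icc (0 : ℝ) 1, ∀ t ∈ Set.Icc (0 : ℝ) 1,
      z (Q.param f k s t) = Q.patch Z f k s t := fun f k s hs t ht => hZ.eq_patch f k hs ht
  have hedge : ∀ f k g l, Q.IsMatch f k g l → ∀ i ≤ 5, Q.edgeEq Z f k g l i = 0 := by
    intro f k g l h i hi
    refine eq_zero_of_forall_bezier_eq_zero (n := 5) (fun s hs => ?_) hi
    have hs := Set.Ioo_subset_Icc_self hs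
    have hs' : 1 - s ∈ Set.Icc (0 : ℝ) 1 := ⟨by linarith [hs.2], by linarith [hs.1]⟩
    have hm := Q.param_mem_elem f k hs (t := 0) (by simp)
    have hm' := Q.param_mem_elem g l hs' (t := 0) (by simp)
    have hG := hdiff _ (elem_subset_domain f hm)
    have hG' := hdiff _ (elem_subset_domain g hm')
    rw [h.param_eq] at hG'
    set G := fderivWithin ℝ z Q.domain (Q.param f k s 0)
    have e1 := grad_sideT (hpatch f) hs (hG.mono (elem_subset_domain f))
    have e2 := grad_side (hpatch f) hs (hG.mono (elem_subset_domain f))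
    rw [← h.param_eq] at hG'
    have e3 := grad_sideT (hpatch g) hs' (hG'.mono (elem_subset_domain g))
    rw [← edgeEq_sum Z h]
    -- A single gradient `G` serves both elements at the edge point. Applied to the linear relation
    -- between the edge and the two transversal directions, it gives the degree 5 identity.
    have key := congrArg G (cross2_smul_add_smul_add_smul (Q.dir (Q.vert f k) (Q.vert f (k + 1)))
      (Q.sideT f k s) (Q.sideT g l (1 - s)))
    simp only [map_add, map_smul, smul_eq_mul, map_zero, e1, e2, e3] at key
    linear_combination 1 / 4 * key
  refine ⟨fun v => ⟨(fderivWithin ℝ z Q.domain (Q.pos v)).toLinearMap, fun w hw => ?_⟩,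
    fun f k g l h => hedge f k g l h 1 (by norm_num),
    fun f k g l h => hedge f k g l h 2 (by norm_num)⟩
  have hv : ∀ f k, Q.vert f k = v →
      HasFDerivWithinAt z (fderivWithin ℝ z Q.domain (Q.pos v)) (Q.elem f) (Q.pos (Q.vert f k)) := by
    rintro f k rfl
    exact (hdiff _ (elem_subset_domain f (Q.pos_mem_elem f k))).mono (elem_subset_domain f)
  rcases adj_iff.mp hw with ⟨c, rfl⟩ | ⟨c, rfl⟩
  · have := (grad_vertex (hpatch c.1.1) (hv c.1.1 c.1.2 c.2)).1
    rwa [c.2] at this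
  · have := (grad_vertex (hpatch c.1.1) (hv c.1.1 c.1.2 c.2)).2
    rwa [c.2] at this

/-- Two nets that define the same surface agree on the control points. -/
theorem HasNet.eq_zero_of_eq_zero {z Z : ℝ × ℝ → ℝ} (hZ : Q.HasNet 4 z Z)
    (hz : ∀ x ∈ Q.domain, z x = 0) {P : ℝ × ℝ} (hP : P ∈ Q.CP 4) : Z P = 0 := by
  obtain ⟨f, i, hi, j, hj, rfl⟩ := hP
  have h : ∀ s ∈ Set.Ioo (0 : ℝ) 1, quartic (fun i => Z (Q.cpt 4 f 0 i j)) s = 0 := by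
    intro s hs
    refine eq_zero_of_quartic_eq_zero (a := fun j => quartic (fun i => Z (Q.cpt 4 f 0 i j)) s)
      (fun t ht => ?_) hj
    have hs := Set.Ioo_subset_Icc_self hs
    have ht := Set.Ioo_subset_Icc_self ht
    have := hZ.eq_patch f 0 hs ht
    rw [hz _ (elem_subset_domain f (Q.param_mem_elem f 0 hs ht))] at this
    exact this.symm
  exact eq_zero_of_quartic_eq_zero h hi

theorem quartic_eq_zero {a : ℕ → ℝ} (h : ∀ i ≤ 4, a i = 0) (s : ℝ) : quartic a s = 0 := by
  rw [quartic_congr (b := fun _ => 0) h]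
  simp [quartic]

theorem HasNet.eq_zero {z Z : ℝ × ℝ → ℝ} (hZ : Q.HasNet 4 z Z) (h : ∀ P ∈ Q.CP 4, Z P = 0) :
    ∀ x ∈ Q.domain, z x = 0 := by
  intro x hx
  obtain ⟨f, hx⟩ := Set.mem_iUnion.mp hx
  obtain ⟨s, hs, t, ht, rfl⟩ := Q.exists_param_of_mem_elem hx 0
  rw [hZ.eq_patch f 0 hs ht, patch]
  exact quartic_eq_zero (fun j hj => quartic_eq_zero (fun i hi => h _ ⟨f, i, hi, j, hj, rfl⟩) _) _

end QuadMesh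

/-! ### Gradients transported through a parametrisation -/

open Filter Topology in
/-- A function that becomes `C¹` after composition with a `C¹` parametrisation of a compact set has
a continuous gradient on this set. -/
theorem exists_continuousOn_gradient {E : Type*} [NormedAddCommGroup E] [NormedSpace ℝ E]
    [FiniteDimensional ℝ E] {X : E → E} {B z : E → ℝ} {K : Set E} (hX : ContDiff ℝ 1 X)
    (hB : ContDiff ℝ 1 B) (hK : IsCompact K) (hinj : Set.InjOn X K)
    (hinv : ∀ u ∈ K, ∃ e : E ≃L[ℝ] E, (e : E →L[ℝ] E) = fderiv ℝ X u)
    (hz : ∀ u ∈ K, z (X u) = B u) :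
    ∃ G : E → E →L[ℝ] ℝ, ContinuousOn G (X '' K) ∧
      ∀ x ∈ X '' K, HasFDerivWithinAt z (G x) (X '' K) x := by
  have : CompleteSpace E := FiniteDimensional.complete ℝ E
  obtain ⟨Y, hY⟩ : ∃ Y : E → E, ∀ u ∈ K, Y (X u) = u :=
    ⟨Function.invFunOn X K, fun u hu => hinj.leftInvOn_invFunOn hu⟩
  let φ : K → E := fun u => X u
  have hφc : Continuous φ := hX.continuous.comp continuous_subtype_val
  have hφi : Function.Injective φ := fun u v h => Subtype.ext (hinj u.2 v.2 h)
  have : CompactSpace K := isCompact_iff_compactSpace.mp hK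
  -- Compactness makes the injective map `X` a homeomorphism of `K` onto its image, so limits within
  -- the image can be computed in `K`.
  have hφ : IsEmbedding φ := (hφc.isClosedEmbedding hφi).isEmbedding
  have hrange : Set.range φ = X '' K := by
    ext x; simp [φ]
  have hnhds : ∀ u : K, 𝓝[X '' K] (X u) = map φ (𝓝 u) := fun u => by
    rw [hφ.map_nhds_eq, hrange]
  -- The chain rule leaves only one candidate: the derivative of `B` after the inverse of that of
  -- `X`. Its continuity is that of operator inversion at invertible operators.
  refine ⟨fun x => (fderiv ℝ B (Y x)).comp (fderiv ℝ X (Y x)).inverse, ?_, ?_⟩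
  · rintro _ ⟨u, hu, rfl⟩
    rw [ContinuousWithinAt, hnhds ⟨u, hu⟩, tendsto_map'_iff]
    have e : (fun x => (fderiv ℝ B (Y x)).comp (fderiv ℝ X (Y x)).inverse) ∘ φ =
        (fun u => (fderiv ℝ B u).comp (fderiv ℝ X u).inverse) ∘ ((↑) : K → E) := by
      funext u
      simp only [Function.comp_apply, φ, hY u.1 u.2]
    rw [e, hY u hu]
    refine Tendsto.comp (y := 𝓝 u) ?_ (continuous_subtype_val.tendsto (⟨u, hu⟩ : K))
    have h1 : ContinuousAt (fderiv ℝ B) u := (hB.continuous_fderiv one_ne_zero).continuousAt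
    have h2 : ContinuousAt (fun u => (fderiv ℝ X u).inverse) u := by
      obtain ⟨e, he⟩ := hinv u hu
      refine ContinuousAt.comp (g := ContinuousLinearMap.inverse) ?_
        (hX.continuous_fderiv one_ne_zero).continuousAt
      rw [← he]
      exact (contDiffAt_map_inverse (n := 0) e).continuousAt
    exact h1.clm_comp h2
  · rintro _ ⟨u, hu, rfl⟩
    obtain ⟨e, he⟩ := hinv u hu
    have hs : HasStrictFDerivAt X (e : E →L[ℝ] E) u :=
      he ▸ hX.contDiffAt.hasStrictFDerivAt one_ne_zero
    have h1 := hs.to_localInverse.hasFDerivAt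
    have h2 : hs.localInverse X e u (X u) = u := hs.localInverse_apply_image
    have h3 : HasFDerivAt B (fderiv ℝ B u) (hs.localInverse X e u (X u)) := by
      rw [h2]
      exact (hB.differentiable one_ne_zero u).hasFDerivAt
    have h4 := (h3.comp (X u) h1).hasFDerivWithinAt (s := X '' K)
    beta_reduce
    rw [hY u hu, ← he, ContinuousLinearMap.inverse_equiv]
    refine h4.congr_of_eventuallyEq ?_ (by rw [Function.comp_apply, h2, hz u hu])
    -- Near `X u`, but only within the image, `z` equals `B` composed with the local inverse. Points
    -- of `K` close to `u` are recovered by that inverse.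
    rw [EventuallyEq, hnhds ⟨u, hu⟩, eventually_map]
    have h5 := (continuous_subtype_val.tendsto (⟨u, hu⟩ : K)).eventually hs.eventually_left_inverse
    filter_upwards [h5] with v hv
    rw [Function.comp_apply, hv, hz v v.2]

/-- A linear form on the plane is determined by its values at two independent vectors. -/
theorem clm_ext_of_cross2_ne_zero {G H : ℝ × ℝ →L[ℝ] ℝ} {a b : ℝ × ℝ} (h : cross2 a b ≠ 0)
    (ha : G a = H a) (hb : G b = H b) : G = H := by
  refine ContinuousLinearMap.ext fun x => ?_
  rw [eq_smul_add_smul_of_cross2_ne_zero h x]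
  simp only [map_add, map_smul, ha, hb]

namespace QuadMesh

variable {V F : Type*} {Q : QuadMesh V F}

/-! ### From nets to smooth surfaces -/

theorem patch_congr_elem (Z : ℝ × ℝ → ℝ) {f : F} {k l : Fin 4} {s t s' t' : ℝ}
    (hs : s ∈ Set.Icc (0 : ℝ) 1) (ht : t ∈ Set.Icc (0 : ℝ) 1) (hs' : s' ∈ Set.Icc (0 : ℝ) 1)
    (ht' : t' ∈ Set.Icc (0 : ℝ) 1) (e : Q.param f k s t = Q.param f l s' t') :
    Q.patch Z f k s t = Q.patch Z f l s' t' := by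
  have hr : ∀ {r : ℝ}, r ∈ Set.Icc (0 : ℝ) 1 → 1 - r ∈ Set.Icc (0 : ℝ) 1 := fun h =>
    ⟨by linarith [h.2], by linarith [h.1]⟩
  rcases fin4_cases k l with rfl | rfl | rfl | rfl
  · obtain ⟨rfl, rfl⟩ := Q.param_injective hs ht hs' ht' e
    rfl
  · rw [param_rotate] at e
    obtain ⟨rfl, rfl⟩ := Q.param_injective hs ht (hr ht') hs' e
    rw [patch_rotate]
  · rw [← fin4_add_one_add_one, param_rotate, param_rotate] at e
    obtain ⟨rfl, rfl⟩ := Q.param_injective hs ht (hr hs') (hr ht') e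
    rw [← fin4_add_one_add_one, patch_rotate, patch_rotate]
  · rw [← fin4_add_two_add_one, ← fin4_add_one_add_one, param_rotate, param_rotate,
      param_rotate] at e
    obtain ⟨rfl, rfl⟩ := Q.param_injective hs ht (hr (hr ht')) (hr hs') e
    rw [← fin4_add_two_add_one, ← fin4_add_one_add_one, patch_rotate, patch_rotate, patch_rotate]

theorem patch_zero_zero (Z : ℝ × ℝ → ℝ) (f : F) (k : Fin 4) :
    Q.patch Z f k 0 0 = Z (Q.pos (Q.vert f k)) := by
  rw [patch, quartic_zero, quartic_zero, cpt_zero_zero]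

/-- Two different elements meet in a vertex or along a common edge. -/
theorem exists_vertex_or_isMatch {f g : F} (hfg : f ≠ g) {x : ℝ × ℝ} (hf : x ∈ Q.elem f)
    (hg : x ∈ Q.elem g) : (∃ k l, Q.vert f k = Q.vert g l ∧ x = Q.pos (Q.vert f k)) ∨
      ∃ k l, Q.IsMatch f k g l ∧ ∃ s ∈ Set.Icc (0 : ℝ) 1, x = Q.param f k s 0 := by
  have hm : x ∈ Q.elem f ∩ Q.elem g := ⟨hf, hg⟩
  rcases Q.regular f g hfg with h | ⟨k, l, hkl, h⟩ | ⟨k, l, hkl, h⟩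
  · exact absurd hm (by rw [elem, elem, h]; simp)
  · rw [elem, elem, h] at hm
    exact Or.inl ⟨k, l, hkl, hm⟩
  · rw [elem, elem, h, mem_segment_iff_param] at hm
    rcases Sym2.eq_iff.mp hkl with ⟨h1, h2⟩ | ⟨h1, h2⟩
    · exact absurd (side_unique h1 h2).1 hfg
    · exact Or.inr ⟨k, l, ⟨h1, h2⟩, hm⟩

/-- Different elements meet only in vertices or common edges, where a patch depends on the control
points lying there. These are shared planar points, so a net always yields a well-defined function.
-/
theorem patch_congr (Z : ℝ × ℝ → ℝ) {f g : F} {k l : Fin 4} {s t s' t' : ℝ}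
    (hs : s ∈ Set.Icc (0 : ℝ) 1) (ht : t ∈ Set.Icc (0 : ℝ) 1) (hs' : s' ∈ Set.Icc (0 : ℝ) 1)
    (ht' : t' ∈ Set.Icc (0 : ℝ) 1) (e : Q.param f k s t = Q.param g l s' t') :
    Q.patch Z f k s t = Q.patch Z g l s' t' := by
  by_cases hfg : f = g
  · subst hfg
    exact patch_congr_elem Z hs ht hs' ht' e
  have z : (0 : ℝ) ∈ Set.Icc (0 : ℝ) 1 := by simp
  rcases exists_vertex_or_isMatch hfg (Q.param_mem_elem f k hs ht)
    (e ▸ Q.param_mem_elem g l hs' ht') with ⟨k', l', hkl, hx⟩ | ⟨k', l', hm, r, hr, hx⟩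
  · have h1 := patch_congr_elem Z hs ht z z (hx.trans (Q.pos_eq_param f k'))
    have h2 := patch_congr_elem Z hs' ht' z z
      ((e.symm.trans hx).trans ((congrArg Q.pos hkl).trans (Q.pos_eq_param g l')))
    rw [h1, h2, patch_zero_zero, patch_zero_zero, hkl]
  · have hr' : 1 - r ∈ Set.Icc (0 : ℝ) 1 := ⟨by linarith [hr.2], by linarith [hr.1]⟩
    have h1 := patch_congr_elem Z hs ht hr z hx
    have h2 := patch_congr_elem Z hs' ht' hr' z ((e.symm.trans hx).trans (hm.param_eq r).symm)
    rw [h1, h2, patch, patch, quartic_zero, quartic_zero, ← quartic_reflect]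
    refine quartic_congr (fun i hi => ?_) r
    rw [hm.cpt_reflect (Nat.sub_le 4 i), Nat.sub_sub_self hi]

theorem exists_isPatchwise (Q : QuadMesh V F) (Z : ℝ × ℝ → ℝ) :
    ∃ z : ℝ × ℝ → ℝ, ∀ f k, ∀ s ∈ Set.Icc (0 : ℝ) 1, ∀ t ∈ Set.Icc (0 : ℝ) 1,
      z (Q.param f k s t) = Q.patch Z f k s t := by
  classical
  refine ⟨fun x => if h : ∃ u : F × Fin 4 × ℝ × ℝ, u.2.2.1 ∈ Set.Icc (0 : ℝ) 1 ∧
    u.2.2.2 ∈ Set.Icc (0 : ℝ) 1 ∧ x = Q.param u.1 u.2.1 u.2.2.1 u.2.2.2 then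
      Q.patch Z h.choose.1 h.choose.2.1 h.choose.2.2.1 h.choose.2.2.2 else 0, ?_⟩
  intro f k s hs t ht
  have h : ∃ u : F × Fin 4 × ℝ × ℝ, u.2.2.1 ∈ Set.Icc (0 : ℝ) 1 ∧
      u.2.2.2 ∈ Set.Icc (0 : ℝ) 1 ∧ Q.param f k s t = Q.param u.1 u.2.1 u.2.2.1 u.2.2.2 :=
    ⟨(f, k, s, t), hs, ht, rfl⟩
  simp only
  rw [dif_pos h]
  obtain ⟨h1, h2, h3⟩ := h.choose_spec
  exact (patch_congr Z hs ht h1 h2 h3).symm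

theorem elem_eq_image (f : F) : Q.elem f =
    (fun u : ℝ × ℝ => Q.param f 0 u.1 u.2) '' (Set.Icc (0 : ℝ) 1 ×ˢ Set.Icc (0 : ℝ) 1) := by
  ext x
  constructor
  · intro hx
    obtain ⟨s, hs, t, ht, rfl⟩ := Q.exists_param_of_mem_elem hx 0
    exact ⟨(s, t), ⟨hs, ht⟩, rfl⟩
  · rintro ⟨u, ⟨hs, ht⟩, rfl⟩
    exact Q.param_mem_elem f 0 hs ht

theorem isClosed_elem (f : F) : IsClosed (Q.elem f) :=
  (Set.finite_range _).isClosed_convexHull ℝ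

/-- On the closed parameter square the bilinear map is injective with positive Jacobian, so the
general gradient statement applies up to the sides and vertices. -/
theorem exists_gradient_elem {z Z : ℝ × ℝ → ℝ} {f : F}
    (hz : ∀ k, ∀ s ∈ Set.Icc (0 : ℝ) 1, ∀ t ∈ Set.Icc (0 : ℝ) 1,
      z (Q.param f k s t) = Q.patch Z f k s t) :
    ∃ G : ℝ × ℝ → ℝ × ℝ →L[ℝ] ℝ, ContinuousOn G (Q.elem f) ∧
      ∀ x ∈ Q.elem f, HasFDerivWithinAt z (G x) (Q.elem f) x := by
  rw [elem_eq_image]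
  have hX : ContDiff ℝ 1 fun u : ℝ × ℝ => Q.param f 0 u.1 u.2 := by
    unfold param
    fun_prop
  refine exists_continuousOn_gradient (B := fun u => Q.patch Z f 0 u.1 u.2) hX ?_
    (isCompact_Icc.prod isCompact_Icc) ?_ ?_ ?_
  · unfold patch quartic
    fun_prop
  · rintro u ⟨hs, ht⟩ v ⟨hs', ht'⟩ h
    have := Q.param_injective hs ht hs' ht' h
    exact Prod.ext this.1 this.2
  · rintro ⟨s, t⟩ ⟨hs, ht⟩
    have hd := (hX.differentiable one_ne_zero (s, t)).hasFDerivAt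
    set L := fderiv ℝ (fun u : ℝ × ℝ => Q.param f 0 u.1 u.2) (s, t)
    have h1 : L (1, 0) = bilinearS (Q.pos (Q.vert f 0)) (Q.pos (Q.vert f (0 + 1)))
        (Q.pos (Q.vert f (0 + 2))) (Q.pos (Q.vert f (0 + 3))) t := by
      have h := hd.comp_hasDerivAt (f := fun s => (s, t)) s
        ((hasDerivAt_id s).prodMk (hasDerivAt_const s t))
      exact h.unique (bilinear_hasDerivAt_left _ _ _ _ s t)
    have h2 : L (0, 1) = bilinearT (Q.pos (Q.vert f 0)) (Q.pos (Q.vert f (0 + 1)))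
        (Q.pos (Q.vert f (0 + 2))) (Q.pos (Q.vert f (0 + 3))) s := by
      have h := hd.comp_hasDerivAt (f := fun t => (s, t)) t
        ((hasDerivAt_const t s).prodMk (hasDerivAt_id t))
      exact h.unique (bilinear_hasDerivAt_right _ _ _ _ s t)
    have hJ := (Q.convexQuad f 0).jacobian_pos hs ht
    rw [← h1, ← h2] at hJ
    have hinj : Function.Injective (L : ℝ × ℝ →ₗ[ℝ] ℝ × ℝ) := by
      rw [injective_iff_map_eq_zero]
      rintro ⟨a, b⟩ hab
      have e : L (a, b) = a • L (1, 0) + b • L (0, 1) := by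
        rw [← map_smul, ← map_smul, ← map_add]
        simp
      have hab : a • L (1, 0) + b • L (0, 1) = 0 := e ▸ hab
      have ha : a * cross2 (L (1, 0)) (L (0, 1)) = 0 := by
        have := congrArg (fun x => cross2 x (L (0, 1))) hab
        simp only [cross2_add_left, cross2_smul_left, cross2_self] at this
        simpa [cross2] using this
      have hb : b * cross2 (L (1, 0)) (L (0, 1)) = 0 := by
        have := congrArg (fun x => cross2 (L (1, 0)) x) hab
        simp only [cross2_add_right, cross2_smul_right, cross2_self] at this
        simpa [cross2] using this
      exact Prod.ext ((mul_eq_zero.mp ha).resolve_right hJ.ne')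
        ((mul_eq_zero.mp hb).resolve_right hJ.ne')
    exact ⟨(LinearEquiv.ofInjectiveEndo (L : ℝ × ℝ →ₗ[ℝ] ℝ × ℝ) hinj).toContinuousLinearEquiv,
      ContinuousLinearMap.ext fun x => rfl⟩
  · rintro u ⟨hs, ht⟩
    exact hz 0 u.1 hs u.2 ht

theorem cross2_sideT_pos (Q : QuadMesh V F) (f : F) (k : Fin 4) {s : ℝ}
    (hs : s ∈ Set.Icc (0 : ℝ) 1) :
    0 < cross2 (Q.dir (Q.vert f k) (Q.vert f (k + 1))) (Q.sideT f k s) := by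
  have h := Q.convexQuad f k
  have e : cross2 (Q.dir (Q.vert f k) (Q.vert f (k + 1)))
      (Q.dir (Q.vert f (k + 1)) (Q.vert f (k + 2))) =
        cross2 (Q.pos (Q.vert f (k + 1)) - Q.pos (Q.vert f k))
          (Q.pos (Q.vert f (k + 2)) - Q.pos (Q.vert f k)) := by
    simp only [dir, cross2, Prod.fst_sub, Prod.snd_sub]
    ring
  rw [sideT, cross2_add_right, cross2_smul_right, cross2_smul_right, e]
  exact combo_pos h.t₀ h.t₁ hs

/-- The gradients of two adjacent elements agree. -/
theorem gradient_eq {z Z : ℝ × ℝ → ℝ} (hZ : Q.IsSmoothNet Z)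
    (hz : ∀ f k, ∀ s ∈ Set.Icc (0 : ℝ) 1, ∀ t ∈ Set.Icc (0 : ℝ) 1,
      z (Q.param f k s t) = Q.patch Z f k s t) {f g : F} (hfg : f ≠ g) {x : ℝ × ℝ}
    {G H : ℝ × ℝ →L[ℝ] ℝ} (hf : x ∈ Q.elem f) (hg : x ∈ Q.elem g)
    (hG : HasFDerivWithinAt z G (Q.elem f) x) (hH : HasFDerivWithinAt z H (Q.elem g) x) :
    G = H := by
  rcases exists_vertex_or_isMatch hfg hf hg with ⟨k, l, hkl, rfl⟩ | ⟨k, l, hm, s, hs, rfl⟩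
  · obtain ⟨L, hL⟩ := hZ.tangent (Q.vert f k)
    -- At a vertex every adjacent element has two independent edge directions, on which its gradient
    -- agrees with the tangent map of the net.
    have key : ∀ (f' : F) (k' : Fin 4) (G' : ℝ × ℝ →L[ℝ] ℝ), Q.vert f' k' = Q.vert f k →
        HasFDerivWithinAt z G' (Q.elem f') (Q.pos (Q.vert f k)) →
          G' = LinearMap.toContinuousLinearMap L := by
      intro f' k' G' hv hG'
      rw [← hv] at hG'
      have h1 := grad_vertex (hz f') hG'
      have a1 : Q.Adj (Q.vert f' k') (Q.vert f' (k' + 1)) := Or.inl ⟨f', k', rfl, rfl⟩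
      have a2 : Q.Adj (Q.vert f' k') (Q.vert f' (k' + 3)) :=
        Or.inr ⟨f', k' + 3, rfl, by rw [fin4_add_three_add_one]⟩
      have h2 := hL (Q.vert f' (k' + 1)) (hv ▸ a1)
      have h3 := hL (Q.vert f' (k' + 3)) (hv ▸ a2)
      rw [← hv] at h2 h3
      refine clm_ext_of_cross2_ne_zero (Q.convexQuad f' k').t₀.ne' ?_ ?_
      · have := h1.1.symm.trans h2
        simp only [dir] at this
        simp only [LinearMap.coe_toContinuousLinearMap']
        linarith
      · have := h1.2.symm.trans h3
        simp only [dir] at this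
        simp only [LinearMap.coe_toContinuousLinearMap']
        linarith
    rw [key f k G rfl hG, key g l H hkl.symm hH]
  · have hs' : 1 - s ∈ Set.Icc (0 : ℝ) 1 := ⟨by linarith [hs.2], by linarith [hs.1]⟩
    have e1 := grad_sideT (hz f) hs hG
    have e2 := grad_side (hz f) hs hG
    rw [← hm.param_eq] at hH
    have e3 := grad_sideT (hz g) hs' hH
    have e4 := grad_side (hz g) hs' hH
    have hd : Q.dir (Q.vert g l) (Q.vert g (l + 1)) =
        -Q.dir (Q.vert f k) (Q.vert f (k + 1)) := by
      rw [← hm.1, ← hm.2, dir_symm]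
    have hc : cubic (fun i => Z (Q.cpt 4 g l (i + 1) 0) - Z (Q.cpt 4 g l i 0)) (1 - s) =
        -cubic (fun i => Z (Q.cpt 4 f k (i + 1) 0) - Z (Q.cpt 4 f k i 0)) s := by
      simp only [cubic, Nat.reduceAdd, zero_add, hm.cpt_reflect (i := 0) (by norm_num),
        hm.cpt_reflect (i := 1) (by norm_num), hm.cpt_reflect (i := 2) (by norm_num),
        hm.cpt_reflect (i := 3) (by norm_num), hm.cpt_reflect (i := 4) (by norm_num), Nat.reduceSub]
      ring
    have hpos := Q.cross2_sideT_pos g l hs'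
    rw [hd, cross2_neg_left, cross2_comm, neg_neg] at hpos
    rw [hd, hc, map_neg] at e4
    have e5 : H (Q.dir (Q.vert f k) (Q.vert f (k + 1))) =
        G (Q.dir (Q.vert f k) (Q.vert f (k + 1))) := by
      rw [e2]; linarith
    -- Along the edge both gradients differentiate the same row of control values. Only the
    -- transversal direction remains, and there the six edge equations enter.
    refine clm_ext_of_cross2_ne_zero (Q.cross2_sideT_pos f k hs).ne' e5.symm ?_
    have key := congrArg H (cross2_smul_add_smul_add_smul (Q.dir (Q.vert f k) (Q.vert f (k + 1)))
      (Q.sideT f k s) (Q.sideT g l (1 - s)))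
    simp only [map_add, map_smul, smul_eq_mul, map_zero, e5, e2, e3] at key
    have hsum := edgeEq_sum Z hm s
    simp only [hZ.edgeEq_eq_zero hm, zero_mul, Finset.sum_const_zero] at hsum
    -- Subtracting the linear relation under `H` from the vanishing polynomial leaves the difference
    -- of the transversal derivatives times a positive weight.
    have h0 : cross2 (Q.sideT g l (1 - s)) (Q.dir (Q.vert f k) (Q.vert f (k + 1))) *
        (G (Q.sideT f k s) - H (Q.sideT f k s)) = 0 := by
      rw [e1]
      linear_combination 4 * hsum - key
    have := (mul_eq_zero.mp h0).resolve_left hpos.ne'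
    linarith

/-- Every net that satisfies the smoothness equations defines a `C¹` surface. -/
theorem IsSmoothNet.exists_mem_FUN [Finite F] {Z : ℝ × ℝ → ℝ} (hZ : Q.IsSmoothNet Z) :
    ∃ z ∈ Q.FUN 4, Q.HasNet 4 z Z := by
  classical
  obtain ⟨z, hz⟩ := exists_isPatchwise Q Z
  have hnet : Q.HasNet 4 z Z := Q.hasNet_of_eq_patch fun f => hz f 0
  refine ⟨z, ⟨?_, Z, hnet⟩, hnet⟩
  choose Gf hGc hGd using fun f => exists_gradient_elem (hz f)
  -- The element chosen at a point is immaterial because the gradients of elements sharing the point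
  -- agree. The value `0` occurs only off the domain.
  let G : ℝ × ℝ → ℝ × ℝ →L[ℝ] ℝ := fun x => if h : ∃ f, x ∈ Q.elem f then Gf h.choose x else 0
  have hG : ∀ f, ∀ x ∈ Q.elem f, G x = Gf f x := by
    intro f x hx
    have h : ∃ f, x ∈ Q.elem f := ⟨f, hx⟩
    simp only [G, dif_pos h]
    by_cases e : h.choose = f
    · rw [e]
    · exact gradient_eq hZ hz e h.choose_spec hx (hGd _ _ h.choose_spec) (hGd _ _ hx)
  have hdom : Q.domain = ⋃ f, Q.elem f := rfl
  have hderiv : ∀ x ∈ Q.domain, HasFDerivWithinAt z (G x) Q.domain x := by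
    intro x _
    -- Elements are closed, so one that does not contain `x` imposes no condition at `x`, and
    -- differentiability passes to the finite union.
    have h1 : ∀ f, HasFDerivWithinAt z (G x) (Q.elem f) x := by
      intro f
      by_cases hx : x ∈ Q.elem f
      · rw [hG f x hx]
        exact hGd f x hx
      · exact HasFDerivWithinAt.of_notMem_closure (by rwa [(isClosed_elem f).closure_eq])
    have h2 : ∀ s : Set F, s.Finite → HasFDerivWithinAt z (G x) (⋃ f ∈ s, Q.elem f) x := by
      intro s hs
      induction s, hs using Set.Finite.induction_on with
      | empty => exact HasFDerivWithinAt.of_notMem_closure (by simp)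
      | insert _ _ ih =>
        rw [Set.biUnion_insert]
        exact (h1 _).union ih
    have := h2 Set.univ Set.finite_univ
    rwa [Set.biUnion_univ] at this
  have hcont : ContinuousOn G Q.domain := by
    rw [hdom]
    exact (locallyFinite_of_finite _).continuousOn_iUnion isClosed_elem
      fun f => (hGc f).congr fun x hx => hG f x hx
  have h := contDiffOn_succ_iff_hasFDerivWithinAt (𝕜 := ℝ) (s := Q.domain) (f := z) (n := 0)
    (by simp)
  rw [zero_add] at h
  rw [h]
  intro x hx
  refine ⟨Q.domain, ?_, by simp, G, hderiv, contDiffOn_zero.mpr hcont⟩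
  rw [Set.insert_eq_of_mem hx]
  exact self_mem_nhdsWithin

end QuadMesh

namespace QuadMesh

variable {V F : Type*} {Q : QuadMesh V F}

/-! ### The space of smooth nets -/

theorem edgeEq_add (Z Z' : ℝ × ℝ → ℝ) (f : F) (k : Fin 4) (g : F) (l : Fin 4) (i : ℕ) :
    Q.edgeEq (Z + Z') f k g l i = Q.edgeEq Z f k g l i + Q.edgeEq Z' f k g l i := by
  rcases i with _ | _ | _ | _ | _ | _ | i <;> simp only [edgeEq, edgeCoeff, Pi.add_apply] <;> ring

theorem edgeEq_smul (r : ℝ) (Z : ℝ × ℝ → ℝ) (f : F) (k : Fin 4) (g : F) (l : Fin 4) (i : ℕ) :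
    Q.edgeEq (r • Z) f k g l i = r * Q.edgeEq Z f k g l i := by
  rcases i with _ | _ | _ | _ | _ | _ | i <;>
    simp only [edgeEq, edgeCoeff, Pi.smul_apply, smul_eq_mul] <;> ring

theorem edgeEq_congr {Z Z' : ℝ × ℝ → ℝ} (h : ∀ P ∈ Q.CP 4, Z P = Z' P) (f : F) (k : Fin 4) (g : F)
    (l : Fin 4) (i : ℕ) : Q.edgeEq Z f k g l i = Q.edgeEq Z' f k g l i := by
  have h1 : ∀ i ≤ 4, ∀ j ≤ 4, Z (Q.cpt 4 f k i j) = Z' (Q.cpt 4 f k i j) :=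
    fun i hi j hj => h _ (Q.cpt_mem_CP f k hi hj)
  have h2 : ∀ i, Z (Q.cpt 4 g l (4 - i) 1) = Z' (Q.cpt 4 g l (4 - i) 1) :=
    fun i => h _ (Q.cpt_mem_CP g l (Nat.sub_le _ _) (by norm_num))
  have a0 := h1 0 (by norm_num) 0 (by norm_num)
  have a1 := h1 1 (by norm_num) 0 (by norm_num)
  have a2 := h1 2 (by norm_num) 0 (by norm_num)
  have a3 := h1 3 (by norm_num) 0 (by norm_num)
  have a4 := h1 4 (by norm_num) 0 (by norm_num)
  have b0 := h1 0 (by norm_num) 1 (by norm_num)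
  have b1 := h1 1 (by norm_num) 1 (by norm_num)
  have b2 := h1 2 (by norm_num) 1 (by norm_num)
  have b3 := h1 3 (by norm_num) 1 (by norm_num)
  have b4 := h1 4 (by norm_num) 1 (by norm_num)
  rcases i with _ | _ | _ | _ | _ | _ | i <;>
    simp only [edgeEq, edgeCoeff, h2, a0, a1, a2, a3, a4, b0, b1, b2, b3, b4]

theorem pos_mem_CP (Q : QuadMesh V F) (v : V) : Q.pos v ∈ Q.CP 4 := by
  obtain ⟨f, k, rfl⟩ := Q.exists_vert v
  rw [← cpt_zero_zero]
  exact Q.cpt_mem_CP f k (by norm_num) (by norm_num)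

theorem ptE_mem_CP {v w : V} (h : Q.Adj v w) : Q.ptE v w ∈ Q.CP 4 := by
  rcases h with ⟨f, k, rfl, rfl⟩ | ⟨f, k, rfl, rfl⟩
  · rw [← cpt_one_zero]
    exact Q.cpt_mem_CP f k (by norm_num) (by norm_num)
  · rw [← cpt_three_zero]
    exact Q.cpt_mem_CP f k (by norm_num) (by norm_num)

theorem ptD_mem_CP {v w : V} (h : Q.Adj v w) : Q.ptD v w ∈ Q.CP 4 := by
  rcases h with ⟨f, k, rfl, rfl⟩ | ⟨f, k, rfl, rfl⟩
  · rw [← cpt_two_zero]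
    exact Q.cpt_mem_CP f k (by norm_num) (by norm_num)
  · rw [ptD_symm, ← cpt_two_zero]
    exact Q.cpt_mem_CP f k (by norm_num) (by norm_num)

theorem IsSmoothNet.congr {Z Z' : ℝ × ℝ → ℝ} (hZ : Q.IsSmoothNet Z)
    (h : ∀ P ∈ Q.CP 4, Z P = Z' P) : Q.IsSmoothNet Z' := by
  refine ⟨fun v => ?_, fun f k g l hm => ?_, fun f k g l hm => ?_⟩
  · obtain ⟨G, hG⟩ := hZ.tangent v
    exact ⟨G, fun w hw => by rw [← h _ (ptE_mem_CP hw), ← h _ (pos_mem_CP Q v), hG w hw]⟩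
  · rw [← edgeEq_congr h, hZ.twist f k g l hm]
  · rw [← edgeEq_congr h, hZ.middle f k g l hm]

/-- Extension by zero of control values. -/
noncomputable def extendNet (Q : QuadMesh V F) : (Q.CP 4 → ℝ) →ₗ[ℝ] (ℝ × ℝ → ℝ) :=
  Function.ExtendByZero.linearMap ℝ ((↑) : Q.CP 4 → ℝ × ℝ)

theorem extendNet_apply (y : Q.CP 4 → ℝ) (P : Q.CP 4) : Q.extendNet y P = y P :=
  Subtype.val_injective.extend_apply _ _ _

theorem extendNet_restrict (Z : ℝ × ℝ → ℝ) :
    ∀ P ∈ Q.CP 4, Z P = Q.extendNet (fun P => Z P) P :=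
  fun P hP => (extendNet_apply (fun P : Q.CP 4 => Z P) ⟨P, hP⟩).symm

/-- The linear space of nets of control values that define `C¹` surfaces. -/
noncomputable def smoothNets (Q : QuadMesh V F) : Submodule ℝ (Q.CP 4 → ℝ) where
  carrier := {y | Q.IsSmoothNet (Q.extendNet y)}
  add_mem' {y y'} h h' := by
    refine ⟨fun v => ?_, fun f k g l hm => ?_, fun f k g l hm => ?_⟩
    · obtain ⟨G, hG⟩ := h.tangent v
      obtain ⟨G', hG'⟩ := h'.tangent v
      refine ⟨G + G', fun w hw => ?_⟩
      simp only [map_add, Pi.add_apply, hG w hw, hG' w hw, LinearMap.add_apply]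
      ring
    · rw [map_add, edgeEq_add, h.twist f k g l hm, h'.twist f k g l hm, add_zero]
    · rw [map_add, edgeEq_add, h.middle f k g l hm, h'.middle f k g l hm, add_zero]
  zero_mem' := by
    refine ⟨fun v => ⟨0, fun w _ => by simp⟩, fun f k g l _ => ?_, fun f k g l _ => ?_⟩ <;>
      simp [edgeEq, edgeCoeff]
  smul_mem' r y h := by
    refine ⟨fun v => ?_, fun f k g l hm => ?_, fun f k g l hm => ?_⟩
    · obtain ⟨G, hG⟩ := h.tangent v
      refine ⟨r • G, fun w hw => ?_⟩
      simp only [map_smul, Pi.smul_apply, hG w hw, LinearMap.smul_apply, smul_eq_mul]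
      ring
    · rw [map_smul, edgeEq_smul, h.twist f k g l hm, mul_zero]
    · rw [map_smul, edgeEq_smul, h.middle f k g l hm, mul_zero]

theorem mem_smoothNets {y : Q.CP 4 → ℝ} : y ∈ Q.smoothNets ↔ Q.IsSmoothNet (Q.extendNet y) :=
  Iff.rfl

variable [Finite F]

instance : Finite (Q.CP 4) := Q.finite_CP.to_subtype

/-- Surfaces and smooth nets correspond, and a surface vanishes exactly when its control values do.
From here on the question is finite-dimensional linear algebra. -/
theorem isDetermining_iff {D : Set (ℝ × ℝ)} : Q.IsDetermining 4 D ↔ D ⊆ Q.CP 4 ∧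
    ∀ Z, Q.IsSmoothNet Z → (∀ P ∈ D, Z P = 0) → ∀ P ∈ Q.CP 4, Z P = 0 := by
  refine and_congr_right fun _ => ⟨fun h Z hZ h0 P hP => ?_, fun h z hz Z hZ h0 => ?_⟩
  · obtain ⟨z, hz, hn⟩ := hZ.exists_mem_FUN
    exact hn.eq_zero_of_eq_zero (h z hz Z hn h0) hP
  · exact hZ.eq_zero (h Z (isSmoothNet_of_mem_FUN hz hZ) h0)

omit [Finite F] in
theorem dependsOnly_of_forall {P : ℝ × ℝ} {A : Set (ℝ × ℝ)}
    (h : ∀ Z, Q.IsSmoothNet Z → (∀ P' ∈ A, Z P' = 0) → Z P = 0) : Q.DependsOnly 4 P A :=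
  fun _ hz Z hZ h0 => h Z (isSmoothNet_of_mem_FUN hz hZ) h0

/-- Restriction of smooth nets to a determining set has trivial kernel. -/
theorem finrank_smoothNets_le {D : Set (ℝ × ℝ)} (hD : Q.IsDetermining 4 D) :
    Module.finrank ℝ Q.smoothNets ≤ D.ncard := by
  obtain ⟨hDC, hD⟩ := isDetermining_iff.mp hD
  have := (Q.finite_CP.subset hDC).to_subtype
  have := Fintype.ofFinite D
  let ρ : Q.smoothNets →ₗ[ℝ] (D → ℝ) :=
    LinearMap.pi fun P => (LinearMap.proj ⟨P.1, hDC P.2⟩ : (Q.CP 4 → ℝ) →ₗ[ℝ] ℝ).comp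
      Q.smoothNets.subtype
  have hρ : Function.Injective ρ := by
    rw [injective_iff_map_eq_zero]
    intro y hy
    refine Subtype.ext (funext fun P => ?_)
    refine (extendNet_apply y.1 P).symm.trans (hD _ y.2 (fun P hP => ?_) P P.2)
    have := congrFun hy ⟨P, hP⟩
    exact (extendNet_apply y.1 ⟨P, hDC hP⟩).trans this
  have := LinearMap.finrank_le_finrank_of_injective hρ
  rwa [Module.finrank_fintype_fun_eq_card, ← Nat.card_eq_fintype_card, Nat.card_coe_set_eq] at this

theorem isMDS_of_ncard_le {M : Set (ℝ × ℝ)} (hM : Q.IsDetermining 4 M)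
    (h : M.ncard ≤ Module.finrank ℝ Q.smoothNets) : Q.IsMDS 4 M :=
  ⟨hM, fun _ hD => h.trans (finrank_smoothNets_le hD)⟩

/-- Each equation lowers the dimension of the space of nets at most by one. -/
theorem ncard_CP_le {J : Type*} [Finite J] (φ : (ℝ × ℝ → ℝ) →ₗ[ℝ] (J → ℝ))
    (hφ : ∀ Z, φ Z = 0 → Q.IsSmoothNet Z) :
    (Q.CP 4).ncard ≤ Module.finrank ℝ Q.smoothNets + Nat.card J := by
  have := Fintype.ofFinite J
  have := Fintype.ofFinite (Q.CP 4)
  let ψ := φ.comp Q.extendNet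
  have h1 := ψ.finrank_range_add_finrank_ker
  have h2 : Module.finrank ℝ (LinearMap.range ψ) ≤ Nat.card J := by
    rw [Nat.card_eq_fintype_card, ← Module.finrank_fintype_fun_eq_card ℝ]
    exact Submodule.finrank_le _
  have h3 : Module.finrank ℝ (LinearMap.ker ψ) ≤ Module.finrank ℝ Q.smoothNets :=
    Submodule.finrank_mono fun y hy => hφ _ hy
  rw [Module.finrank_fintype_fun_eq_card, ← Nat.card_eq_fintype_card, Nat.card_coe_set_eq] at h1
  omega

/-- For every set of fixed control points there is a fitting minimal determining set. -/
theorem exists_isMDS_fits {S : Set (ℝ × ℝ)} (hS : S ⊆ Q.CP 4) :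
    ∃ M, Q.IsMDS 4 M ∧ Q.Fits 4 S M := by
  -- Control points act as evaluation functionals on the smooth nets. A maximal independent family
  -- `b₁` of those in `S` is extended to a maximal independent family `b₂` of all of them.
  let e : Q.CP 4 → Module.Dual ℝ Q.smoothNets := fun P =>
    (LinearMap.proj P : (Q.CP 4 → ℝ) →ₗ[ℝ] ℝ).comp Q.smoothNets.subtype
  obtain ⟨b₁, hb₁, -, hs₁, hi₁⟩ := exists_linearIndepOn_extension (K := ℝ) (v := e)
    (linearIndepOn_empty ℝ e) (Set.empty_subset {P : Q.CP 4 | P.1 ∈ S})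
  obtain ⟨b₂, -, hb₂, hs₂, hi₂⟩ := exists_linearIndepOn_extension (K := ℝ) (v := e)
    hi₁ (Set.subset_univ b₁)
  have key : ∀ (b : Set (Q.CP 4)) (P : Q.CP 4), e P ∈ Submodule.span ℝ (e '' b) →
      ∀ Z, Q.IsSmoothNet Z → (∀ P ∈ b, Z P.1 = 0) → Z P.1 = 0 := by
    intro b P hP Z hZ h0
    let y : Q.smoothNets := ⟨fun P => Z P, mem_smoothNets.mpr (hZ.congr (extendNet_restrict Z))⟩
    have h : Submodule.span ℝ (e '' b) ≤ LinearMap.ker (Module.Dual.eval ℝ Q.smoothNets y) := by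
      rw [Submodule.span_le]
      rintro _ ⟨P, hP, rfl⟩
      exact h0 P hP
    exact h hP
  have hM : Q.IsDetermining 4 (Subtype.val '' b₂) := by
    rw [isDetermining_iff]
    refine ⟨by rintro _ ⟨P, -, rfl⟩; exact P.2, fun Z hZ h0 P hP => ?_⟩
    exact key b₂ ⟨P, hP⟩ (hs₂ ⟨_, trivial, rfl⟩) Z hZ fun P hP => h0 _ ⟨P, hP, rfl⟩
  refine ⟨Subtype.val '' b₂, isMDS_of_ncard_le hM ?_, fun P hP => Or.inr ?_⟩
  · rw [Set.ncard_image_of_injective _ Subtype.val_injective]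
    have := Fintype.ofFinite b₂
    have h := LinearIndependent.fintype_card_le_finrank hi₂
    rwa [Subspace.dual_finrank_eq, ← Nat.card_eq_fintype_card, Nat.card_coe_set_eq] at h
  · refine dependsOnly_of_forall fun Z hZ h0 => ?_
    exact key b₁ ⟨P, hS hP⟩ (hs₁ ⟨_, hP, rfl⟩) Z hZ fun P hP =>
      h0 _ ⟨⟨P, hb₂ hP, rfl⟩, hb₁ hP⟩

end QuadMesh

namespace QuadMesh

variable {V F : Type*} {Q : QuadMesh V F}

/-! ### Control points of different types are different -/

theorem ptT_eq_param (f : F) (k : Fin 4) : Q.ptT f k = Q.param f k (1 / 4) (1 / 4) := by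
  simp [ptT, cpt]

theorem ptM_eq_param (f : F) (k : Fin 4) : Q.ptM f k = Q.param f k (2 / 4) (1 / 4) := by
  simp [ptM, cpt]

theorem ptT_injective {f g : F} {k l : Fin 4} (h : Q.ptT f k = Q.ptT g l) : f = g ∧ k = l := by
  rw [ptT_eq_param, ptT_eq_param] at h
  obtain rfl : f = g := Q.eq_of_param_interior_mem_elem (by norm_num) (by norm_num)
    (h ▸ Q.param_mem_elem g l (by norm_num) (by norm_num))
  -- Seen from corner `k`, changing the corner moves the parameters `(1/4, 1/4)` to a different
  -- pair, which injectivity of the parametrisation forbids.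
  refine ⟨rfl, ?_⟩
  rcases fin4_cases k l with rfl | rfl | rfl | rfl
  · rfl
  · rw [param_rotate] at h
    have := Q.param_injective (by norm_num) (by norm_num) (by norm_num) (by norm_num) h
    norm_num at this
  · rw [param_rotate_two] at h
    have := Q.param_injective (by norm_num) (by norm_num) (by norm_num) (by norm_num) h
    norm_num at this
  · rw [param_rotate_three] at h
    have := Q.param_injective (by norm_num) (by norm_num) (by norm_num) (by norm_num) h
    norm_num at this

theorem ptM_injective {f g : F} {k l : Fin 4} (h : Q.ptM f k = Q.ptM g l) : f = g ∧ k = l := by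
  rw [ptM_eq_param, ptM_eq_param] at h
  obtain rfl : f = g := Q.eq_of_param_interior_mem_elem (by norm_num) (by norm_num)
    (h ▸ Q.param_mem_elem g l (by norm_num) (by norm_num))
  refine ⟨rfl, ?_⟩
  rcases fin4_cases k l with rfl | rfl | rfl | rfl
  · rfl
  · rw [param_rotate] at h
    have := Q.param_injective (by norm_num) (by norm_num) (by norm_num) (by norm_num) h
    norm_num at this
  · rw [param_rotate_two] at h
    have := Q.param_injective (by norm_num) (by norm_num) (by norm_num) (by norm_num) h
    norm_num at this
  · rw [param_rotate_three] at h
    have := Q.param_injective (by norm_num) (by norm_num) (by norm_num) (by norm_num) h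
    norm_num at this

theorem ptT_ne_ptM (f g : F) (k l : Fin 4) : Q.ptT f k ≠ Q.ptM g l := by
  intro h
  rw [ptT_eq_param, ptM_eq_param] at h
  obtain rfl : f = g := Q.eq_of_param_interior_mem_elem (by norm_num) (by norm_num)
    (h ▸ Q.param_mem_elem g l (by norm_num) (by norm_num))
  rcases fin4_cases k l with rfl | rfl | rfl | rfl
  · have := Q.param_injective (by norm_num) (by norm_num) (by norm_num) (by norm_num) h
    norm_num at this
  · rw [param_rotate] at h
    have := Q.param_injective (by norm_num) (by norm_num) (by norm_num) (by norm_num) h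
    norm_num at this
  · rw [param_rotate_two] at h
    have := Q.param_injective (by norm_num) (by norm_num) (by norm_num) (by norm_num) h
    norm_num at this
  · rw [param_rotate_three] at h
    have := Q.param_injective (by norm_num) (by norm_num) (by norm_num) (by norm_num) h
    norm_num at this

theorem ptT_ne_ptE {f : F} {k : Fin 4} {v w : V} (h : Q.Adj v w) : Q.ptT f k ≠ Q.ptE v w := by
  rw [ptT_eq_param]
  exact Q.param_interior_ne_edge_point (by norm_num) (by norm_num) h (by norm_num)

theorem ptT_ne_ptD {f : F} {k : Fin 4} {v w : V} (h : Q.Adj v w) : Q.ptT f k ≠ Q.ptD v w := by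
  rw [ptT_eq_param]
  exact Q.param_interior_ne_edge_point (by norm_num) (by norm_num) h (by norm_num)

theorem ptM_ne_ptE {f : F} {k : Fin 4} {v w : V} (h : Q.Adj v w) : Q.ptM f k ≠ Q.ptE v w := by
  rw [ptM_eq_param]
  exact Q.param_interior_ne_edge_point (by norm_num) (by norm_num) h (by norm_num)

theorem ptM_ne_ptD {f : F} {k : Fin 4} {v w : V} (h : Q.Adj v w) : Q.ptM f k ≠ Q.ptD v w := by
  rw [ptM_eq_param]
  exact Q.param_interior_ne_edge_point (by norm_num) (by norm_num) h (by norm_num)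

theorem exists_adj (Q : QuadMesh V F) (v : V) : ∃ w, Q.Adj v w := by
  obtain ⟨c⟩ := Q.exists_corner v
  exact ⟨_, c.adj_rgt⟩

theorem ptT_ne_pos (f : F) (k : Fin 4) (v : V) : Q.ptT f k ≠ Q.pos v := by
  obtain ⟨w, hw⟩ := exists_adj Q v
  have := Q.param_interior_ne_edge_point (f := f) (k := k) (s := 1 / 4) (t := 1 / 4) (by norm_num)
    (by norm_num) hw (r := 0) (by norm_num)
  rwa [zero_smul, add_zero, ← ptT_eq_param] at this

theorem ptM_ne_pos (f : F) (k : Fin 4) (v : V) : Q.ptM f k ≠ Q.pos v := by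
  obtain ⟨w, hw⟩ := exists_adj Q v
  have := Q.param_interior_ne_edge_point (f := f) (k := k) (s := 2 / 4) (t := 1 / 4) (by norm_num)
    (by norm_num) hw (r := 0) (by norm_num)
  rwa [zero_smul, add_zero, ← ptM_eq_param] at this

theorem ptE_ne_pos {v w : V} (h : Q.Adj v w) (u : V) : Q.ptE v w ≠ Q.pos u :=
  Q.edge_point_ne_pos h (by norm_num)

theorem ptD_ne_pos {v w : V} (h : Q.Adj v w) (u : V) : Q.ptD v w ≠ Q.pos u :=
  Q.edge_point_ne_pos h (by norm_num)

theorem ptE_injective {v w v' w' : V} (h : Q.Adj v w) (h' : Q.Adj v' w')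
    (e : Q.ptE v w = Q.ptE v' w') : v = v' ∧ w = w' := by
  rcases Q.edge_point_eq h h' (by norm_num) (by norm_num) e with ⟨h1, h2, -⟩ | ⟨-, -, h3⟩
  · exact ⟨h1, h2⟩
  · norm_num at h3

theorem ptE_ne_ptD {v w v' w' : V} (h : Q.Adj v w) (h' : Q.Adj v' w') : Q.ptE v w ≠ Q.ptD v' w' := by
  intro e
  rcases Q.edge_point_eq h h' (by norm_num) (by norm_num) e with ⟨-, -, h3⟩ | ⟨-, -, h3⟩ <;>
    norm_num at h3

theorem ptD_injective {v w v' w' : V} (h : Q.Adj v w) (h' : Q.Adj v' w')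
    (e : Q.ptD v w = Q.ptD v' w') : s(v, w) = s(v', w') := by
  rw [Sym2.eq_iff]
  rcases Q.edge_point_eq h h' (by norm_num) (by norm_num) e with ⟨h1, h2, -⟩ | ⟨h1, h2, -⟩
  · exact Or.inl ⟨h1, h2⟩
  · exact Or.inr ⟨h1, h2⟩

/-! ### Corners and matching sides -/

theorem isMatch_of_corners {v : V} {c p : Q.Corner v} (h : p.lft = c.rgt) :
    Q.IsMatch c.1.1 c.1.2 p.1.1 (p.1.2 + 3) :=
  ⟨by rw [fin4_add_three_add_one, c.2, p.2], h.symm⟩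

theorem IsMatch.unique {f g g' : F} {k l l' : Fin 4} (h : Q.IsMatch f k g l)
    (h' : Q.IsMatch f k g' l') : g = g' ∧ l = l' :=
  side_unique (h.2.symm.trans h'.2) (h.1.symm.trans h'.1)

/-- The corners at the first vertex of an inner edge. -/
theorem IsMatch.exists_corners {f g : F} {k l : Fin 4} (h : Q.IsMatch f k g l) :
    ∃ c p : Q.Corner (Q.vert f k), c.1 = (f, k) ∧ p.1 = (g, l + 1) ∧ p.lft = c.rgt := by
  refine ⟨⟨(f, k), rfl⟩, ⟨(g, l + 1), h.1.symm⟩, rfl, rfl, ?_⟩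
  simp only [Corner.lft, Corner.rgt, fin4_add_one_add_three, h.2]

/-- The `T`-type control value of a corner relative to a tangent plane at its vertex, normalised. -/
noncomputable def twistVal (Z : ℝ × ℝ → ℝ) (H : ℝ × ℝ →ₗ[ℝ] ℝ) {v : V} (c : Q.Corner v) : ℝ :=
  (Z (Q.ptT c.1.1 c.1.2) - (Z (Q.pos v) + H (Q.ptT c.1.1 c.1.2 - Q.pos v))) /
    cross2 (Q.dir v c.rgt) (Q.dir v c.lft)

/-- The twist equation at a vertex, relative to the tangent plane at this vertex. -/
theorem edgeEq_one {Z : ℝ × ℝ → ℝ} {v : V} {H : ℝ × ℝ →ₗ[ℝ] ℝ}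
    (hH : ∀ w, Q.Adj v w → Z (Q.ptE v w) = Z (Q.pos v) + 1 / 4 * H (Q.dir v w))
    {c p : Q.Corner v} (h : p.lft = c.rgt) :
    Q.edgeEq Z c.1.1 c.1.2 p.1.1 (p.1.2 + 3) 1 =
      4 * cross2 (Q.dir v p.rgt) (Q.dir v p.lft) * cross2 (Q.dir v c.rgt) (Q.dir v c.lft) *
        (twistVal Z H c + twistVal Z H p) -
      3 * cross2 (Q.dir v p.rgt) (Q.dir v c.lft) *
        (Z (Q.ptD v c.rgt) - (Z (Q.pos v) + H (Q.ptD v c.rgt - Q.pos v))) := by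
  have hm := isMatch_of_corners h
  -- In coordinates the linear map is two unknown numbers, and the claim becomes a polynomial
  -- identity in these, the vertex positions and the control values.
  have hlin : ∀ x : ℝ × ℝ, H x = x.1 * H (1, 0) + x.2 * H (0, 1) := by
    intro x
    rw [← smul_eq_mul, ← smul_eq_mul, ← map_smul, ← map_smul, ← map_add]
    simp
  have hc := c.cross2_pos.ne'
  have hp := p.cross2_pos.ne'
  have e1 := hH _ c.adj_rgt
  have e2 := hH _ c.adj_lft
  have e3 := hH _ p.adj_rgt
  have t1 : twistVal Z H c * cross2 (Q.dir v c.rgt) (Q.dir v c.lft) =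
      Z (Q.ptT c.1.1 c.1.2) - (Z (Q.pos v) + H (Q.ptT c.1.1 c.1.2 - Q.pos v)) :=
    div_mul_cancel₀ _ hc
  have t2 : twistVal Z H p * cross2 (Q.dir v p.rgt) (Q.dir v p.lft) =
      Z (Q.ptT p.1.1 p.1.2) - (Z (Q.pos v) + H (Q.ptT p.1.1 p.1.2 - Q.pos v)) :=
    div_mul_cancel₀ _ hp
  have e : 4 * cross2 (Q.dir v p.rgt) (Q.dir v p.lft) * cross2 (Q.dir v c.rgt) (Q.dir v c.lft) *
        (twistVal Z H c + twistVal Z H p) =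
      4 * cross2 (Q.dir v p.rgt) (Q.dir v p.lft) *
        (Z (Q.ptT c.1.1 c.1.2) - (Z (Q.pos v) + H (Q.ptT c.1.1 c.1.2 - Q.pos v))) +
      4 * cross2 (Q.dir v c.rgt) (Q.dir v c.lft) *
        (Z (Q.ptT p.1.1 p.1.2) - (Z (Q.pos v) + H (Q.ptT p.1.1 p.1.2 - Q.pos v))) := by
    rw [← t1, ← t2]; ring
  rw [e]
  obtain ⟨⟨f, k⟩, hf⟩ := c
  obtain ⟨⟨g, l⟩, hg⟩ := p
  simp only [Corner.rgt, Corner.lft] at *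
  have q3 : l + 3 + 3 = l + 2 := by rw [add_assoc]; rfl
  have q2 : l + 3 + 2 = l + 1 := by rw [add_assoc]; rfl
  have a1 : Q.cpt 4 f k 0 1 = Q.ptE v (Q.vert f (k + 3)) := by rw [cpt_zero_one, hf]
  have a2 : Q.cpt 4 f k 1 0 = Q.ptE v (Q.vert f (k + 1)) := by rw [cpt_one_zero, hf]
  have a3 : Q.cpt 4 f k 2 0 = Q.ptD v (Q.vert f (k + 1)) := by rw [cpt_two_zero, hf]
  have a4 : Q.cpt 4 g (l + 3) 4 1 = Q.ptE v (Q.vert g (l + 1)) := by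
    rw [cpt_four_one, fin4_add_three_add_one, hg, q2]
  have a5 : Q.cpt 4 g (l + 3) 3 1 = Q.ptT g l := by rw [cpt_three_one, fin4_add_three_add_one]
  have a6 : Q.cpt 4 f k 1 1 = Q.ptT f k := rfl
  have a7 : Q.cpt 4 f k 0 0 = Q.pos v := by rw [cpt_zero_zero, hf]
  simp only [edgeEq, edgeCoeff, Nat.reduceSub, tsub_zero, a1, a2, a3, a4, a5, a6, a7, e1, e2, e3]
  rw [hlin (Q.dir v (Q.vert f (k + 1))), hlin (Q.dir v (Q.vert f (k + 3))),
    hlin (Q.dir v (Q.vert g (l + 1))), hlin (Q.ptT f k - _), hlin (Q.ptT g l - _),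
    hlin (Q.ptD v _ - _)]
  simp only [fin4_add_three_add_one, q2, q3, hf, hg, h, ptT_eq_param, ptD, param, dir, cross2,
    Prod.fst_add, Prod.snd_add, Prod.fst_sub, Prod.snd_sub, Prod.smul_fst, Prod.smul_snd,
    smul_eq_mul]
  ring

/-! ### Alternating functions on the cycle of corners at an inner vertex -/

section Cycle

variable [Finite F] {v : V} (hv : ¬ Q.IsBoundaryVertex v) {t : Q.Corner v → ℝ}
include hv

theorem apply_pow_next (h : ∀ x, t (next hv x) = -t x) (j : ℕ) (x : Q.Corner v) :
    t ((next hv ^ j) x) = (-1) ^ j * t x := by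
  induction j with
  | zero => simp
  | succ j ih => rw [pow_succ', Equiv.Perm.mul_apply, h, ih]; ring

/-- One full turn returns to the same corner after an odd number of sign changes. -/
theorem eq_zero_of_alternating_of_odd (hodd : Odd (Q.valence v)) (h : ∀ x, t (next hv x) = -t x)
    (x : Q.Corner v) : t x = 0 := by
  have h1 := apply_pow_next hv h (Nat.card (Q.Corner v)) x
  rw [pow_card_next, ← valence_eq_card hv, hodd.neg_one_pow] at h1
  linarith

theorem eq_zero_of_alternating {x₀ : Q.Corner v} (h0 : t x₀ = 0) (h : ∀ x, t (next hv x) = -t x)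
    (x : Q.Corner v) : t x = 0 := by
  obtain ⟨j, -, rfl⟩ := exists_pow_next_eq hv x₀ x
  rw [apply_pow_next hv h, h0, mul_zero]

/-- At an even vertex, one of the alternation conditions follows from the others. -/
theorem alternating_of_even (heven : Even (Q.valence v)) {x₀ : Q.Corner v}
    (h : ∀ x, x ≠ x₀ → t (next hv x) = -t x) : t (next hv x₀) = -t x₀ := by
  classical
  -- The first return to `x₀`, starting just after it, uses only the given alternations. It takes
  -- valence minus one steps, an odd number.
  have hex : ∃ j, (next hv ^ j) (next hv x₀) = x₀ :=
    (exists_pow_next_eq hv (next hv x₀) x₀).imp fun j h => h.2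
  have hlt : Nat.find hex < Nat.card (Q.Corner v) := by
    obtain ⟨j, hj, e⟩ := exists_pow_next_eq hv (next hv x₀) x₀
    exact (Nat.find_min' hex e).trans_lt hj
  have hind : ∀ j ≤ Nat.find hex, t ((next hv ^ j) (next hv x₀)) = (-1) ^ j * t (next hv x₀) := by
    intro j hj
    induction j with
    | zero => simp
    | succ j ih =>
      rw [pow_succ', Equiv.Perm.mul_apply, h _ (Nat.find_min hex hj), ih (Nat.le_of_succ_le hj)]
      ring
  have h1 := hind _ le_rfl
  rw [Nat.find_spec hex] at h1
  have h2 : Nat.card (Q.Corner v) ∣ Nat.find hex + 1 := by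
    have := Fintype.ofFinite (Q.Corner v)
    have hc : (next hv).IsCycleOn ((Finset.univ : Finset (Q.Corner v)) : Set (Q.Corner v)) :=
      ⟨by simp, fun a _ b _ => next_sameCycle hv a b⟩
    have h3 : (next hv ^ (Nat.find hex + 1)) x₀ = x₀ := by
      rw [pow_succ, Equiv.Perm.mul_apply]
      exact Nat.find_spec hex
    rw [hc.pow_apply_eq (Finset.mem_univ _)] at h3
    simpa [Nat.card_eq_fintype_card] using h3
  have h3 : Nat.find hex + 1 = Q.valence v := by
    rw [valence_eq_card hv]
    exact Nat.le_antisymm hlt (Nat.le_of_dvd (Nat.succ_pos _) h2)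
  have h4 : Odd (Nat.find hex) := by
    rw [← h3] at heven
    obtain ⟨n, hn⟩ := heven
    exact ⟨n - 1, by omega⟩
  rw [h4.neg_one_pow] at h1
  linarith

end Cycle

/-- At a regular `4`-vertex the two neighbours of an edge are opposite. -/
theorem IsRegular4.cross2_eq_zero [Finite F] {v : V} (hv : Q.IsRegular4 v) {c p : Q.Corner v}
    (h : p.lft = c.rgt) : cross2 (Q.dir v p.rgt) (Q.dir v c.lft) = 0 := by
  have hin := hv.1
  have hc : c = next hin p := Corner.rgt_injective v (by rw [rgt_next, h])
  subst hc
  obtain ⟨w, hw, hne, h0⟩ := hv.2.2 p.rgt p.adj_rgt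
  obtain ⟨x, rfl⟩ := exists_rgt_of_adj hin hw
  obtain ⟨j, hj, rfl⟩ := exists_pow_next_eq hin p x
  rw [← valence_eq_card hin, hv.2.1] at hj
  have h4 := pow_card_next hin p
  rw [← valence_eq_card hin, hv.2.1] at h4
  have h1 := cross2_next_pos hin p
  have h3 := cross2_next_pos hin ((next hin ^ 3) p)
  rw [← Equiv.Perm.mul_apply, ← pow_succ', h4] at h3
  rw [← rgt_next hin]
  -- The colinear partner cannot be the edge itself, nor one of its two cyclic neighbours, whose
  -- cross products with it are nonzero; so it is two steps away.
  interval_cases j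
  · exact absurd rfl hne
  · rw [pow_one] at h0
    exact absurd h0 h1.ne'
  · rw [pow_two, Equiv.Perm.mul_apply] at h0
    exact h0
  · rw [cross2_comm] at h3
    linarith

/-! ### The Projections Relation -/

/-- Clearing the nonzero denominators rewrites the quotient of distances as vanishing of the
determinant of the four linear weights, the form in which it meets the middle equations. -/
theorem projectionsRelation_iff {f g : F} {k l : Fin 4} (h : Q.IsMatch f k g l) :
    Q.ProjectionsRelation f k g l ↔
      cross2 (Q.dir (Q.vert g (l + 1)) (Q.vert g (l + 2))) (Q.dir (Q.vert f k) (Q.vert f (k + 1))) *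
        cross2 (Q.dir (Q.vert f k) (Q.vert f (k + 1)))
          (Q.dir (Q.vert f (k + 1)) (Q.vert f (k + 2))) =
      cross2 (Q.dir (Q.vert f k) (Q.vert f (k + 1))) (Q.dir (Q.vert f k) (Q.vert f (k + 3))) *
        cross2 (Q.dir (Q.vert g l) (Q.vert g (l + 3))) (Q.dir (Q.vert f k) (Q.vert f (k + 1))) := by
  have hf := Q.convexQuad f k
  have hg := Q.convexQuad g l
  have g1 : cross2 (Q.dir (Q.vert f k) (Q.vert f (k + 1))) (Q.dir (Q.vert f k) (Q.vert g (l + 3))) ≠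
      0 := by
    have := hg.t₀
    rw [← h.1, ← h.2] at this
    simp only [dir, cross2, Prod.fst_sub, Prod.snd_sub] at *
    intro h0
    linarith
  have f1 : cross2 (Q.dir (Q.vert f k) (Q.vert f (k + 1))) (Q.dir (Q.vert f k) (Q.vert f (k + 2))) ≠
      0 := hf.t₁.ne'
  rw [ProjectionsRelation]
  rw [div_eq_div_iff g1 f1, ← h.1, ← h.2]
  simp only [dir, cross2, Prod.fst_sub, Prod.snd_sub]
  constructor <;> intro e <;> linear_combination -e

theorem projectionsRelation_symm {f g : F} {k l : Fin 4} (h : Q.IsMatch f k g l) :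
    Q.ProjectionsRelation g l f k ↔ Q.ProjectionsRelation f k g l := by
  rw [projectionsRelation_iff h, projectionsRelation_iff h.symm]
  have hd : Q.dir (Q.vert g l) (Q.vert g (l + 1)) = -Q.dir (Q.vert f k) (Q.vert f (k + 1)) := by
    rw [← h.1, ← h.2, dir_symm]
  rw [hd]
  simp only [cross2_neg_left, cross2_neg_right]
  rw [cross2_comm (Q.dir (Q.vert g l) _), cross2_comm (Q.dir (Q.vert g (l + 1)) _),
    cross2_comm (Q.dir (Q.vert f (k + 1)) _), cross2_comm (Q.dir (Q.vert f k) (Q.vert f (k + 3)))]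
  constructor <;> intro e <;> linear_combination e

/-- The outer weights of the `C¹` condition along an edge are positive. -/
theorem IsMatch.weights_pos {f g : F} {k l : Fin 4} (h : Q.IsMatch f k g l) :
    0 < cross2 (Q.dir (Q.vert g (l + 1)) (Q.vert g (l + 2)))
        (Q.dir (Q.vert f k) (Q.vert f (k + 1))) ∧
      0 < cross2 (Q.dir (Q.vert g l) (Q.vert g (l + 3))) (Q.dir (Q.vert f k) (Q.vert f (k + 1))) ∧
      0 < cross2 (Q.dir (Q.vert f k) (Q.vert f (k + 1))) (Q.dir (Q.vert f k) (Q.vert f (k + 3))) ∧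
      0 < cross2 (Q.dir (Q.vert f k) (Q.vert f (k + 1)))
        (Q.dir (Q.vert f (k + 1)) (Q.vert f (k + 2))) := by
  have hf := Q.convexQuad f k
  have hg := Q.convexQuad g l
  obtain ⟨a0, a1, -, -⟩ := hf
  obtain ⟨b0, b1, -, -⟩ := hg
  rw [← h.1, ← h.2] at b0 b1 ⊢
  simp only [dir, cross2, Prod.fst_sub, Prod.snd_sub] at *
  refine ⟨?_, ?_, ?_, ?_⟩ <;> linarith

/-- If the weights are proportional, one of the two middle equations follows from the other one and
from the remaining equations. -/
theorem edgeCoeff_two_eq_zero {c q₀ q₁ l₀ l₁ : ℝ} (h0 : l₀ ≠ 0) (h1 : l₁ ≠ 0) {p q r : ℕ → ℝ}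
    (h : ∀ i ≤ 5, i ≠ 2 → edgeCoeff (c * l₀) (c * l₁) l₀ l₁ (-(q₀ * l₀)) (-(q₁ * l₀) - q₀ * l₁)
      (-(q₁ * l₁)) p q r i = 0) :
    edgeCoeff (c * l₀) (c * l₁) l₀ l₁ (-(q₀ * l₀)) (-(q₁ * l₀) - q₀ * l₁) (-(q₁ * l₁)) p q r 2 =
      0 := by
  have e0 := h 0 (by norm_num) (by norm_num)
  have e1 := h 1 (by norm_num) (by norm_num)
  have e3 := h 3 (by norm_num) (by norm_num)
  have e4 := h 4 (by norm_num) (by norm_num)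
  have e5 := h 5 (by norm_num) (by norm_num)
  simp only [edgeCoeff] at *
  -- With proportional weights the degree 5 polynomial is the common linear weight times a quartic
  -- with coefficients `k0, …, k4`. Five of the six equations determine these: `k0, k1` from the
  -- left end, `k4, k3` from the right, then `k2` from the third equation.
  have k0 : c * (q 0 - p 0) + (r 0 - p 0) - q₀ * (p 1 - p 0) = 0 := by
    refine (mul_eq_zero.mp (?_ : l₀ * _ = 0)).resolve_left h0
    linear_combination e0
  have k1 : 4 * (c * (q 1 - p 1) + (r 1 - p 1)) - 3 * q₀ * (p 2 - p 1) - q₁ * (p 1 - p 0) = 0 := by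
    refine (mul_eq_zero.mp (?_ : l₀ * _ = 0)).resolve_left h0
    linear_combination e1 - l₁ * k0
  have k4 : c * (q 4 - p 4) + (r 4 - p 4) - q₁ * (p 4 - p 3) = 0 := by
    refine (mul_eq_zero.mp (?_ : l₁ * _ = 0)).resolve_left h1
    linear_combination e5
  have k3 : 4 * (c * (q 3 - p 3) + (r 3 - p 3)) - q₀ * (p 4 - p 3) - 3 * q₁ * (p 3 - p 2) = 0 := by
    refine (mul_eq_zero.mp (?_ : l₁ * _ = 0)).resolve_left h1
    linear_combination e4 - l₀ * k4
  have k2 : 6 * (c * (q 2 - p 2) + (r 2 - p 2)) - 3 * q₀ * (p 3 - p 2) - 3 * q₁ * (p 2 - p 1) =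
      0 := by
    refine (mul_eq_zero.mp (?_ : l₁ * _ = 0)).resolve_left h1
    linear_combination e3 - l₀ * k3
  linear_combination l₀ * k2 + l₁ * k1

/-- The Projections Relation makes the two linear weights proportional. The quadratic weight then
has the same linear factor, which reduces the claim to `edgeCoeff_two_eq_zero`. -/
theorem edgeEq_two_eq_zero {Z : ℝ × ℝ → ℝ} {f g : F} {k l : Fin 4} (h : Q.IsMatch f k g l)
    (hP : Q.ProjectionsRelation f k g l) (hZ : ∀ i ≤ 5, i ≠ 2 → Q.edgeEq Z f k g l i = 0) :
    Q.edgeEq Z f k g l 2 = 0 := by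
  rw [projectionsRelation_iff h] at hP
  obtain ⟨hr₀, hr₁, hl₀, hl₁⟩ := h.weights_pos
  rw [edgeEq] at *
  have he : Q.dir (Q.vert f k) (Q.vert f (k + 1)) ≠ 0 := by
    intro h0
    rw [h0] at hl₀
    simp [cross2] at hl₀
  set e := Q.dir (Q.vert f k) (Q.vert f (k + 1))
  set a₀ := Q.dir (Q.vert f k) (Q.vert f (k + 3))
  set a₁ := Q.dir (Q.vert f (k + 1)) (Q.vert f (k + 2))
  set b₀ := Q.dir (Q.vert g (l + 1)) (Q.vert g (l + 2))
  set b₁ := Q.dir (Q.vert g l) (Q.vert g (l + 3))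
  obtain ⟨c, hc0, hc1⟩ : ∃ c, cross2 b₀ e = c * cross2 e a₀ ∧ cross2 b₁ e = c * cross2 e a₁ := by
    refine ⟨cross2 b₀ e / cross2 e a₀, (div_mul_cancel₀ _ hl₀.ne').symm, ?_⟩
    field_simp
    linarith
  -- By the choice of `c`, the vectors `c a₀ + b₀` and `c a₁ + b₁` have no component transversal to
  -- the edge; `q₀` and `q₁` are their coordinates along it.
  obtain ⟨q₀, hq0⟩ := exists_smul_eq_of_cross2_eq_zero (b := c • a₀ + b₀) he (by
    rw [cross2_add_right, cross2_smul_right, cross2_comm e b₀, hc0]; ring)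
  obtain ⟨q₁, hq1⟩ := exists_smul_eq_of_cross2_eq_zero (b := c • a₁ + b₁) he (by
    rw [cross2_add_right, cross2_smul_right, cross2_comm e b₁, hc1]; ring)
  have hb0 : b₀ = q₀ • e - c • a₀ := by rw [← hq0]; abel
  have hb1 : b₁ = q₁ • e - c • a₁ := by rw [← hq1]; abel
  have w0 : cross2 a₀ b₀ = -(q₀ * cross2 e a₀) := by
    rw [hb0]; simp only [cross2, Prod.fst_sub, Prod.snd_sub, Prod.smul_fst, Prod.smul_snd,
      smul_eq_mul]; ring
  have w2 : cross2 a₁ b₁ = -(q₁ * cross2 e a₁) := by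
    rw [hb1]; simp only [cross2, Prod.fst_sub, Prod.snd_sub, Prod.smul_fst, Prod.smul_snd,
      smul_eq_mul]; ring
  have w1 : cross2 a₀ b₁ + cross2 a₁ b₀ = -(q₁ * cross2 e a₀) - q₀ * cross2 e a₁ := by
    rw [hb0, hb1]; simp only [cross2, Prod.fst_sub, Prod.snd_sub, Prod.smul_fst, Prod.smul_snd,
      smul_eq_mul]; ring
  rw [w0, w1, w2, hc0, hc1] at hZ ⊢
  exact edgeCoeff_two_eq_zero hl₀.ne' hl₁.ne' hZ

end QuadMesh

namespace QuadMesh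

variable {V F : Type*} {Q : QuadMesh V F}

/-! ### Assembling the local templates -/

/-- The inner even vertices that are not regular `4`-vertices. -/
def IsFreeEven (Q : QuadMesh V F) (v : V) : Prop :=
  ¬ Q.IsBoundaryVertex v ∧ Even (Q.valence v) ∧ ¬ Q.IsRegular4 v

/-- The choices that determine the local templates: two edges `v (a v)`, `v (b v)` with basic
`E`-type points at every vertex, a corner `t v` with a basic `T`-type point, and an edge `v (d v)`
with a dependent `D`-type point at every even vertex where this is needed. -/
structure TemplateChoice (Q : QuadMesh V F) where
  a : V → V
  b : V → V
  t : V → F × Fin 4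
  d : V → V
  adj_a : ∀ v, Q.Adj v (a v)
  adj_b : ∀ v, Q.Adj v (b v)
  cross2_ne : ∀ v, cross2 (Q.dir v (a v)) (Q.dir v (b v)) ≠ 0
  vert_t : ∀ v, Q.vert (t v).1 (t v).2 = v
  adj_d : ∀ v, Q.IsFreeEven v → Q.Adj v (d v)
  uses_d : ∀ v, Q.IsFreeEven v → Q.Uses v (d v)
  lexPos_d : ∀ v, Q.IsFreeEven v → LexPos (Q.dir v (d v))

namespace TemplateChoice

variable (C : Q.TemplateChoice)

def DepE (x : V × V) : Prop := ¬ Q.IsCorner x.1 ∧ Q.Adj x.1 x.2 ∧ x.2 ≠ C.a x.1 ∧ x.2 ≠ C.b x.1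

/-- At an inner odd vertex the chosen corner `C.t` has a dependent point too; at every other vertex
that is not a mesh corner it carries the only basic T-point. -/
def DepT (c : F × Fin 4) : Prop :=
  ¬ Q.IsCorner (Q.vert c.1 c.2) ∧
    ((¬ Q.IsBoundaryVertex (Q.vert c.1 c.2) ∧ Odd (Q.valence (Q.vert c.1 c.2))) ∨
      c ≠ C.t (Q.vert c.1 c.2))

/-- The side `c` is an inner edge, and its middle point is not the basic one that the Projections
Relation allows. -/
def DepM (_ : Q.TemplateChoice) (c : F × Fin 4) : Prop :=
  ∃ e : F × Fin 4, Q.IsMatch c.1 c.2 e.1 e.2 ∧ ¬ (Q.ProjectionsRelation c.1 c.2 e.1 e.2 ∧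
    LexPos (Q.dir (Q.vert c.1 c.2) (Q.vert c.1 (c.2 + 1))))

/-- Index set of the dependent control points. -/
abbrev DepIndex : Type _ :=
  ({x // C.DepE x} ⊕ {c // C.DepT c}) ⊕ ({v // Q.IsFreeEven v} ⊕ {c // C.DepM c})

/-- The dependent control points. -/
noncomputable def depPoint : C.DepIndex → ℝ × ℝ :=
  Sum.elim (Sum.elim (fun x => Q.ptE x.1.1 x.1.2) (fun c => Q.ptT c.1.1 c.1.2))
    (Sum.elim (fun v => Q.ptD v.1 (C.d v.1)) (fun c => Q.ptM c.1.1 c.1.2))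

/-- The basic control points. -/
def basic : Set (ℝ × ℝ) := Q.CP 4 \ Set.range C.depPoint

theorem mem_range_depPoint {P : ℝ × ℝ} : P ∈ Set.range C.depPoint ↔
    (∃ v w, C.DepE (v, w) ∧ P = Q.ptE v w) ∨ (∃ f k, C.DepT (f, k) ∧ P = Q.ptT f k) ∨
      (∃ v, Q.IsFreeEven v ∧ P = Q.ptD v (C.d v)) ∨ (∃ f k, C.DepM (f, k) ∧ P = Q.ptM f k) := by
  constructor
  · rintro ⟨(⟨x, hx⟩ | ⟨c, hc⟩) | (⟨v, hv⟩ | ⟨c, hc⟩), rfl⟩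
    · exact Or.inl ⟨x.1, x.2, hx, rfl⟩
    · exact Or.inr (Or.inl ⟨c.1, c.2, hc, rfl⟩)
    · exact Or.inr (Or.inr (Or.inl ⟨v, hv, rfl⟩))
    · exact Or.inr (Or.inr (Or.inr ⟨c.1, c.2, hc, rfl⟩))
  · rintro (⟨v, w, h, rfl⟩ | ⟨f, k, h, rfl⟩ | ⟨v, h, rfl⟩ | ⟨f, k, h, rfl⟩)
    · exact ⟨Sum.inl (Sum.inl ⟨(v, w), h⟩), rfl⟩
    · exact ⟨Sum.inl (Sum.inr ⟨(f, k), h⟩), rfl⟩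
    · exact ⟨Sum.inr (Sum.inl ⟨v, h⟩), rfl⟩
    · exact ⟨Sum.inr (Sum.inr ⟨(f, k), h⟩), rfl⟩

/-- An owned edge points from its owner into the positive half-plane. Ownership by both ends would
make two opposite vectors positive. -/
theorem eq_of_ptD_eq {v w : V} (hv : Q.IsFreeEven v) (hw : Q.IsFreeEven w)
    (h : s(v, C.d v) = s(w, C.d w)) : v = w := by
  rcases Sym2.eq_iff.mp h with ⟨h, -⟩ | ⟨h1, h2⟩
  · exact h
  · have a1 := C.lexPos_d v hv
    have a2 := C.lexPos_d w hw
    rw [h2] at a1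
    rw [← h1, dir_symm] at a2
    exact absurd a2 a1.not_neg

/-- Control points of different types, or with different labels, are different planar points. The
dependent points can therefore be counted by their index set, which also indexes the equations. -/
theorem depPoint_injective : Function.Injective C.depPoint := by
  refine Function.Injective.sumElim (Function.Injective.sumElim ?_ ?_ ?_)
    (Function.Injective.sumElim ?_ ?_ ?_) ?_
  · rintro ⟨x, hx⟩ ⟨y, hy⟩ h
    have := ptE_injective hx.2.1 hy.2.1 h
    exact Subtype.ext (Prod.ext this.1 this.2)
  · rintro ⟨x, hx⟩ ⟨y, hy⟩ h
    have := ptT_injective h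
    exact Subtype.ext (Prod.ext this.1 this.2)
  · rintro ⟨x, hx⟩ ⟨y, hy⟩ h
    exact ptT_ne_ptE hx.2.1 h.symm
  · rintro ⟨x, hx⟩ ⟨y, hy⟩ h
    exact Subtype.ext (C.eq_of_ptD_eq hx hy (ptD_injective (C.adj_d x hx) (C.adj_d y hy) h))
  · rintro ⟨x, hx⟩ ⟨y, hy⟩ h
    have := ptM_injective h
    exact Subtype.ext (Prod.ext this.1 this.2)
  · rintro ⟨x, hx⟩ ⟨y, hy⟩ h
    exact ptM_ne_ptD (C.adj_d x hx) h.symm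
  · rintro (⟨x, hx⟩ | ⟨x, hx⟩) (⟨y, hy⟩ | ⟨y, hy⟩) h
    · exact ptE_ne_ptD hx.2.1 (C.adj_d y hy) h
    · exact ptM_ne_ptE hx.2.1 h.symm
    · exact ptT_ne_ptD (C.adj_d y hy) h
    · exact ptT_ne_ptM _ _ _ _ h

theorem pos_mem_basic (v : V) : Q.pos v ∈ C.basic := by
  refine ⟨pos_mem_CP Q v, fun h => ?_⟩
  rcases C.mem_range_depPoint.mp h with ⟨v, w, h, e⟩ | ⟨f, k, h, e⟩ | ⟨v, h, e⟩ | ⟨f, k, h, e⟩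
  · exact ptE_ne_pos h.2.1 _ e.symm
  · exact ptT_ne_pos _ _ _ e.symm
  · exact ptD_ne_pos (C.adj_d v h) _ e.symm
  · exact ptM_ne_pos _ _ _ e.symm

theorem ptE_mem_basic {v w : V} (hw : Q.Adj v w) : Q.ptE v w ∈ C.basic ↔ ¬ C.DepE (v, w) := by
  refine ⟨fun h h' => h.2 (C.mem_range_depPoint.mpr (Or.inl ⟨v, w, h', rfl⟩)),
    fun h' => ⟨ptE_mem_CP hw, fun h => ?_⟩⟩
  rcases C.mem_range_depPoint.mp h with ⟨v, w, h, e⟩ | ⟨f, k, h, e⟩ | ⟨v, h, e⟩ | ⟨f, k, h, e⟩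
  · obtain ⟨rfl, rfl⟩ := ptE_injective hw h.2.1 e
    exact h' h
  · exact ptT_ne_ptE hw e.symm
  · exact ptE_ne_ptD hw (C.adj_d v h) e
  · exact ptM_ne_ptE hw e.symm

theorem ptT_mem_basic (f : F) (k : Fin 4) : Q.ptT f k ∈ C.basic ↔ ¬ C.DepT (f, k) := by
  refine ⟨fun h h' => h.2 (C.mem_range_depPoint.mpr (Or.inr (Or.inl ⟨f, k, h', rfl⟩))),
    fun h' => ⟨Q.cpt_mem_CP f k (by norm_num) (by norm_num), fun h => ?_⟩⟩
  rcases C.mem_range_depPoint.mp h with ⟨v, w, h, e⟩ | ⟨f, k, h, e⟩ | ⟨v, h, e⟩ | ⟨f, k, h, e⟩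
  · exact ptT_ne_ptE h.2.1 e
  · obtain ⟨rfl, rfl⟩ := ptT_injective e
    exact h' h
  · exact ptT_ne_ptD (C.adj_d v h) e
  · exact ptT_ne_ptM _ _ _ _ e

theorem ptM_mem_basic (f : F) (k : Fin 4) : Q.ptM f k ∈ C.basic ↔ ¬ C.DepM (f, k) := by
  refine ⟨fun h h' => h.2 (C.mem_range_depPoint.mpr (Or.inr (Or.inr (Or.inr ⟨f, k, h', rfl⟩)))),
    fun h' => ⟨Q.cpt_mem_CP f k (by norm_num) (by norm_num), fun h => ?_⟩⟩
  rcases C.mem_range_depPoint.mp h with ⟨v, w, h, e⟩ | ⟨f, k, h, e⟩ | ⟨v, h, e⟩ | ⟨f, k, h, e⟩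
  · exact ptM_ne_ptE h.2.1 e
  · exact ptT_ne_ptM _ _ _ _ e.symm
  · exact ptM_ne_ptD (C.adj_d v h) e
  · obtain ⟨rfl, rfl⟩ := ptM_injective e
    exact h' h

theorem ptD_notMem_basic {v w : V} (hw : Q.Adj v w) :
    Q.ptD v w ∉ C.basic ↔ ∃ x, Q.IsFreeEven x ∧ s(x, C.d x) = s(v, w) := by
  constructor
  · intro h'
    have h : Q.ptD v w ∈ Set.range C.depPoint := by
      by_contra h
      exact h' ⟨ptD_mem_CP hw, h⟩
    rcases C.mem_range_depPoint.mp h with ⟨v, w, h, e⟩ | ⟨f, k, h, e⟩ | ⟨v, h, e⟩ | ⟨f, k, h, e⟩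
    · exact absurd e.symm (ptE_ne_ptD h.2.1 hw)
    · exact absurd e.symm (ptT_ne_ptD hw)
    · exact ⟨v, h, ptD_injective (C.adj_d v h) hw e.symm⟩
    · exact absurd e.symm (ptM_ne_ptD hw)
  · rintro ⟨x, hx, e⟩ h
    exact h.2 (C.mem_range_depPoint.mpr
      (Or.inr (Or.inr (Or.inl ⟨x, hx, (Q.ptD_eq_of_sym2 e).symm⟩))))

theorem depM_iff {f g : F} {k l : Fin 4} (h : Q.IsMatch f k g l) : C.DepM (f, k) ↔
    ¬ (Q.ProjectionsRelation f k g l ∧ LexPos (Q.dir (Q.vert f k) (Q.vert f (k + 1)))) := by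
  constructor
  · rintro ⟨⟨g', l'⟩, h', h2⟩
    obtain ⟨rfl, rfl⟩ := h.unique h'
    exact h2
  · exact fun h' => ⟨(g, l), h, h'⟩

/-! #### The template equations imply smoothness -/

/-- A tangent plane at `v` through the basic points. -/
noncomputable def tangentMap (Z : ℝ × ℝ → ℝ) (v : V) : ℝ × ℝ →ₗ[ℝ] ℝ :=
  IsLinearMap.mk' (fun x =>
    4 * (cross2 x (Q.dir v (C.b v)) / cross2 (Q.dir v (C.a v)) (Q.dir v (C.b v)) *
        (Z (Q.ptE v (C.a v)) - Z (Q.pos v)) +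
      cross2 (Q.dir v (C.a v)) x / cross2 (Q.dir v (C.a v)) (Q.dir v (C.b v)) *
        (Z (Q.ptE v (C.b v)) - Z (Q.pos v))))
    ⟨fun x y => by rw [cross2_add_left, cross2_add_right]; ring,
      fun r x => by rw [cross2_smul_left, cross2_smul_right, smul_eq_mul]; ring⟩

theorem tangentMap_apply (Z : ℝ × ℝ → ℝ) (v : V) (x : ℝ × ℝ) : C.tangentMap Z v x =
    4 * (cross2 x (Q.dir v (C.b v)) / cross2 (Q.dir v (C.a v)) (Q.dir v (C.b v)) *
        (Z (Q.ptE v (C.a v)) - Z (Q.pos v)) +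
      cross2 (Q.dir v (C.a v)) x / cross2 (Q.dir v (C.a v)) (Q.dir v (C.b v)) *
        (Z (Q.ptE v (C.b v)) - Z (Q.pos v))) := rfl

theorem a_ne_b (v : V) : C.a v ≠ C.b v := by
  intro h
  have := C.cross2_ne v
  rw [h, cross2_self] at this
  exact this rfl

variable [Finite V] [Finite F]

/-- A mesh corner belongs to a single element and has only two edges, so the tangent plane through
two E-points is no condition there. -/
theorem eq_a_or_eq_b_of_isCorner {v w : V} (hv : Q.IsCorner v) (hw : Q.Adj v w) :
    w = C.a v ∨ w = C.b v := by
  have hs := hv.subsingleton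
  obtain ⟨c⟩ := Q.exists_corner v
  have key : ∀ u, Q.Adj v u → u = c.rgt ∨ u = c.lft := by
    intro u hu
    rcases adj_iff.mp hu with ⟨x, rfl⟩ | ⟨x, rfl⟩
    · exact Or.inl (by rw [Subsingleton.elim x c])
    · exact Or.inr (by rw [Subsingleton.elim x c])
  have hab := C.a_ne_b v
  rcases key _ (C.adj_a v) with h1 | h1 <;> rcases key _ (C.adj_b v) with h2 | h2 <;>
    rcases key w hw with h3 | h3 <;> simp_all

omit [Finite V] [Finite F] in
theorem tangentMap_a (Z : ℝ × ℝ → ℝ) (v : V) :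
    Z (Q.ptE v (C.a v)) = Z (Q.pos v) + 1 / 4 * C.tangentMap Z v (Q.dir v (C.a v)) := by
  rw [tangentMap_apply, cross2_self, div_self (C.cross2_ne v)]
  ring

omit [Finite V] [Finite F] in
theorem tangentMap_b (Z : ℝ × ℝ → ℝ) (v : V) :
    Z (Q.ptE v (C.b v)) = Z (Q.pos v) + 1 / 4 * C.tangentMap Z v (Q.dir v (C.b v)) := by
  rw [tangentMap_apply, cross2_self, div_self (C.cross2_ne v)]
  ring

/-- An inner edge at `v`, seen as a matching pair of sides, to which the equation of a dependent
`T`-type point is attached. -/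
theorem exists_twistEdge (hQ : Q.Limitations) (x : F × Fin 4)
    (hx : ¬ Q.IsCorner (Q.vert x.1 x.2)) :
    ∃ y : (F × Fin 4) × F × Fin 4, Q.IsMatch y.1.1 y.1.2 y.2.1 y.2.2 ∧
      Q.vert y.1.1 y.1.2 = Q.vert x.1 x.2 ∧ (¬ Q.IsBoundaryVertex (Q.vert x.1 x.2) → y.1 = x) := by
  by_cases hb : Q.IsBoundaryVertex (Q.vert x.1 x.2)
  · obtain ⟨c, d, -, -, h, -⟩ := exists_two_corners hQ hb hx
    -- Both corners at a boundary vertex are attached to its single inner edge; only one of their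
    -- T-points needs an equation.
    exact ⟨(d.1, (c.1.1, c.1.2 + 3)), isMatch_of_corners h, d.2, fun h => absurd hb h⟩
  · have h1 : Q.Adj (Q.vert x.1 x.2) (Q.vert x.1 (x.2 + 1)) := Or.inl ⟨x.1, x.2, rfl, rfl⟩
    obtain ⟨g, l, h⟩ := Q.exists_isMatch (isInnerEdge_of_not_isBoundaryVertex hb h1)
    exact ⟨(x, (g, l)), h, rfl, fun _ => rfl⟩

open Classical in
/-- The matching pair of sides attached to a corner. -/
noncomputable def twistEdge (x : F × Fin 4) : (F × Fin 4) × F × Fin 4 :=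
  if h : ∃ y : (F × Fin 4) × F × Fin 4, Q.IsMatch y.1.1 y.1.2 y.2.1 y.2.2 ∧
      Q.vert y.1.1 y.1.2 = Q.vert x.1 x.2 ∧ (¬ Q.IsBoundaryVertex (Q.vert x.1 x.2) → y.1 = x)
  -- The default is taken only where no attached edge exists; the equations use `twistEdge` at
  -- vertices that are not mesh corners.
  then h.choose else (x, x)

theorem twistEdge_spec (hQ : Q.Limitations) {x : F × Fin 4} (hx : ¬ Q.IsCorner (Q.vert x.1 x.2)) :
    Q.IsMatch (twistEdge (Q := Q) x).1.1 (twistEdge (Q := Q) x).1.2 (twistEdge (Q := Q) x).2.1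
        (twistEdge (Q := Q) x).2.2 ∧
      Q.vert (twistEdge (Q := Q) x).1.1 (twistEdge (Q := Q) x).1.2 = Q.vert x.1 x.2 ∧
      (¬ Q.IsBoundaryVertex (Q.vert x.1 x.2) → (twistEdge (Q := Q) x).1 = x) := by
  have h := exists_twistEdge hQ x hx
  rw [twistEdge, dif_pos h]
  exact h.choose_spec

/-- The equations of the dependent control points. -/
noncomputable def equations : (ℝ × ℝ → ℝ) →ₗ[ℝ] (C.DepIndex → ℝ) :=
  IsLinearMap.mk' (fun Z => Sum.elim
      (Sum.elim
        (fun x => Z (Q.ptE x.1.1 x.1.2) -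
          (Z (Q.pos x.1.1) + 1 / 4 * C.tangentMap Z x.1.1 (Q.dir x.1.1 x.1.2)))
        (fun c => Q.edgeEq Z (twistEdge (Q := Q) c.1).1.1 (twistEdge (Q := Q) c.1).1.2
          (twistEdge (Q := Q) c.1).2.1 (twistEdge (Q := Q) c.1).2.2 1))
      (Sum.elim
        -- The dependent D-point is paired with the twist equation at the corner `C.t`, the one
        -- equation around an even vertex that no dependent T-point takes.
        (fun v => Q.edgeEq Z (twistEdge (Q := Q) (C.t v.1)).1.1 (twistEdge (Q := Q) (C.t v.1)).1.2
          (twistEdge (Q := Q) (C.t v.1)).2.1 (twistEdge (Q := Q) (C.t v.1)).2.2 1)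
        -- The matching side is unique by `IsMatch.unique`, so the choice is harmless.
        (fun c => Q.edgeEq Z c.1.1 c.1.2 c.2.choose.1 c.2.choose.2 2)))
    ⟨fun Z Z' => by
      funext x
      rcases x with (x | x) | (x | x)
      · simp only [Sum.elim_inl, Pi.add_apply, tangentMap_apply]; ring
      · simp only [Sum.elim_inl, Sum.elim_inr, Pi.add_apply, edgeEq_add]
      · simp only [Sum.elim_inl, Sum.elim_inr, Pi.add_apply, edgeEq_add]
      · simp only [Sum.elim_inr, Pi.add_apply, edgeEq_add],
    fun r Z => by
      funext x
      rcases x with (x | x) | (x | x)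
      · simp only [Sum.elim_inl, Pi.smul_apply, tangentMap_apply, smul_eq_mul]; ring
      · simp only [Sum.elim_inl, Sum.elim_inr, Pi.smul_apply, edgeEq_smul, smul_eq_mul]
      · simp only [Sum.elim_inl, Sum.elim_inr, Pi.smul_apply, edgeEq_smul, smul_eq_mul]
      · simp only [Sum.elim_inr, Pi.smul_apply, edgeEq_smul, smul_eq_mul]⟩

/-- This is the upper bound for the number of basic points. Equations missing from the list are
redundant for one of two reasons: parity at a regular 4-vertex, or the Projections Relation. -/
theorem isSmoothNet_of_equations (hQ : Q.Limitations) {Z : ℝ × ℝ → ℝ} (hZ : C.equations Z = 0) :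
    Q.IsSmoothNet Z := by
  have hE : ∀ v w, C.DepE (v, w) →
      Z (Q.ptE v w) = Z (Q.pos v) + 1 / 4 * C.tangentMap Z v (Q.dir v w) := by
    intro v w h
    have := congrFun hZ (Sum.inl (Sum.inl ⟨(v, w), h⟩))
    exact sub_eq_zero.mp this
  have hT : ∀ c, C.DepT c → Q.edgeEq Z (twistEdge (Q := Q) c).1.1 (twistEdge (Q := Q) c).1.2
      (twistEdge (Q := Q) c).2.1 (twistEdge (Q := Q) c).2.2 1 = 0 := fun c h =>
    congrFun hZ (Sum.inl (Sum.inr ⟨c, h⟩))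
  have hD : ∀ v, Q.IsFreeEven v → Q.edgeEq Z (twistEdge (Q := Q) (C.t v)).1.1
      (twistEdge (Q := Q) (C.t v)).1.2 (twistEdge (Q := Q) (C.t v)).2.1
      (twistEdge (Q := Q) (C.t v)).2.2 1 = 0 := fun v h =>
    congrFun hZ (Sum.inr (Sum.inl ⟨v, h⟩))
  have hM : ∀ f k g l, Q.IsMatch f k g l → C.DepM (f, k) → Q.edgeEq Z f k g l 2 = 0 := by
    intro f k g l h h'
    have h1 : Q.edgeEq Z f k h'.choose.1 h'.choose.2 2 = 0 :=
      congrFun hZ (Sum.inr (Sum.inr ⟨(f, k), h'⟩))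
    obtain ⟨h2, h3⟩ := h.unique h'.choose_spec.1
    rwa [← h2, ← h3] at h1
  have htan : ∀ v w, Q.Adj v w →
      Z (Q.ptE v w) = Z (Q.pos v) + 1 / 4 * C.tangentMap Z v (Q.dir v w) := by
    intro v w hw
    by_cases ha : w = C.a v
    · rw [ha]; exact C.tangentMap_a Z v
    by_cases hb : w = C.b v
    · rw [hb]; exact C.tangentMap_b Z v
    refine hE v w ⟨fun hc => ?_, hw, ha, hb⟩
    rcases C.eq_a_or_eq_b_of_isCorner hc hw with h | h
    · exact ha h
    · exact hb h
  have htwist : ∀ f k g l, Q.IsMatch f k g l → Q.edgeEq Z f k g l 1 = 0 := by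
    intro f k g l h
    have hnc : ¬ Q.IsCorner (Q.vert f k) := fun hc => hc.not_isInnerEdge h.isInnerEdge
    by_cases hb : Q.IsBoundaryVertex (Q.vert f k)
    -- The boundary vertex has two corners and one inner edge. At least one T-point is dependent,
    -- and its equation is the twist equation of that edge.
    · obtain ⟨c, d, hcd, -, -, hin, -⟩ := exists_two_corners hQ hb hnc
      have key : ∀ x : F × Fin 4, C.DepT x → Q.vert x.1 x.2 = Q.vert f k →
          Q.edgeEq Z f k g l 1 = 0 := by
        intro x hx hv
        obtain ⟨h1, h2, -⟩ := twistEdge_spec hQ hx.1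
        have h3 := hT x hx
        set y := twistEdge (Q := Q) x
        have h4 : Q.vert y.1.1 y.1.2 = Q.vert f k := h2.trans hv
        have h5 : Q.vert y.1.1 (y.1.2 + 1) = Q.vert f (k + 1) := by
          have h6 := h1.isInnerEdge
          rw [h4] at h6
          exact ((hin _).mp h6).trans ((hin _).mp h.isInnerEdge).symm
        obtain ⟨h6, h7⟩ := side_unique h4 h5
        rw [h6, h7] at h1 h3
        obtain ⟨h8, h9⟩ := h1.unique h
        rwa [h8, h9] at h3
      have hdep : ∀ x : Q.Corner (Q.vert f k), x.1 ≠ C.t (Q.vert f k) → C.DepT x.1 := by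
        intro x hx
        refine ⟨by rw [x.2]; exact hnc, Or.inr ?_⟩
        rwa [x.2]
      by_cases hct : c.1 = C.t (Q.vert f k)
      · exact key d.1 (hdep d fun h => hcd (Subtype.ext (hct.trans h.symm))) d.2
      · exact key c.1 (hdep c hct) c.2
    · have key : ∀ (f : F) (k : Fin 4) (g : F) (l : Fin 4), Q.IsMatch f k g l →
          ¬ Q.IsBoundaryVertex (Q.vert f k) → ¬ Q.IsCorner (Q.vert f k) →
          (C.DepT (f, k) ∨ Q.IsFreeEven (Q.vert f k) ∧ C.t (Q.vert f k) = (f, k)) →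
          Q.edgeEq Z f k g l 1 = 0 := by
        intro f k g l h hb hnc hor
        have h3 : Q.edgeEq Z (twistEdge (Q := Q) (f, k)).1.1 (twistEdge (Q := Q) (f, k)).1.2
            (twistEdge (Q := Q) (f, k)).2.1 (twistEdge (Q := Q) (f, k)).2.2 1 = 0 := by
          rcases hor with h | ⟨h1, h2⟩
          · exact hT _ h
          · rw [← h2]; exact hD _ h1
        obtain ⟨h1, -, h2⟩ := twistEdge_spec hQ (x := (f, k)) hnc
        rw [h2 hb] at h3 h1
        obtain ⟨h8, h9⟩ := h1.unique h
        rwa [h8, h9] at h3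
      by_cases hdep : C.DepT (f, k)
      · exact key f k g l h hb hnc (Or.inl hdep)
      have ht : (f, k) = C.t (Q.vert f k) := by
        by_contra ht
        exact hdep ⟨hnc, Or.inr ht⟩
      have heven : Even (Q.valence (Q.vert f k)) := by
        by_contra hodd
        exact hdep ⟨hnc, Or.inl ⟨hb, Nat.not_even_iff_odd.mp hodd⟩⟩
      -- Here the corner is the chosen one at an even vertex. For a regular 4-vertex the D-terms
      -- vanish, the twist equations say that twist values alternate, and the missing one follows
      -- from the others by parity.
      by_cases hreg : Q.IsRegular4 (Q.vert f k)
      · obtain ⟨c, p, hc, hp, hcp⟩ := h.exists_corners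
        have e0 : Q.edgeEq Z f k g l 1 = Q.edgeEq Z c.1.1 c.1.2 p.1.1 (p.1.2 + 3) 1 := by
          rw [hc, hp, fin4_add_one_add_three]
        have hnext : next hb p = c := Corner.rgt_injective _ (by rw [rgt_next, hcp])
        have hform : ∀ x : Q.Corner (Q.vert f k),
            Q.edgeEq Z (next hb x).1.1 (next hb x).1.2 x.1.1 (x.1.2 + 3) 1 = 0 ↔
              twistVal Z (C.tangentMap Z (Q.vert f k)) (next hb x) =
                -twistVal Z (C.tangentMap Z (Q.vert f k)) x := by
          intro x
          have h1 := x.cross2_pos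
          have h2 := (next hb x).cross2_pos
          rw [edgeEq_one (htan _) (rgt_next hb x).symm, hreg.cross2_eq_zero (rgt_next hb x).symm,
            mul_zero, zero_mul, sub_zero, mul_eq_zero, or_iff_right (by positivity),
            eq_neg_iff_add_eq_zero]
        rw [e0, ← hnext, hform]
        refine alternating_of_even hb heven fun x hx => ?_
        rw [← hform]
        refine key _ _ _ _ (isMatch_of_corners (rgt_next hb x).symm) ?_ ?_ (Or.inl ?_)
        · rw [(next hb x).2]; exact hb
        · rw [(next hb x).2]; exact hnc
        · refine ⟨by rw [(next hb x).2]; exact hnc, Or.inr fun h => hx ?_⟩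
          rw [(next hb x).2, ← ht, ← hc] at h
          exact (next hb).injective ((Subtype.ext h).trans hnext.symm)
      · exact key f k g l h hb hnc (Or.inr ⟨⟨hb, heven, hreg⟩, ht.symm⟩)
  refine ⟨fun v => ⟨C.tangentMap Z v, htan v⟩, htwist, fun f k g l h => ?_⟩
  by_cases hdep : C.DepM (f, k)
  · exact hM f k g l h hdep
  -- The middle point of this side is basic, so the Projections Relation holds and the edge is
  -- positive in this direction. The opposite side then has its own middle equation, and the present
  -- one follows from the remaining five.
  · rw [C.depM_iff h, not_not] at hdep
    have hdep' : C.DepM (g, l) := by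
      rw [C.depM_iff h.symm, ← h.1, ← h.2, dir_symm]
      exact fun h' => hdep.2.not_neg h'.2
    have htan' : ∀ v, ∃ G : ℝ × ℝ →ₗ[ℝ] ℝ, ∀ w, Q.Adj v w →
      Z (Q.ptE v w) = Z (Q.pos v) + 1 / 4 * G (Q.dir v w) := fun v => ⟨_, htan v⟩
    refine edgeEq_two_eq_zero h hdep.1 fun i hi hi2 => ?_
    interval_cases i
    · exact IsSmoothNet.edgeEq_zero htan' h
    · exact htwist _ _ _ _ h
    · exact absurd rfl hi2
    · exact (edgeEq_symm Z h.symm (i := 3) (by norm_num)).trans (hM _ _ _ _ h.symm hdep')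
    · exact (edgeEq_symm Z h.symm (i := 4) (by norm_num)).trans (htwist _ _ _ _ h.symm)
    · exact (edgeEq_symm Z h.symm (i := 5) (by norm_num)).trans
        (IsSmoothNet.edgeEq_zero htan' h.symm)

instance : Finite C.DepIndex := by
  unfold DepIndex
  infer_instance

omit [Finite V] [Finite F] in
theorem depPoint_mem_CP (x : C.DepIndex) : C.depPoint x ∈ Q.CP 4 := by
  rcases x with (⟨x, hx⟩ | ⟨c, hc⟩) | (⟨v, hv⟩ | ⟨c, hc⟩)
  · exact ptE_mem_CP hx.2.1
  · exact Q.cpt_mem_CP c.1 c.2 (by norm_num) (by norm_num)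
  · exact ptD_mem_CP (C.adj_d v hv)
  · exact Q.cpt_mem_CP c.1 c.2 (by norm_num) (by norm_num)

/-- There are at most as many basic points as the dimension of the space of smooth nets. -/
theorem ncard_basic_le (hQ : Q.Limitations) :
    C.basic.ncard ≤ Module.finrank ℝ Q.smoothNets := by
  have h1 := ncard_CP_le C.equations fun Z hZ => C.isSmoothNet_of_equations hQ hZ
  have h2 : Set.range C.depPoint ⊆ Q.CP 4 := by
    rintro _ ⟨x, rfl⟩
    exact C.depPoint_mem_CP x
  have h3 := Set.ncard_sdiff_add_ncard_of_subset h2 Q.finite_CP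
  have h4 : (Set.range C.depPoint).ncard = Nat.card C.DepIndex := by
    rw [← Set.image_univ, Set.ncard_image_of_injective _ C.depPoint_injective, Set.ncard_univ]
  rw [h4] at h3
  rw [basic]
  omega

end TemplateChoice

end QuadMesh

/-! ### Propagation of zeros from the basic points to all control points -/

namespace QuadMesh

variable {V F : Type*} {Q : QuadMesh V F}

theorem linearMap_eq_zero_of_cross2_ne_zero {H : ℝ × ℝ →ₗ[ℝ] ℝ} {a b : ℝ × ℝ}
    (hab : cross2 a b ≠ 0) (ha : H a = 0) (hb : H b = 0) : H = 0 := by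
  ext1 <;> ext1
  · simp only [LinearMap.comp_apply, LinearMap.zero_apply]
    rw [eq_smul_add_smul_of_cross2_ne_zero hab (LinearMap.inl ℝ ℝ ℝ 1), map_add, map_smul, map_smul,
      ha, hb, smul_zero, smul_zero, add_zero]
  · simp only [LinearMap.comp_apply, LinearMap.zero_apply]
    rw [eq_smul_add_smul_of_cross2_ne_zero hab (LinearMap.inr ℝ ℝ ℝ 1), map_add, map_smul, map_smul,
      ha, hb, smul_zero, smul_zero, add_zero]

/-- If the tangent plane at a vertex vanishes at two non-colinear edges, it vanishes. -/
theorem IsSmoothNet.ptE_eq_zero {Z : ℝ × ℝ → ℝ} (hZ : Q.IsSmoothNet Z) {v a b : V} (ha : Q.Adj v a)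
    (hb : Q.Adj v b) (hab : cross2 (Q.dir v a) (Q.dir v b) ≠ 0) (h0 : Z (Q.pos v) = 0)
    (hza : Z (Q.ptE v a) = 0) (hzb : Z (Q.ptE v b) = 0) {w : V} (hw : Q.Adj v w) :
    Z (Q.ptE v w) = 0 := by
  obtain ⟨H, hH⟩ := hZ.tangent v
  have h1 := hH a ha
  have h2 := hH b hb
  rw [hza, h0] at h1
  rw [hzb, h0] at h2
  have h3 : H = 0 := linearMap_eq_zero_of_cross2_ne_zero hab (by linarith) (by linarith)
  rw [hH w hw, h3, h0]
  simp

/-- The twist equation at a vertex with vanishing tangent plane. -/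
theorem IsSmoothNet.twistVal_add {Z : ℝ × ℝ → ℝ} (hZ : Q.IsSmoothNet Z) {v : V}
    (h0 : Z (Q.pos v) = 0) (hE : ∀ w, Q.Adj v w → Z (Q.ptE v w) = 0) {c p : Q.Corner v}
    (h : p.lft = c.rgt) :
    4 * cross2 (Q.dir v p.rgt) (Q.dir v p.lft) * cross2 (Q.dir v c.rgt) (Q.dir v c.lft) *
        (twistVal Z 0 c + twistVal Z 0 p) =
      3 * cross2 (Q.dir v p.rgt) (Q.dir v c.lft) * Z (Q.ptD v c.rgt) := by
  have h1 := edgeEq_one (Z := Z) (H := 0) (fun w hw => by rw [hE w hw, h0]; simp) h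
  rw [hZ.twist _ _ _ _ (isMatch_of_corners h)] at h1
  simp only [h0, LinearMap.zero_apply, add_zero, sub_zero] at h1
  linarith

/-- The D-term drops out either because the vertex does not use the point or because the control
value there is zero. -/
theorem IsSmoothNet.twistVal_eq_neg {Z : ℝ × ℝ → ℝ} (hZ : Q.IsSmoothNet Z) {v : V}
    (h0 : Z (Q.pos v) = 0) (hE : ∀ w, Q.Adj v w → Z (Q.ptE v w) = 0) {c p : Q.Corner v}
    (h : p.lft = c.rgt)
    (hD : cross2 (Q.dir v p.rgt) (Q.dir v c.lft) = 0 ∨ Z (Q.ptD v c.rgt) = 0) :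
    twistVal Z 0 c = -twistVal Z 0 p := by
  have h1 := hZ.twistVal_add h0 hE h
  have h2 := p.cross2_pos
  have h3 := c.cross2_pos
  have h4 : 3 * cross2 (Q.dir v p.rgt) (Q.dir v c.lft) * Z (Q.ptD v c.rgt) = 0 := by
    rcases hD with hD | hD <;> rw [hD] <;> ring
  rw [h4, mul_eq_zero, or_iff_right (by positivity)] at h1
  linarith

theorem twistVal_zero_eq_zero_iff {Z : ℝ × ℝ → ℝ} {v : V} (h0 : Z (Q.pos v) = 0) (c : Q.Corner v) :
    twistVal Z 0 c = 0 ↔ Z (Q.ptT c.1.1 c.1.2) = 0 := by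
  rw [twistVal, div_eq_zero_iff, or_iff_left c.cross2_pos.ne', h0]
  simp

/-- The middle equations, when all the other control values at the edge vanish. -/
theorem middle_equations {Z : ℝ × ℝ → ℝ} (hZ : Q.IsSmoothNet Z) {f g : F} {k l : Fin 4}
    (h : Q.IsMatch f k g l) (hV : ∀ v, Z (Q.pos v) = 0)
    (hE : ∀ v w, Q.Adj v w → Z (Q.ptE v w) = 0) (hD : ∀ v w, Q.Adj v w → Z (Q.ptD v w) = 0)
    (hT : ∀ f k, ¬ Q.IsCorner (Q.vert f k) → Z (Q.ptT f k) = 0)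
    (hc₀ : ¬ Q.IsCorner (Q.vert f k)) (hc₁ : ¬ Q.IsCorner (Q.vert f (k + 1)))
    (hM : Q.ProjectionsRelation f k g l → Z (Q.ptM f k) = 0 ∨ Z (Q.ptM g l) = 0) :
    Z (Q.ptM f k) = 0 ∧ Z (Q.ptM g l) = 0 := by
  have e2 := hZ.edgeEq_eq_zero h 2
  have e3 := hZ.edgeEq_eq_zero h 3
  obtain ⟨hr₀, hr₁, hl₀, hl₁⟩ := h.weights_pos
  rw [projectionsRelation_iff h] at hM
  have ha : Q.Adj (Q.vert f k) (Q.vert f (k + 1)) := h.isInnerEdge.adj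
  have m1 : Q.cpt 4 f k 2 1 = Q.ptM f k := rfl
  have m2 : Q.cpt 4 g l 2 1 = Q.ptM g l := rfl
  have t1 : Q.cpt 4 f k 1 1 = Q.ptT f k := rfl
  have t2 : Q.cpt 4 g l 1 1 = Q.ptT g l := rfl
  have z1 := hT f k hc₀
  have z2 := hT f (k + 1) hc₁
  have z3 := hT g (l + 1) (by rw [← h.1]; exact hc₀)
  have z4 := hT g l (by rw [← h.2]; exact hc₁)
  simp only [edgeEq, edgeCoeff, Nat.reduceSub, cpt_zero_zero, cpt_one_zero, cpt_two_zero,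
    cpt_three_zero, cpt_four_zero, cpt_three_one, m1, m2, t1, t2, z1, z2, z3, z4, hV, hD _ _ ha,
    hE _ _ ha, hE _ _ ha.symm] at e2 e3
  generalize cross2 (Q.dir (Q.vert g (l + 1)) (Q.vert g (l + 2)))
    (Q.dir (Q.vert f k) (Q.vert f (k + 1))) = r₀ at *
  generalize cross2 (Q.dir (Q.vert g l) (Q.vert g (l + 3)))
    (Q.dir (Q.vert f k) (Q.vert f (k + 1))) = r₁ at *
  generalize cross2 (Q.dir (Q.vert f k) (Q.vert f (k + 1)))
    (Q.dir (Q.vert f k) (Q.vert f (k + 3))) = l₀ at *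
  generalize cross2 (Q.dir (Q.vert f k) (Q.vert f (k + 1)))
    (Q.dir (Q.vert f (k + 1)) (Q.vert f (k + 2))) = l₁ at *
  generalize Z (Q.ptM f k) = x at *
  generalize Z (Q.ptM g l) = y at *
  -- What remains is a homogeneous system for the two side middle values. Its determinant vanishes
  -- exactly under the Projections Relation, where one value is zero by assumption.
  have e2' : r₀ * x + l₀ * y = 0 := by linarith
  have e3' : r₁ * x + l₁ * y = 0 := by linarith
  have hor : x = 0 ∨ y = 0 := by
    by_cases hP : r₀ * l₁ = l₀ * r₁
    · exact hM hP
    · left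
      have : (r₀ * l₁ - l₀ * r₁) * x = 0 := by linear_combination l₁ * e2' - l₀ * e3'
      exact (mul_eq_zero.mp this).resolve_left (sub_ne_zero.mpr hP)
  rcases hor with rfl | rfl
  · rw [mul_zero, zero_add, mul_eq_zero, or_iff_right hl₀.ne'] at e2'
    exact ⟨rfl, e2'⟩
  · rw [mul_zero, add_zero, mul_eq_zero, or_iff_right hr₀.ne'] at e2'
    exact ⟨e2', rfl⟩

/-- The number of vertices that precede `v` in the lexicographic order. -/
noncomputable def lexRank (Q : QuadMesh V F) (v : V) : ℕ := {u | LexPos (Q.dir u v)}.ncard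

/-- Every predecessor of `u` precedes `v` by transitivity, and `u` itself is one predecessor more.
-/
theorem lexRank_lt [Finite V] {u v : V} (h : LexPos (Q.dir u v)) : Q.lexRank u < Q.lexRank v := by
  refine Set.ncard_lt_ncard ⟨fun x hx => ?_, fun h' => ?_⟩
  · have e : Q.dir x v = Q.dir x u + Q.dir u v := by simp [dir]
    rw [Set.mem_ofPred_eq, e]
    exact LexPos.add hx h
  · have h1 : LexPos (Q.dir u u) := h' h
    rw [dir, sub_self] at h1
    exact not_lexPos_zero h1

namespace TemplateChoice

variable (C : Q.TemplateChoice) {Z : ℝ × ℝ → ℝ} [Finite V] [Finite F]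

/-- A smooth net that vanishes at the basic control points vanishes at the dependent ones. -/
theorem eq_zero (hQ : Q.Limitations) (hZ : Q.IsSmoothNet Z) (h0 : ∀ P ∈ C.basic, Z P = 0) :
    ∀ P ∈ Q.CP 4, Z P = 0 := by
  have hV : ∀ v, Z (Q.pos v) = 0 := fun v => h0 _ (C.pos_mem_basic v)
  have hE : ∀ v w, Q.Adj v w → Z (Q.ptE v w) = 0 := fun v w hw =>
    hZ.ptE_eq_zero (C.adj_a v) (C.adj_b v) (C.cross2_ne v) (hV v)
      (h0 _ ((C.ptE_mem_basic (C.adj_a v)).mpr fun h => h.2.2.1 rfl))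
      (h0 _ ((C.ptE_mem_basic (C.adj_b v)).mpr fun h => h.2.2.2 rfl)) hw
  have hT0 : ∀ v, Z (Q.ptT (C.t v).1 (C.t v).2) = 0 ∨
      (¬ Q.IsBoundaryVertex v ∧ Odd (Q.valence v)) := by
    intro v
    by_cases h : Q.ptT (C.t v).1 (C.t v).2 ∈ C.basic
    · exact Or.inl (h0 _ h)
    · rw [C.ptT_mem_basic, not_not, DepT] at h
      simp only [C.vert_t v] at h
      exact Or.inr (h.2.resolve_right fun h => h rfl)
  -- Owned D-points are treated in lexicographic order of their owners.
  have hown : ∀ n v, Q.lexRank v = n → Q.IsFreeEven v → Z (Q.ptD v (C.d v)) = 0 := by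
    intro n
    induction n using Nat.strong_induction_on with
    | _ n ih =>
      intro v hn hv
      obtain ⟨c₀, hc₀⟩ := exists_rgt_of_adj hv.1 (C.adj_d v hv)
      have hp₀ : next hv.1 ((next hv.1).symm c₀) = c₀ := Equiv.apply_symm_apply _ _
      -- Apart from the point owned by `v`, any dependent D-point used at `v` is owned by the other
      -- end of its edge. That end precedes `v`, so the value is already zero.
      have halt : ∀ x : Q.Corner v, x ≠ (next hv.1).symm c₀ →
          twistVal Z 0 (next hv.1 x) = -twistVal Z 0 x := by
        intro x hx
        refine hZ.twistVal_eq_neg (hV v) (hE v) (rgt_next hv.1 x).symm ?_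
        by_contra! hne
        have huse := (uses_iff (rgt_next hv.1 x).symm).mpr hne.1
        have hdep : Q.ptD v (next hv.1 x).rgt ∉ C.basic := fun h => hne.2 (h0 _ h)
        obtain ⟨y, hy, e⟩ := (C.ptD_notMem_basic (next hv.1 x).adj_rgt).mp hdep
        rcases Sym2.eq_iff.mp e with ⟨rfl, h2⟩ | ⟨h1, h2⟩
        · rw [← hc₀] at h2
          refine hx ?_
          rw [Equiv.eq_symm_apply]
          exact (Corner.rgt_injective _ h2).symm
        · have hl := C.lexPos_d y hy
          rw [h2] at hl
          have h3 := ih _ (hn ▸ lexRank_lt hl) y rfl hy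
          rw [h2, h1, ← ptD_symm] at h3
          exact hne.2 h3
      -- By parity the twist values alternate across the owned edge as well. The twist equation
      -- there leaves the owned D-value times a nonzero coefficient.
      have h1 := alternating_of_even hv.1 hv.2.1 halt
      rw [hp₀] at h1
      have hl : ((next hv.1).symm c₀).lft = c₀.rgt := lft_next_symm hv.1 c₀
      have h2 := hZ.twistVal_add (hV v) (hE v) hl
      rw [h1, neg_add_cancel, mul_zero, eq_comm, mul_eq_zero, hc₀] at h2
      refine h2.resolve_left ?_
      have := C.uses_d v hv
      rw [← hc₀, uses_iff hl] at this
      exact mul_ne_zero (by norm_num) this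
  have hD : ∀ v w, Q.Adj v w → Z (Q.ptD v w) = 0 := by
    intro v w hw
    by_cases h : Q.ptD v w ∈ C.basic
    · exact h0 _ h
    · obtain ⟨x, hx, e⟩ := (C.ptD_notMem_basic hw).mp h
      rw [← Q.ptD_eq_of_sym2 e]
      exact hown _ x rfl hx
  have hT : ∀ f k, ¬ Q.IsCorner (Q.vert f k) → Z (Q.ptT f k) = 0 := by
    intro f k hc
    set v := Q.vert f k with hv
    let x₀ : Q.Corner v := ⟨(f, k), rfl⟩
    let x₁ : Q.Corner v := ⟨C.t v, C.vert_t v⟩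
    by_cases hb : Q.IsBoundaryVertex v
    · obtain ⟨c, d, -, hall, hcd, -, -⟩ := exists_two_corners hQ hb hc
      have h1 := hZ.twistVal_eq_neg (hV v) (hE v) hcd (Or.inr (hD _ _ d.adj_rgt))
      have ht : twistVal Z 0 x₁ = 0 := (twistVal_zero_eq_zero_iff (hV v) x₁).mpr
        ((hT0 v).resolve_right fun h => h.1 hb)
      have h2 : twistVal Z 0 x₀ = 0 := by
        rcases hall x₁ with h | h <;> rcases hall x₀ with h' | h' <;> rw [h] at ht <;> rw [h'] <;>
          linarith
      exact (twistVal_zero_eq_zero_iff (hV v) x₀).mp h2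
    · have halt : ∀ x : Q.Corner v, twistVal Z 0 (next hb x) = -twistVal Z 0 x := fun x =>
        hZ.twistVal_eq_neg (hV v) (hE v) (rgt_next hb x).symm (Or.inr (hD _ _ (Corner.adj_rgt _)))
      refine (twistVal_zero_eq_zero_iff (hV v) x₀).mp ?_
      rcases hT0 v with h | h
      · exact eq_zero_of_alternating hb (x₀ := x₁) ((twistVal_zero_eq_zero_iff (hV v) x₁).mpr h)
          halt x₀
      · exact eq_zero_of_alternating_of_odd hb h.2 halt x₀
  have hM : ∀ f k g l, Q.IsMatch f k g l → Z (Q.ptM f k) = 0 := by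
    intro f k g l h
    refine (middle_equations hZ h hV hE hD hT (fun hc => hc.not_isInnerEdge h.isInnerEdge)
      (fun hc => hc.not_isInnerEdge h.isInnerEdge.symm) fun hP => ?_).1
    -- The lexicographic sign of the edge tells which of the two side middle points is the basic
    -- one.
    rcases lexPos_or_neg (Q.dir_ne_zero h.isInnerEdge.adj.ne) with hl | hl
    · exact Or.inl (h0 _ ((C.ptM_mem_basic f k).mpr fun hd => (C.depM_iff h).mp hd ⟨hP, hl⟩))
    · refine Or.inr (h0 _ ((C.ptM_mem_basic g l).mpr fun hd =>
        (C.depM_iff h.symm).mp hd ⟨(projectionsRelation_symm h).mpr hP, ?_⟩))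
      rwa [← h.1, ← h.2, dir_symm]
  intro P hP
  by_cases hb : P ∈ C.basic
  · exact h0 P hb
  have hr : P ∈ Set.range C.depPoint := by
    by_contra h
    exact hb ⟨hP, h⟩
  rcases C.mem_range_depPoint.mp hr with ⟨v, w, h, rfl⟩ | ⟨f, k, h, rfl⟩ | ⟨v, h, rfl⟩ |
    ⟨f, k, ⟨e, h, -⟩, rfl⟩
  · exact hE v w h.2.1
  · exact hT f k h.1
  · exact hD _ _ (C.adj_d v h)
  · exact hM f k e.1 e.2 h

theorem isMDS_basic (hQ : Q.Limitations) : Q.IsMDS 4 C.basic :=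
  isMDS_of_ncard_le (isDetermining_iff.mpr ⟨Set.sdiff_subset, fun _ hZ h0 => C.eq_zero hQ hZ h0⟩)
    (C.ncard_basic_le hQ)

end TemplateChoice

end QuadMesh

namespace QuadMesh

variable {V F : Type*} {Q : QuadMesh V F}

/-! ### Positions of the dependent control points -/

section Finite

variable [Finite V] [Finite F]

/-- Every element at a vertex that is not a mesh corner has an inner edge there. Hence the E- and
T-points of such a vertex lie on an inner edge or in the row next to it. -/
theorem Corner.isInnerEdge_or (hQ : Q.Limitations) {v : V} (hv : ¬ Q.IsCorner v) (x : Q.Corner v) :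
    Q.IsInnerEdge v x.rgt ∨ Q.IsInnerEdge v x.lft := by
  by_cases hb : Q.IsBoundaryVertex v
  · obtain ⟨c, d, -, hall, hcd, hin, -⟩ := exists_two_corners hQ hb hv
    rcases hall x with rfl | rfl
    · exact Or.inr ((hin _).mpr hcd)
    · exact Or.inl ((hin _).mpr rfl)
  · exact Or.inl (isInnerEdge_of_not_isBoundaryVertex hb x.adj_rgt)

omit [Finite V] [Finite F] in
theorem Corner.mem_GCP {v : V} {x : Q.Corner v} (h : Q.IsInnerEdge v x.rgt) {i j : ℕ} (hi : i ≤ 4)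
    (hj : j ≤ 1) : Q.cpt 4 x.1.1 x.1.2 i j ∈ Q.GCP 4 :=
  ⟨x.1.1, x.1.2, by rw [x.2]; exact h, i, hi, j, hj, rfl⟩

omit [Finite V] [Finite F] in
theorem Corner.mem_GCP' {v : V} {x : Q.Corner v} (h : Q.IsInnerEdge v x.lft) {i j : ℕ} (hi : i ≤ 4)
    (hj : j ≤ 1) : Q.cpt 4 x.1.1 (x.1.2 + 3) i j ∈ Q.GCP 4 :=
  ⟨x.1.1, x.1.2 + 3, by rw [fin4_add_three_add_one, x.2]; exact h.symm, i, hi, j, hj, rfl⟩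

theorem ptE_mem_GCP (hQ : Q.Limitations) {v w : V} (hv : ¬ Q.IsCorner v) (hw : Q.Adj v w) :
    Q.ptE v w ∈ Q.GCP 4 := by
  have q2 : ∀ k : Fin 4, k + 3 + 2 = k + 1 := fun k => by rw [add_assoc]; rfl
  rcases adj_iff.mp hw with ⟨x, rfl⟩ | ⟨x, rfl⟩ <;> rcases x.isInnerEdge_or hQ hv with h | h
  · have := Corner.mem_GCP h (i := 1) (j := 0) (by norm_num) (by norm_num)
    rwa [cpt_one_zero, x.2] at this
  · have := Corner.mem_GCP' h (i := 4) (j := 1) (by norm_num) (by norm_num)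
    rwa [cpt_four_one, fin4_add_three_add_one, x.2, q2] at this
  · have := Corner.mem_GCP h (i := 0) (j := 1) (by norm_num) (by norm_num)
    rwa [cpt_zero_one, x.2] at this
  · have := Corner.mem_GCP' h (i := 3) (j := 0) (by norm_num) (by norm_num)
    rwa [cpt_three_zero, fin4_add_three_add_one, x.2] at this

theorem ptT_mem_GCP (hQ : Q.Limitations) {f : F} {k : Fin 4} (hv : ¬ Q.IsCorner (Q.vert f k)) :
    Q.ptT f k ∈ Q.GCP 4 := by
  let x : Q.Corner (Q.vert f k) := ⟨(f, k), rfl⟩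
  rcases x.isInnerEdge_or hQ hv with h | h
  · exact Corner.mem_GCP h (i := 1) (j := 1) (by norm_num) (by norm_num)
  · have := Corner.mem_GCP' h (i := 3) (j := 1) (by norm_num) (by norm_num)
    rwa [cpt_three_one, fin4_add_three_add_one] at this

end Finite

theorem ptD_mem_GCP {v w : V} (h : Q.IsInnerEdge v w) : Q.ptD v w ∈ Q.GCP 4 := by
  obtain ⟨f, k, rfl, rfl⟩ := h.1
  exact ⟨f, k, h, 2, by norm_num, 0, by norm_num, (Q.cpt_two_zero f k).symm⟩

theorem IsMatch.ptM_mem_GCP {f g : F} {k l : Fin 4} (h : Q.IsMatch f k g l) :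
    Q.ptM f k ∈ Q.GCP 4 :=
  ⟨f, k, h.isInnerEdge, 2, by norm_num, 1, by norm_num, rfl⟩

/-- Every control point in the two rows at an inner edge has another type, or is the D-point of that
inner edge. Boundary curve constraints may therefore fix D-points of boundary edges freely. -/
theorem ptD_notMem_GCP {v w : V} (hw : Q.IsBoundaryEdge v w) : Q.ptD v w ∉ Q.GCP 4 := by
  rintro ⟨f, k, h, i, hi, j, hj, e⟩
  interval_cases j <;> interval_cases i
  · rw [cpt_zero_zero] at e
    exact ptD_ne_pos hw.1 _ e
  · rw [cpt_one_zero] at e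
    exact ptE_ne_ptD h.adj hw.1 e.symm
  · rw [cpt_two_zero] at e
    rcases Sym2.eq_iff.mp (ptD_injective hw.1 h.adj e) with ⟨h1, h2⟩ | ⟨h1, h2⟩
    · exact hw.2 (by rw [h1, h2]; exact h)
    · exact hw.2 (by rw [h1, h2]; exact h.symm)
  · rw [cpt_three_zero] at e
    exact ptE_ne_ptD h.adj.symm hw.1 e.symm
  · rw [cpt_four_zero] at e
    exact ptD_ne_pos hw.1 _ e
  · rw [cpt_zero_one] at e
    exact ptE_ne_ptD (Corner.adj_lft ⟨(f, k), rfl⟩) hw.1 e.symm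
  · exact ptT_ne_ptD hw.1 e.symm
  · exact ptM_ne_ptD hw.1 e.symm
  · rw [cpt_three_one] at e
    exact ptT_ne_ptD hw.1 e.symm
  · rw [cpt_four_one] at e
    exact ptE_ne_ptD (Or.inl ⟨f, k + 1, rfl, by rw [fin4_add_one_add_one]⟩) hw.1 e.symm

namespace TemplateChoice

variable (C : Q.TemplateChoice) [Finite V] [Finite F] {S : Set (ℝ × ℝ)}

/-- This is what makes all points outside the smoothness conditions basic. -/
theorem range_depPoint_subset_GCP (hQ : Q.Limitations) : Set.range C.depPoint ⊆ Q.GCP 4 := by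
  intro P hP
  rcases C.mem_range_depPoint.mp hP with ⟨v, w, h, rfl⟩ | ⟨f, k, h, rfl⟩ | ⟨v, h, rfl⟩ |
    ⟨f, k, ⟨e, h, -⟩, rfl⟩
  · exact ptE_mem_GCP hQ h.1 h.2.1
  · exact ptT_mem_GCP hQ h.1
  · exact ptD_mem_GCP (isInnerEdge_of_not_isBoundaryVertex h.1 (C.adj_d v h))
  · exact h.ptM_mem_GCP

omit [Finite V] [Finite F] in
theorem existsUnique_twist {v : V} (hv : ¬ Q.IsCorner v)
    (hodd : ¬ (¬ Q.IsBoundaryVertex v ∧ Odd (Q.valence v))) :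
    ∃! c : F × Fin 4, Q.vert c.1 c.2 = v ∧ Q.ptT c.1 c.2 ∈ C.basic := by
  refine ⟨C.t v, ⟨C.vert_t v, (C.ptT_mem_basic _ _).mpr ?_⟩, ?_⟩
  · rintro ⟨-, h | h⟩
    · rw [C.vert_t] at h
      exact hodd h
    · rw [C.vert_t] at h
      exact h rfl
  · rintro c ⟨rfl, hc⟩
    by_contra h
    exact (C.ptT_mem_basic _ _).mp hc ⟨hv, Or.inr h⟩

theorem isTemplateInstance (hQ : Q.Limitations) (hS : ∀ v, ¬ Q.IsDRelevantBoundary S v) :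
    Q.IsTemplateInstance S C.basic := by
  have hrel : ∀ v, Q.IsDRelevant S v ↔ Q.IsFreeEven v := fun v => or_iff_left (hS v)
  refine ⟨Set.sdiff_subset, fun P hP => ⟨hP.1, fun h => hP.2 (C.range_depPoint_subset_GCP hQ h)⟩,
    fun v _ => C.pos_mem_basic v, fun v hv => ⟨C.a v, C.b v, C.adj_a v, C.adj_b v, C.cross2_ne v,
      fun w hw => ?_⟩, ?_, ?_, ?_, fun v h => absurd h (hS v), ⟨C.d, Q.lexRank, ?_, ?_, ?_, ?_⟩, ?_⟩
  · rw [C.ptE_mem_basic hw]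
    constructor
    · intro h
      by_contra! h'
      exact h ⟨hv, hw, h'⟩
    · rintro h ⟨-, -, h1, h2⟩
      exact h.elim h1 h2
  · rintro v hb hodd f k rfl h
    exact (C.ptT_mem_basic f k).mp h ⟨fun hc => hb hc.1, Or.inl ⟨hb, hodd⟩⟩
  · intro v hb heven
    exact C.existsUnique_twist (fun hc => hb hc.1) fun h => Nat.not_even_iff_odd.mpr h.2 heven
  · intro v hb hc _
    exact C.existsUnique_twist hc fun h => h.1 hb
  · intro v h
    exact C.uses_d v ((hrel v).mp h)
  · intro v w hv hw h
    exact C.eq_of_ptD_eq ((hrel v).mp hv) ((hrel w).mp hw) h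
  · intro v w h
    rw [C.ptD_notMem_basic h.adj]
    exact exists_congr fun x => and_congr_left fun _ => (hrel x).symm
  -- The owner `x` differs from `v`, so it is the other end `w`, and its edge leads to `v` in the
  -- positive direction.
  · intro v w x _ _ hx hne e
    rcases Sym2.eq_iff.mp e with ⟨h1, -⟩ | ⟨-, h2⟩
    · exact absurd h1 hne
    · have := C.lexPos_d x ((hrel x).mp hx)
      rw [h2] at this
      exact lexRank_lt this
  · intro f k g l h1 h2
    have h : Q.IsMatch f k g l := ⟨h1, h2⟩
    have hd : Q.dir (Q.vert g l) (Q.vert g (l + 1)) = -Q.dir (Q.vert f k) (Q.vert f (k + 1)) := by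
      rw [← h.1, ← h.2, dir_symm]
    simp only [C.ptM_mem_basic, C.depM_iff h, C.depM_iff h.symm, not_not,
      projectionsRelation_symm h, hd]
    refine ⟨fun hP => ⟨fun h => hP h.1, fun h => hP h.1⟩, fun hP => ?_⟩
    rcases lexPos_or_neg (Q.dir_ne_zero h.isInnerEdge.adj.ne) with hl | hl
    · exact Or.inl ⟨⟨hP, hl⟩, fun h => hl.not_neg h.2⟩
    · exact Or.inr ⟨⟨hP, hl⟩, fun h => h.2.not_neg hl⟩

/-- If the choices prefer fixed control points, the basic points fit the constraint. -/
theorem fits (hQ : Q.Limitations) (hSC : S ⊆ Q.CP 4) (hstd : Q.IsStandardConstraint S)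
    (hrel : ∀ v, ¬ Q.IsDRelevantBoundary S v)
    (hE : ∀ v w, Q.Adj v w → Q.ptE v w ∈ S → w ≠ C.a v → w ≠ C.b v → Q.ptE v (C.a v) ∈ S ∧
      (Q.ptE v (C.b v) ∈ S ∨ cross2 (Q.dir v (C.a v)) (Q.dir v w) = 0))
    (hT : ∀ f k, Q.ptT f k ∈ S → Q.ptT (C.t (Q.vert f k)).1 (C.t (Q.vert f k)).2 ∈ S) :
    Q.Fits 4 S C.basic := by
  intro P hP
  by_cases hb : P ∈ C.basic
  · exact Or.inl hb
  right
  have hr : P ∈ Set.range C.depPoint := by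
    by_contra h
    exact hb ⟨hSC hP, h⟩
  have hEa : ∀ v, Q.ptE v (C.a v) ∈ C.basic := fun v =>
    (C.ptE_mem_basic (C.adj_a v)).mpr fun h => h.2.2.1 rfl
  have hEb : ∀ v, Q.ptE v (C.b v) ∈ C.basic := fun v =>
    (C.ptE_mem_basic (C.adj_b v)).mpr fun h => h.2.2.2 rfl
  refine dependsOnly_of_forall fun Z hZ h0 => ?_
  rcases hstd.kinds P hP (C.range_depPoint_subset_GCP hQ hr) with ⟨v, rfl⟩ | ⟨v, w, hw, rfl⟩ |
    ⟨f, k, hbd, hc, rfl⟩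
  · exact absurd (C.pos_mem_basic v) hb
  -- If both chosen E-points are fixed, they determine the tangent plane. Otherwise the edge is
  -- colinear with the edge to `C.a v`, and the plane restricted to that line is determined by `v`
  -- and one fixed E-point.
  · rw [C.ptE_mem_basic hw, not_not] at hb
    have hv := h0 _ ⟨C.pos_mem_basic v, hstd.tangent v w hb.1 hw hP⟩
    obtain ⟨haS, hor⟩ := hE v w hw hP hb.2.2.1 hb.2.2.2
    have ha := h0 _ ⟨hEa v, haS⟩
    rcases hor with hbS | hab
    · exact hZ.ptE_eq_zero (C.adj_a v) (C.adj_b v) (C.cross2_ne v) hv ha (h0 _ ⟨hEb v, hbS⟩) hw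
    · obtain ⟨r, hr⟩ := exists_smul_eq_of_cross2_eq_zero (Q.dir_ne_zero (C.adj_a v).ne) hab
      obtain ⟨H, hH⟩ := hZ.tangent v
      have h1 := hH _ (C.adj_a v)
      rw [ha, hv] at h1
      have h2 : H (Q.dir v (C.a v)) = 0 := by linarith
      rw [hH w hw, hr, map_smul, h2, hv]
      simp
  · rw [C.ptT_mem_basic, not_not] at hb
    set v := Q.vert f k with hv
    have hne : (f, k) ≠ C.t v := hb.2.resolve_left fun h => h.1 hbd
    let x₀ : Q.Corner v := ⟨(f, k), rfl⟩
    let x₁ : Q.Corner v := ⟨C.t v, C.vert_t v⟩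
    have hx : x₀ ≠ x₁ := fun h => hne (congrArg Subtype.val h)
    obtain ⟨c, d, hcd, hall, hlr, hin, hout⟩ := exists_two_corners hQ hbd hc
    -- A boundary vertex that is not a mesh corner has two T-points. The dependent one is fixed by
    -- assumption, and the chosen one is then fixed too because the choice prefers `S`.
    have hallT : ∀ g l, Q.vert g l = v → Q.ptT g l ∈ S := by
      intro g l hg
      have : (⟨(g, l), hg⟩ : Q.Corner v) = x₀ ∨ (⟨(g, l), hg⟩ : Q.Corner v) = x₁ := by
        rcases hall x₀ with h | h <;> rcases hall x₁ with h' | h'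
        · exact absurd (h.trans h'.symm) hx
        · rw [h, h']; exact hall _
        · rw [h, h']; exact (hall _).symm
        · exact absurd (h.trans h'.symm) hx
      rcases this with h | h
      · have h := congrArg Subtype.val h
        simp only [x₀, Prod.mk.injEq] at h
        rw [h.1, h.2]; exact hP
      · have h : (g, l) = C.t v := congrArg Subtype.val h
        have h2 := hT f k hP
        rw [← hv, ← h] at h2
        exact h2
    obtain ⟨hposS, hES⟩ := hstd.twist v hbd hc hallT
    have hz := h0 _ ⟨C.pos_mem_basic v, hposS⟩
    have hzE : ∀ w, Q.Adj v w → Z (Q.ptE v w) = 0 := fun w hw =>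
      hZ.ptE_eq_zero (C.adj_a v) (C.adj_b v) (C.cross2_ne v) hz
        (h0 _ ⟨hEa v, hES _ (C.adj_a v)⟩) (h0 _ ⟨hEb v, hES _ (C.adj_b v)⟩) hw
    -- With both T-points fixed, non-colinear boundary edges would make the vertex D-relevant.
    -- Colinearity removes the D-point from the twist equation, so one T-value determines the other.
    have hcol : cross2 (Q.dir v c.rgt) (Q.dir v d.lft) = 0 := by
      by_contra hne
      refine hrel v ⟨hbd, hc, ⟨c.rgt, d.lft, ⟨c.adj_rgt, fun h => ?_⟩, ⟨d.adj_lft, fun h => ?_⟩,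
        hout, hne⟩, hallT⟩
      · exact hcd (Corner.rgt_injective v ((hin _).mp h))
      · exact hcd (Corner.lft_injective v (hlr.trans ((hin _).mp h).symm))
    have h1 := hZ.twistVal_eq_neg hz hzE hlr (Or.inl hcol)
    have ht : twistVal Z 0 x₁ = 0 := by
      rw [twistVal_zero_eq_zero_iff hz]
      refine h0 _ ⟨(C.ptT_mem_basic _ _).mpr ?_, hallT _ _ (C.vert_t v)⟩
      rintro ⟨-, h | h⟩
      · rw [C.vert_t] at h
        exact h.1 hbd
      · rw [C.vert_t] at h
        exact h rfl
    refine (twistVal_zero_eq_zero_iff hz x₀).mp ?_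
    rcases hall x₁ with h | h <;> rcases hall x₀ with h' | h' <;> rw [h] at ht <;> rw [h'] <;>
      linarith

end TemplateChoice

/-! ### Template choices that prefer fixed control points -/

/-- If two fixed E-points lie on non-colinear edges, they are chosen. If all fixed ones lie on one
line, one of them is completed by any transversal edge. If none is fixed, any corner will do. -/
theorem exists_tangent_choice (Q : QuadMesh V F) (S : Set (ℝ × ℝ)) (v : V) :
    ∃ a b, Q.Adj v a ∧ Q.Adj v b ∧ cross2 (Q.dir v a) (Q.dir v b) ≠ 0 ∧
      ∀ w, Q.Adj v w → Q.ptE v w ∈ S → w ≠ a → w ≠ b → Q.ptE v a ∈ S ∧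
        (Q.ptE v b ∈ S ∨ cross2 (Q.dir v a) (Q.dir v w) = 0) := by
  obtain ⟨c⟩ := Q.exists_corner v
  by_cases h : ∃ a, Q.Adj v a ∧ Q.ptE v a ∈ S
  · obtain ⟨a, ha, haS⟩ := h
    by_cases h' : ∃ b, Q.Adj v b ∧ Q.ptE v b ∈ S ∧ cross2 (Q.dir v a) (Q.dir v b) ≠ 0
    · obtain ⟨b, hb, hbS, hab⟩ := h'
      exact ⟨a, b, ha, hb, hab, fun _ _ _ _ _ => ⟨haS, Or.inl hbS⟩⟩
    · push Not at h'
      have hb : ∃ b, Q.Adj v b ∧ cross2 (Q.dir v a) (Q.dir v b) ≠ 0 := by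
        by_contra! hb
        obtain ⟨r, hr⟩ := exists_smul_eq_of_cross2_eq_zero (Q.dir_ne_zero ha.ne) (hb _ c.adj_rgt)
        have := c.cross2_pos
        rw [hr, cross2_smul_left, hb _ c.adj_lft, mul_zero] at this
        exact lt_irrefl _ this
      obtain ⟨b, hb, hab⟩ := hb
      exact ⟨a, b, ha, hb, hab, fun w hw hwS _ _ => ⟨haS, Or.inr (h' w hw hwS)⟩⟩
  · push Not at h
    exact ⟨c.rgt, c.lft, c.adj_rgt, c.adj_lft, c.cross2_pos.ne', fun w hw hwS =>
      absurd hwS (h w hw)⟩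

theorem exists_twist_choice (Q : QuadMesh V F) (S : Set (ℝ × ℝ)) (v : V) :
    ∃ t : F × Fin 4, Q.vert t.1 t.2 = v ∧
      ∀ f k, Q.vert f k = v → Q.ptT f k ∈ S → Q.ptT t.1 t.2 ∈ S := by
  by_cases h : ∃ t : F × Fin 4, Q.vert t.1 t.2 = v ∧ Q.ptT t.1 t.2 ∈ S
  · obtain ⟨t, h1, h2⟩ := h
    exact ⟨t, h1, fun _ _ _ _ => h2⟩
  · obtain ⟨c⟩ := Q.exists_corner v
    exact ⟨c.1, c.2, fun f k h1 h2 => absurd ⟨(f, k), h1, h2⟩ h⟩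

theorem exists_template [Finite V] [Finite F] (hQ : Q.Limitations) {S : Set (ℝ × ℝ)} (hSC : S ⊆ Q.CP 4)
    (hstd : Q.IsStandardConstraint S) (hrel : ∀ v, ¬ Q.IsDRelevantBoundary S v) :
    ∃ M, Q.IsMDS 4 M ∧ Q.Fits 4 S M ∧ Q.IsTemplateInstance S M := by
  choose a b ha hb hab hE using Q.exists_tangent_choice S
  choose t ht hT using Q.exists_twist_choice S
  have hd : ∀ v, ∃ w, Q.IsFreeEven v → Q.Adj v w ∧ Q.Uses v w ∧ LexPos (Q.dir v w) := by
    intro v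
    by_cases hv : Q.IsFreeEven v
    · obtain ⟨w, hw⟩ := exists_uses_lexPos hQ.uniform hv.1 hv.2.1 hv.2.2
      exact ⟨w, fun _ => hw⟩
    · exact ⟨v, fun h => absurd h hv⟩
  choose d hd using hd
  let C : Q.TemplateChoice := ⟨a, b, t, d, ha, hb, hab, ht, fun v hv => (hd v hv).1,
    fun v hv => (hd v hv).2.1, fun v hv => (hd v hv).2.2⟩
  exact ⟨C.basic, C.isMDS_basic hQ, C.fits hQ hSC hstd hrel hE fun f k h => hT _ f k rfl h,
    C.isTemplateInstance hQ hrel⟩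

/-! ### The standard constraints -/

/-- The vertex of an E-point is recorded as a boundary point as well, since a standard constraint
fixes an E-point of a vertex other than a mesh corner only together with that vertex. -/
theorem mem_boundaryPoints {P : ℝ × ℝ} (hP : P ∈ Q.boundaryPoints 4) :
    (∃ v, P = Q.pos v) ∨ (∃ v w, Q.IsBoundaryEdge v w ∧ P = Q.ptE v w ∧
      Q.pos v ∈ Q.boundaryPoints 4) ∨ ∃ v w, Q.IsBoundaryEdge v w ∧ P = Q.ptD v w := by
  obtain ⟨f, k, h, i, hi, rfl⟩ := hP
  interval_cases i
  · exact Or.inl ⟨_, Q.cpt_zero_zero f k⟩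
  · exact Or.inr (Or.inl ⟨_, _, h, Q.cpt_one_zero f k, f, k, h, 0, by norm_num,
      (Q.cpt_zero_zero f k).symm⟩)
  · exact Or.inr (Or.inr ⟨_, _, h, Q.cpt_two_zero f k⟩)
  · exact Or.inr (Or.inl ⟨_, _, ⟨h.1.symm, fun h' => h.2 h'.symm⟩, Q.cpt_three_zero f k, f, k, h, 4,
      le_rfl, (Q.cpt_four_zero f k).symm⟩)
  · exact Or.inl ⟨_, Q.cpt_four_zero f k⟩

/-- Constraints without `T`-type points. -/
theorem isStandardConstraint_of_subset {S : Set (ℝ × ℝ)}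
    (h : ∀ P ∈ S, (∃ v, P = Q.pos v) ∨ (∃ v w, Q.Adj v w ∧ P = Q.ptE v w ∧ Q.pos v ∈ S) ∨
      ∃ v w, Q.IsBoundaryEdge v w ∧ P = Q.ptD v w) :
    S ⊆ Q.CP 4 ∧ Q.IsStandardConstraint S ∧ ∀ v, ¬ Q.IsDRelevantBoundary S v := by
  have hT : ∀ f k, Q.ptT f k ∉ S := by
    intro f k hS
    rcases h _ hS with ⟨v, e⟩ | ⟨v, w, hw, e, -⟩ | ⟨v, w, hw, e⟩
    · exact ptT_ne_pos _ _ _ e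
    · exact ptT_ne_ptE hw e
    · exact ptT_ne_ptD hw.1 e
  refine ⟨fun P hP => ?_, ⟨fun P hP hG => ?_, fun v w _ hw hS => ?_, fun v _ _ h => ?_⟩,
    fun v h => ?_⟩
  · rcases h P hP with ⟨v, rfl⟩ | ⟨v, w, hw, rfl, -⟩ | ⟨v, w, hw, rfl⟩
    · exact pos_mem_CP Q v
    · exact ptE_mem_CP hw
    · exact ptD_mem_CP hw.1
  · rcases h P hP with ⟨v, e⟩ | ⟨v, w, hw, e, -⟩ | ⟨v, w, hw, rfl⟩
    · exact Or.inl ⟨v, e⟩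
    · exact Or.inr (Or.inl ⟨v, w, hw, e⟩)
    · exact absurd hG (ptD_notMem_GCP hw)
  · rcases h _ hS with ⟨u, e⟩ | ⟨v', w', hw', e, hp⟩ | ⟨v', w', hw', e⟩
    · exact absurd e (ptE_ne_pos hw _)
    · rwa [(ptE_injective hw hw' e).1]
    · exact absurd e (ptE_ne_ptD hw hw'.1)
  · obtain ⟨f, k, e⟩ := Q.exists_vert v
    exact absurd (h f k e) (hT f k)
  · obtain ⟨f, k, e⟩ := Q.exists_vert v
    exact hT f k (h.2.2.2 f k e)

end QuadMesh

/-! ### The main theorem -/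

theorem mainTheorem6 {V F : Type*} [Finite V] [Finite F] (Q : QuadMesh V F)
    (hdom : SimplyConnectedSpace Q.domain) (hQ : Q.Limitations) :
    (∃ M, Q.IsMDS 4 M ∧ Q.IsTemplateInstance ∅ M) ∧
    (∀ S ⊆ Q.CP 4, (∀ v, ¬ Q.IsDRelevantBoundary S v) →
      ∃ M, Q.IsMDS 4 M ∧ Q.Fits 4 S M ∧
        (Q.IsStandardConstraint S → Q.IsTemplateInstance S M)) ∧
    (∀ tangentPlane boundaryCurve : Prop,
      ∃ M, Q.IsMDS 4 M ∧ Q.Fits 4 (Q.interpolationPoints tangentPlane boundaryCurve) M ∧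
        Q.IsTemplateInstance (Q.interpolationPoints tangentPlane boundaryCurve) M) ∧
    (∃ M, Q.IsMDS 4 M ∧ Q.Fits 4 (Q.boundaryPoints 4) M ∧
      Q.IsTemplateInstance (Q.boundaryPoints 4) M) := by
  have key : ∀ S : Set (ℝ × ℝ), (∀ P ∈ S, (∃ v, P = Q.pos v) ∨
      (∃ v w, Q.Adj v w ∧ P = Q.ptE v w ∧ Q.pos v ∈ S) ∨
      ∃ v w, Q.IsBoundaryEdge v w ∧ P = Q.ptD v w) →
      ∃ M, Q.IsMDS 4 M ∧ Q.Fits 4 S M ∧ Q.IsTemplateInstance S M := by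
    intro S hS
    obtain ⟨h1, h2, h3⟩ := QuadMesh.isStandardConstraint_of_subset hS
    exact QuadMesh.exists_template hQ h1 h2 h3
  refine ⟨?_, fun S hS hrel => ?_, fun tangentPlane boundaryCurve => key _ fun P hP => ?_,
    key _ fun P hP => ?_⟩
  · obtain ⟨M, h1, -, h2⟩ := key ∅ fun P hP => absurd hP (Set.notMem_empty P)
    exact ⟨M, h1, h2⟩
  -- A standard constraint is served by the templates. For any other one the template clause is
  -- vacuous, and basis extension supplies the fitting set.
  · by_cases hstd : Q.IsStandardConstraint S
    · obtain ⟨M, h1, h2, h3⟩ := QuadMesh.exists_template hQ hS hstd hrel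
      exact ⟨M, h1, h2, fun _ => h3⟩
    · obtain ⟨M, h1, h2⟩ := QuadMesh.exists_isMDS_fits hS
      exact ⟨M, h1, h2, fun h => absurd h hstd⟩
  · rcases hP with ⟨v, rfl⟩ | ⟨-, v, w, hw, rfl⟩ | ⟨-, hP⟩
    · exact Or.inl ⟨v, rfl⟩
    -- Interpolation fixes every vertex, hence the vertex of each fixed E-point.
    · exact Or.inr (Or.inl ⟨v, w, hw, rfl, Or.inl ⟨v, rfl⟩⟩)
    · rcases QuadMesh.mem_boundaryPoints hP with h | ⟨v, w, hw, e, -⟩ | h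
      · exact Or.inl h
      · exact Or.inr (Or.inl ⟨v, w, hw.1, e, Or.inl ⟨v, rfl⟩⟩)
      · exact Or.inr (Or.inr h)
  · rcases QuadMesh.mem_boundaryPoints hP with h | ⟨v, w, hw, e, hp⟩ | h
    · exact Or.inl h
    · exact Or.inr (Or.inl ⟨v, w, hw.1, e, hp⟩)
    · exact Or.inr (Or.inr h)
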